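/- **Setting.** Let $\mathcal X\subset\mathbb R^{d_x}$ and $\mathcal A\subset\mathbb R^{d_a}$ be finite and non-empty, $d=d_x+d_a$, $M=\#\mathcal X\cdot\#\mathcal A$; write $\xi=(x,a)\in\mathcal X\times\mathcal A\subset\mathbb R^d$. Consider a Markov decision process with transition probabilities $p(x'|\xi)$, initial distribution $\rho_0$ on $\mathcal X\times\mathcal A$, reward $r:\mathcal X\times\mathcal A\to[-1,1]$ and discount factor $\gamma\in(0,1)$. Put $\tilde p(x'|\xi)=\gamma p(x'|\xi)+(1-\gamma)\sum_a\rho_0(x',a)$. For a policy $f$ that gives positive probability $f(x,a)$ to every action, let $(\mathcal M,f)$ and $(\mathcal M,f)_{\rm aux}$ be the Markov chains on $\mathcal X\times\mathcal A$ with transition probabilities $p(x'|\xi)f(x',a')$ and $\tilde p(x'|\xi)f(x',a')$. Assume that for all such $f$ both chains are irreducible and aperiodic, and denote their stationary distributions by $\pi^f$ and $\sigma^f_{\rho_0}$ (the latter is the normalised discounted visiting measure); assume that there is a constant $C$ with $\max(d_{TV}(\pi^f,\pi^{f'}),d_{TV}(\sigma^f_{\rho_0},\sigma^{f'}_{\rho_0}))\le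 C\,d_{TV}(f,f')$ for all such $f,f'$, where $d_{TV}(u,v)=\frac12\sum_\xi|u(\xi)-v(\xi)|$. Let $\sigma\in C^2(\mathbb R)$ with $|\sigma|,|\sigma'|,|\sigma''|\le1$. Let $\nu_0$ be a probability measure on $\mathbb R^{1+d}$, absolutely continuous with respect to Lebesgue measure, under which the coordinates $c\in\mathbb R$ and $w\in\mathbb R^d$ are independent with mean zero, $|c|\le1$ almost surely and $\mathbb E\|w\|\le1$. Let $\alpha>0$, $T>0$, $\zeta_t=\frac1{1+t}$, $\eta_t=\frac1{1+\log^2(1+t)}$, $\mathsf{clip}(x)=\max(\min(x,2),0)$, and $\mathrm{Softmax}(P)(x,a)=e^{P(x,a)}/\sum_{a'}e^{P(x,a')}$. **Algorithm.** For $N\ge1$ let $(C^i_0,W^i_0,B^i_0,U^i_0)$, $1\le i\le N$, be i.i.d. with law $\nu_0\otimes\nu_0$. For $k\ge0$ set $$P^N_k(\xi)=\tfrac1{\sqrt N}\sum_iB^i_k\sigma(U^i_k\cdot\xi),\quad Q^N_k(\xi)=\tfrac1{\sqrt N}\sum_iC^i_k\sigma(W^i_k\cdot\xi),\quad f^N_k=\mathrm{Softmax}(P^N_k),\quad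 g^N_k=\tfrac{\eta_{k/N}}{\#\mathcal A}+(1-\eta_{k/N})f^N_k .$$ The critic process $(\xi_k)$ and the actor process $(\tilde\xi_k)$ start from $\xi_0\sim\rho_0$, $\tilde\xi_0\sim\rho_0$; given the initial parameters and $(\xi_j,\tilde\xi_j)_{j\le k}$, the pair $\xi_{k+1}=(x',a')$ has conditional law $p(x'|\xi_k)g^N_k(x',a')$, and $\tilde\xi_{k+1}=(x',a')$ has conditional law $\tilde p(x'|\tilde\xi_k)g^N_k(x',a')$. With $\delta_k=r(\xi_k)+\gamma Q^N_k(\xi_{k+1})-Q^N_k(\xi_k)$ and $\tilde\xi_k=(\tilde x_k,\tilde a_k)$ the updates are $$C^i_{k+1}=C^i_k+\tfrac{\alpha}{N^{3/2}}\delta_k\,\sigma(W^i_k\cdot\xi_k),\qquad W^i_{k+1}=W^i_k+\tfrac{\alpha}{N^{3/2}}\delta_k\,C^i_k\sigma'(W^i_k\cdot\xi_k)\,\xi_k,$$ $$B^i_{k+1}=B^i_k+\tfrac{\zeta_{k/N}}{N^{3/2}}\mathsf{clip}(Q^N_k(\tilde\xi_k))\Big[\sigma(U^i_k\cdot\tilde\xi_k)-\sum_{a''}f^N_k(\tilde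 x_k,a'')\sigma(U^i_k\cdot(\tilde x_k,a''))\Big],$$ $$U^i_{k+1}=U^i_k+\tfrac{\zeta_{k/N}}{N^{3/2}}\mathsf{clip}(Q^N_k(\tilde\xi_k))\,B^i_k\Big[\sigma'(U^i_k\cdot\tilde\xi_k)\tilde\xi_k-\sum_{a''}f^N_k(\tilde x_k,a'')\sigma'(U^i_k\cdot(\tilde x_k,a''))(\tilde x_k,a'')\Big].$$ Let $\mu^N_k=\frac1N\sum_i\delta_{(B^i_k,U^i_k)}$, $\nu^N_k=\frac1N\sum_i\delta_{(C^i_k,W^i_k)}$, and for $t\in[0,T]$ let $(\mu^N_t,\nu^N_t,P^N_t,Q^N_t)$ be $(\mu^N_k,\nu^N_k,P^N_k,Q^N_k)$ at $k=\lfloor Nt\rfloor$. Let $E=\mathcal M(\mathbb R^{1+d})^2\times\mathbb R^M\times\mathbb R^M$, where $\mathcal M(\mathbb R^{1+d})$ is the space of probability measures with the topology of weak convergence, and let $D_E([0,T])$ be the space of càdlàg paths with the Skorokhod topology. Define $$A_{\xi,\xi'}=\int\big[\sigma(w\cdot\xi')\sigma(w\cdot\xi)+c^2\sigma'(w\cdot\xi')\sigma'(w\cdot\xi)(\xi\cdot\xi')\big]\nu_0(dc,dw).$$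 **Theorem.** As $N\to\infty$, $(P^N_0,Q^N_0)$ converges weakly to $(\mathcal G,\mathcal H)$, where $\mathcal G,\mathcal H$ are independent, jointly Gaussian, mean-zero random vectors in $\mathbb R^M$, each with covariance $\int c^2\sigma(w\cdot\xi)\sigma(w\cdot\xi')\nu_0(dc,dw)$; and the process $(\mu^N_t,\nu^N_t,P^N_t,Q^N_t)_{0\le t\le T}$ converges weakly in $D_E([0,T])$ to the process $(\mu_t,\nu_t,P_t,Q_t)_{0\le t\le T}$ that satisfies, for all $t\in[0,T]$ and $\xi\in\mathcal X\times\mathcal A$, the random ODE system $$\frac{dQ_t}{dt}(\xi)=\alpha\sum_{\xi'}A_{\xi,\xi'}\Big(r(\xi')+\gamma\sum_{z,a''}Q_t(z,a'')g_t(z,a'')p(z|\xi')-Q_t(\xi')\Big)\pi^{g_t}(\xi'),$$ $$\frac{dP_t}{dt}(\xi)=\sum_{\xi'=(x',a')}\zeta_t\,\mathsf{clip}(Q_t(\xi'))\Big[A_{\xi,\xi'}-\sum_{a''}f_t(x',a'')A_{\xi,(x',a'')}\Big]\sigma^{g_t}_{\rho_0}(\xi'),$$ $$P_0=\mathcal G,\quad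 Q_0=\mathcal H,\quad \mu_t=\nu_t=\nu_0,\qquad f_t=\mathrm{Softmax}(P_t),\quad g_t=\tfrac{\eta_t}{\#\mathcal A}+(1-\eta_t)f_t.$$ For every initial condition in $\mathbb R^M\times\mathbb R^M$ this system has exactly one solution on $[0,T]$. -/

import Mathlib

open MeasureTheory ProbabilityTheory Filter Topology
open scoped ENNReal

noncomputable section

/-! ### The Skorokhod space `D_E([0,T])` -/

/-- Càdlàg paths `[0,T] → E`: right-continuous with left limits. -/
structure CadlagPath (T : ℝ) (E : Type*) [TopologicalSpace E] where
  /-- The underlying path. -/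
  toFun : Set.Icc (0 : ℝ) T → E
  right_continuous : ∀ t, ContinuousWithinAt toFun (Set.Ici t) t
  left_limit : ∀ t, ∃ l, Tendsto toFun (𝓝[<] t) (𝓝 l)

namespace CadlagPath

variable {T : ℝ} {E : Type*}

instance [TopologicalSpace E] : CoeFun (CadlagPath T E) (fun _ => Set.Icc (0 : ℝ) T → E) :=
  ⟨CadlagPath.toFun⟩

/-- The cost of a time change `l` (an increasing bijection of `[0,T]`) between two paths:
the larger of `sup_t |l t - t|` and `sup_t d(x t, y (l t))`. -/
def cost [PseudoEMetricSpace E] (x y : CadlagPath T E)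
    (l : Set.Icc (0 : ℝ) T ≃o Set.Icc (0 : ℝ) T) : ℝ≥0∞ :=
  max (⨆ t, edist (l t) t) (⨆ t, edist (x t) (y (l t)))

/-- The Skorokhod (`J₁`) distance
`d(x,y) = inf_l max (sup_t |l t - t|, sup_t d(x t, y (l t)))`. -/
instance [PseudoEMetricSpace E] : PseudoEMetricSpace (CadlagPath T E) where
  edist x y := ⨅ l, cost x y l
  edist_self x := by
    refine le_antisymm (iInf_le_of_le (OrderIso.refl _) ?_) zero_le
    simp [cost]
  edist_comm := by
    have key : ∀ x y : CadlagPath T E, (⨅ l, cost x y l) ≤ ⨅ l, cost y x l := by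
      intro x y
      refine le_iInf fun l => iInf_le_of_le l.symm ?_
      refine max_le_max (iSup_le fun t => ?_) (iSup_le fun t => ?_)
      · have h := le_iSup (fun t => edist (l t) t) (l.symm t)
        rw [OrderIso.apply_symm_apply, edist_comm] at h
        exact h
      · have h := le_iSup (fun t => edist (y t) (x (l t))) (l.symm t)
        rw [OrderIso.apply_symm_apply, edist_comm] at h
        exact h
    exact fun x y => le_antisymm (key x y) (key y x)
  edist_triangle x y z := by
    rw [ENNReal.iInf_add]
    refine le_iInf fun l => ?_
    rw [ENNReal.add_iInf]
    refine le_iInf fun l' => iInf_le_of_le (l.trans l') (max_le ?_ ?_)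
    · refine iSup_le fun t => (edist_triangle _ (l t) _).trans ?_
      rw [add_comm]
      exact add_le_add (le_max_of_le_left (le_iSup (fun t => edist (l t) t) t))
        (le_max_of_le_left (le_iSup (fun t => edist (l' t) t) (l t)))
    · refine iSup_le fun t => (edist_triangle _ (y (l t)) _).trans ?_
      exact add_le_add (le_max_of_le_right (le_iSup (fun t => edist (x t) (y (l t))) t))
        (le_max_of_le_right (le_iSup (fun t => edist (y t) (z (l' t))) (l t)))

/-- The Borel `σ`-algebra of the Skorokhod topology. -/
instance [PseudoEMetricSpace E] : MeasurableSpace (CadlagPath T E) := borel _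

instance [PseudoEMetricSpace E] : BorelSpace (CadlagPath T E) := ⟨rfl⟩

/-- The path `t ↦ Y ⌊n t⌋` on `[0,T]`. -/
def ofSeq [TopologicalSpace E] (T : ℝ) (n : ℕ) (Y : ℕ → E) : CadlagPath T E where
  toFun t := Y ⌊(n : ℝ) * t⌋₊
  right_continuous t := by
    have h1 : Tendsto (fun s : Set.Icc (0 : ℝ) T => (n : ℝ) * s) (𝓝[≥] t) (𝓝[≥] ((n : ℝ) * t)) := by
      refine tendsto_nhdsWithin_iff.2 ⟨?_, ?_⟩
      · exact (Continuous.tendsto (by fun_prop) t).mono_left nhdsWithin_le_nhds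
      · filter_upwards [self_mem_nhdsWithin] with s hs
        exact mul_le_mul_of_nonneg_left (show (t : ℝ) ≤ s from hs) n.cast_nonneg
    have h2 := (tendsto_floor_right_pure_floor ((n : ℝ) * t)).comp h1
    exact ((tendsto_pure_nhds (fun k : ℤ => Y k.toNat) _).comp h2)
  left_limit t := by
    rcases Nat.eq_zero_or_pos n with rfl | hn
    · exact ⟨Y 0, by simpa using tendsto_const_nhds⟩
    have h1 : Tendsto (fun s : Set.Icc (0 : ℝ) T => (n : ℝ) * s) (𝓝[<] t) (𝓝[<] ((n : ℝ) * t)) := by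
      refine tendsto_nhdsWithin_iff.2 ⟨?_, ?_⟩
      · exact (Continuous.tendsto (by fun_prop) t).mono_left nhdsWithin_le_nhds
      · filter_upwards [self_mem_nhdsWithin] with s hs
        exact mul_lt_mul_of_pos_left (show (s : ℝ) < t from hs) (by exact_mod_cast hn)
    have h2 := (tendsto_floor_left_pure_ceil_sub_one ((n : ℝ) * t)).comp h1
    exact ⟨_, (tendsto_pure_nhds (fun k : ℤ => Y k.toNat) _).comp h2⟩

end CadlagPath

/-! ### Markov decision processes -/

/-- A Markov decision process with finite state space `X ⊆ ℝ^dx` and finite action space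
`A ⊆ ℝ^da`, transition kernel `p (x, a) x'`, initial distribution `ρ₀` on state-action pairs,
rewards in `[-1,1]` and discount factor `γ ∈ (0,1)`. -/
structure MDP (dx da : ℕ) where
  /-- State space. -/
  X : Finset (EuclideanSpace ℝ (Fin dx))
  /-- Action space. -/
  A : Finset (EuclideanSpace ℝ (Fin da))
  X_nonempty : X.Nonempty
  A_nonempty : A.Nonempty
  /-- Transition probabilities. -/
  p : X × A → X → ℝ
  p_nonneg : ∀ ξ x', 0 ≤ p ξ x'
  p_sum : ∀ ξ, ∑ x', p ξ x' = 1
  /-- Initial distribution. -/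
  ρ₀ : X × A → ℝ
  ρ₀_nonneg : ∀ ξ, 0 ≤ ρ₀ ξ
  ρ₀_sum : ∑ ξ, ρ₀ ξ = 1
  /-- Reward. -/
  r : X × A → ℝ
  r_bound : ∀ ξ, |r ξ| ≤ 1
  /-- Discount factor. -/
  γ : ℝ
  γ_pos : 0 < γ
  γ_lt_one : γ < 1

/-- A finite chain with transition matrix `K` is aperiodic: for every state, the gcd of the set of
possible return times is `1`. -/
def Aperiodic {ι : Type*} [Fintype ι] [DecidableEq ι] (K : Matrix ι ι ℝ) : Prop :=
  ∀ i, ∀ d : ℕ, (∀ n, 0 < n → 0 < (K ^ n) i i → d ∣ n) → d = 1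

/-- `π` is a stationary probability distribution of the transition matrix `K`. -/
structure IsStationaryDist {ι : Type*} [Fintype ι] (K : Matrix ι ι ℝ) (π : ι → ℝ) : Prop where
  nonneg : ∀ i, 0 ≤ π i
  sum_eq_one : ∑ i, π i = 1
  invariant : ∀ j, ∑ i, π i * K i j = π j

/-- The stationary distribution of `K` (meaningful when it exists and is unique, as it does for an
irreducible finite chain). -/
def statDist {ι : Type*} [Fintype ι] (K : Matrix ι ι ℝ) : ι → ℝ :=
  Classical.epsilon (IsStationaryDist K)

/-- Total variation distance `½ ∑ |f - f'|`. -/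
def dTV {ι : Type*} [Fintype ι] (f f' : ι → ℝ) : ℝ := (1 / 2) * ∑ i, |f i - f' i|

namespace MDP

variable {dx da : ℕ} (M : MDP dx da)

/-- State-action pairs `ξ = (x, a)`. -/
abbrev SA : Type := M.X × M.A

instance : Nonempty M.X := M.X_nonempty.to_subtype
instance : Nonempty M.A := M.A_nonempty.to_subtype

/-- A policy: `f (x, a)` is the probability of the action `a` in the state `x`; here every action
has positive probability. -/
structure IsPositivePolicy (f : M.SA → ℝ) : Prop where
  pos : ∀ ξ, 0 < f ξ
  sum_eq_one : ∀ x, ∑ a, f (x, a) = 1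

/-- Transition matrix of the chain of state-action pairs induced by the policy `f`. -/
def chain (f : M.SA → ℝ) : Matrix M.SA M.SA ℝ := fun ξ ξ' => M.p ξ ξ'.1 * f ξ'

/-- Transition probabilities that restart from the state marginal of `ρ₀` with probability `1-γ`. -/
def pAux (ξ : M.SA) (x' : M.X) : ℝ := M.γ * M.p ξ x' + (1 - M.γ) * ∑ a, M.ρ₀ (x', a)

/-- Transition matrix of the auxiliary chain induced by the policy `f`. -/
def auxChain (f : M.SA → ℝ) : Matrix M.SA M.SA ℝ := fun ξ ξ' => M.pAux ξ ξ'.1 * f ξ'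

/-- `π^f`: the stationary distribution of the chain induced by `f`. -/
def stat (f : M.SA → ℝ) : M.SA → ℝ := statDist (M.chain f)

/-- `σ^f_{ρ₀}`: the (normalised) state-action visiting measure, that is, the stationary
distribution of the auxiliary chain induced by `f`. -/
def visit (f : M.SA → ℝ) : M.SA → ℝ := statDist (M.auxChain f)

open Classical in
/-- Ergodicity of the MDP: for every policy that selects all actions with positive probability, the
induced chain and the induced auxiliary chain are irreducible and aperiodic; moreover their
stationary distributions are Lipschitz in the policy for the total variation distance. -/
structure IsErgodic : Prop where
  irreducible : ∀ f, M.IsPositivePolicy f → (M.chain f).IsIrreducible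
  aperiodic : ∀ f, M.IsPositivePolicy f → Aperiodic (M.chain f)
  aux_irreducible : ∀ f, M.IsPositivePolicy f → (M.auxChain f).IsIrreducible
  aux_aperiodic : ∀ f, M.IsPositivePolicy f → Aperiodic (M.auxChain f)
  lipschitz : ∃ C : ℝ, ∀ f f', M.IsPositivePolicy f → M.IsPositivePolicy f' →
    max (dTV (M.stat f) (M.stat f')) (dTV (M.visit f) (M.visit f')) ≤ C * dTV f f'

end MDP

/-! ### The online actor-critic algorithm -/

/-- `ℝ^d` with `d = dx + da`. -/
abbrev Weight (dx da : ℕ) : Type := EuclideanSpace ℝ (Fin dx ⊕ Fin da)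

/-- Parameters `(c, w) ∈ ℝ^{1+d}` of one hidden unit. -/
abbrev HiddenUnit (dx da : ℕ) : Type := ℝ × Weight dx da

/-- The activation function is `C²`, and it and its first two derivatives are bounded by `1`. -/
structure IsActivation (act : ℝ → ℝ) : Prop where
  contDiff : ContDiff ℝ 2 act
  bound : ∀ x, |act x| ≤ 1
  bound_deriv : ∀ x, |deriv act x| ≤ 1
  bound_deriv₂ : ∀ x, |deriv (deriv act) x| ≤ 1

/-- Assumptions on the law `ν₀` of the initial parameters `(c, w)` of a hidden unit: `c` and `w` are
independent, `ν₀` is absolutely continuous, `|c| ≤ 1` almost surely, `𝔼‖w‖ ≤ 1`, and `c`, `w` have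
mean zero. -/
structure IsInitLaw {dx da : ℕ} (ν₀ : Measure (HiddenUnit dx da)) : Prop where
  indep : IndepFun Prod.fst Prod.snd ν₀
  absolutelyContinuous : ν₀ ≪ volume
  bound_c : ∀ᵐ z ∂ν₀, |z.1| ≤ 1
  bound_w : ∫⁻ z, ‖z.2‖ₑ ∂ν₀ ≤ 1
  mean_c : ∫ z, z.1 ∂ν₀ = 0
  mean_w : ∫ z, z.2 ∂ν₀ = 0

/-- The learning rate profile of the actor: `ζ_k^N = zeta (k/N)` and `ζ_t = zeta t`. -/
def zeta (t : ℝ) : ℝ := 1 / (1 + t)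

/-- The exploration rate profile: `η_k^N = eta (k/N)` and `η_t = eta t`. -/
def eta (t : ℝ) : ℝ := 1 / (1 + Real.log (t + 1) ^ 2)

/-- `clip x = max (min x 2) 0`. -/
def clip (x : ℝ) : ℝ := max (min x 2) 0

namespace MDP

variable {dx da : ℕ} (M : MDP dx da)

/-- The pair `ξ = (x, a)` as a vector of `ℝ^d`. -/
def vec (ξ : M.SA) : Weight dx da :=
  WithLp.toLp 2 (Sum.elim (fun i => (ξ.1 : EuclideanSpace ℝ (Fin dx)) i)
    (fun j => (ξ.2 : EuclideanSpace ℝ (Fin da)) j))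

/-- `w · ξ`. -/
def dot (w : Weight dx da) (ξ : M.SA) : ℝ := inner ℝ w (M.vec ξ)

/-- `Softmax(P)(x,a) = exp P(x,a) / ∑_{a'} exp P(x,a')`. -/
def softmax (P : M.SA → ℝ) (ξ : M.SA) : ℝ := Real.exp (P ξ) / ∑ a', Real.exp (P (ξ.1, a'))

/-- The exploration policy `η / #A + (1 - η) Softmax(P)`. -/
def explore (η : ℝ) (P : M.SA → ℝ) (ξ : M.SA) : ℝ :=
  η / (Fintype.card M.A) + (1 - η) * M.softmax P ξ

/-- The output `N^{-1/2} ∑ᵢ cᵢ σ(wᵢ · ξ)` of a single-layer network with `N` hidden units. -/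
def net (act : ℝ → ℝ) {N : ℕ} (θ : Fin N → HiddenUnit dx da) (ξ : M.SA) : ℝ :=
  1 / √(N : ℝ) * ∑ i, (θ i).1 * act (M.dot (θ i).2 ξ)

/-- One temporal-difference update of the critic parameters, with learning rate `α^N = α / N`, the
current pair `ξ` and the next pair `ξ'`. -/
def criticStep (act : ℝ → ℝ) (α : ℝ) {N : ℕ} (θ : Fin N → HiddenUnit dx da) (ξ ξ' : M.SA) :
    Fin N → HiddenUnit dx da :=
  let Q := M.net act θ
  let δ := α / N / √(N : ℝ) * (M.r ξ + M.γ * Q ξ' - Q ξ)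
  fun i => ((θ i).1 + δ * act (M.dot (θ i).2 ξ),
    (θ i).2 + (δ * ((θ i).1 * deriv act (M.dot (θ i).2 ξ))) • M.vec ξ)

/-- One policy-gradient update of the actor parameters `θ`, with learning rate `ζ / N`, the critic
output `Q` and the sampled pair `ξ = (x, a)`. -/
def actorStep (act : ℝ → ℝ) (ζ : ℝ) {N : ℕ} (θ : Fin N → HiddenUnit dx da) (Q : M.SA → ℝ) (ξ : M.SA) :
    Fin N → HiddenUnit dx da :=
  let f := M.softmax (M.net act θ)
  let δ := ζ / (N * √(N : ℝ)) * clip (Q ξ)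
  fun i => ((θ i).1 + δ * (act (M.dot (θ i).2 ξ)
      - ∑ a'', f (ξ.1, a'') * act (M.dot (θ i).2 (ξ.1, a''))),
    (θ i).2 + δ • (((θ i).1 * deriv act (M.dot (θ i).2 ξ)) • M.vec ξ
      - ∑ a'', (f (ξ.1, a'') * ((θ i).1 * deriv act (M.dot (θ i).2 (ξ.1, a'')))) •
          M.vec (ξ.1, a'')))

/-- The parameters `(actor, critic)` after `k` updates, from the initial parameters `θ₀` (actor) and
`ϑ₀` (critic), along the critic samples `ξ` and the actor samples `ξt`. -/
def params (act : ℝ → ℝ) (α : ℝ) {N : ℕ} (θ₀ ϑ₀ : Fin N → HiddenUnit dx da) (ξ ξt : ℕ → M.SA) :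
    ℕ → (Fin N → HiddenUnit dx da) × (Fin N → HiddenUnit dx da)
  | 0 => (θ₀, ϑ₀)
  | k + 1 =>
    let s := params act α θ₀ ϑ₀ ξ ξt k
    (M.actorStep act (zeta ((k : ℝ) / N)) s.1 (M.net act s.2) (ξt k),
      M.criticStep act α s.2 (ξ k) (ξ (k + 1)))

/-- The random inputs of the algorithm with `N` hidden units on a sample space `Ω`. -/
structure NACData (N : ℕ) (Ω : Type*) where
  /-- Initial actor parameters `(Bᵢ, Uᵢ)`. -/
  θ₀ : Ω → Fin N → HiddenUnit dx da
  /-- Initial critic parameters `(Cᵢ, Wᵢ)`. -/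
  ϑ₀ : Ω → Fin N → HiddenUnit dx da
  /-- Critic process. -/
  ξ : ℕ → Ω → M.SA
  /-- Actor process. -/
  ξt : ℕ → Ω → M.SA

namespace NACData

variable {M} {N : ℕ} {Ω : Type*} (D : M.NACData N Ω) (act : ℝ → ℝ) (α : ℝ)

/-- The parameters (actor, critic) after `k` updates. -/
def state (k : ℕ) (ω : Ω) : (Fin N → HiddenUnit dx da) × (Fin N → HiddenUnit dx da) :=
  M.params act α (D.θ₀ ω) (D.ϑ₀ ω) (fun j => D.ξ j ω) (fun j => D.ξt j ω) k

/-- The actor output `P_k^N`. -/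
def P (k : ℕ) (ω : Ω) : M.SA → ℝ := M.net act (D.state act α k ω).1

/-- The critic output `Q_k^N`. -/
def Q (k : ℕ) (ω : Ω) : M.SA → ℝ := M.net act (D.state act α k ω).2

/-- The exploration policy `g_k^N`. -/
def g (k : ℕ) (ω : Ω) : M.SA → ℝ := M.explore (eta ((k : ℝ) / N)) (D.P act α k ω)

/-- The history `σ(θ₀, ϑ₀, ξ_j, ξt_j : j ≤ k)`. -/
@[reducible]
def history (k : ℕ) : MeasurableSpace Ω :=
  MeasurableSpace.comap
    (fun ω => (D.θ₀ ω, D.ϑ₀ ω, fun j : Fin (k + 1) => (D.ξ j ω, D.ξt j ω))) inferInstance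

/-- `D` is a realization of the online actor-critic algorithm on the probability space `(Ω, Pr)`:
the initial parameters `(Cᵢ, Wᵢ, Bᵢ, Uᵢ)` are i.i.d. with law `ν₀ ⊗ ν₀`; the initial pairs have law
`ρ₀`; given the history up to step `k`, the next critic pair has law `p(x' | ξ_k) g_k(x', a')`, and
the next actor pair has law `p̃(x' | ξt_k) g_k(x', a')`. (The joint conditional law of the two next
pairs is arbitrary; in particular they may be sampled independently.) -/
structure IsOnlineNAC [MeasurableSpace Ω] (ν₀ : Measure (HiddenUnit dx da)) (Pr : Measure Ω) :
    Prop where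
  measurable_θ₀ : Measurable D.θ₀
  measurable_ϑ₀ : Measurable D.ϑ₀
  measurable_ξ : ∀ k, Measurable (D.ξ k)
  measurable_ξt : ∀ k, Measurable (D.ξt k)
  init_indep : iIndepFun (fun i ω => (D.ϑ₀ ω i, D.θ₀ ω i)) Pr
  init_law : ∀ i, Pr.map (fun ω => (D.ϑ₀ ω i, D.θ₀ ω i)) = ν₀.prod ν₀
  ξ_zero : ∀ y, Pr.real {ω | D.ξ 0 ω = y} = M.ρ₀ y
  ξt_zero : ∀ y, Pr.real {ω | D.ξt 0 ω = y} = M.ρ₀ y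
  ξ_succ : ∀ k y, Pr[{ω | D.ξ (k + 1) ω = y}.indicator (fun _ => (1 : ℝ)) | D.history k]
    =ᵐ[Pr] fun ω => M.p (D.ξ k ω) y.1 * D.g act α k ω y
  ξt_succ : ∀ k y, Pr[{ω | D.ξt (k + 1) ω = y}.indicator (fun _ => (1 : ℝ)) | D.history k]
    =ᵐ[Pr] fun ω => M.pAux (D.ξt k ω) y.1 * D.g act α k ω y

end NACData

/-! ### The time-rescaled process -/

/-- The state space `E = 𝓜(ℝ^{1+d}) × 𝓜(ℝ^{1+d}) × ℝ^M × ℝ^M`, where the spaces of probability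
measures carry the Lévy-Prokhorov metric (which metrizes weak convergence). -/
abbrev E : Type :=
  LevyProkhorov (ProbabilityMeasure (HiddenUnit dx da)) ×
    LevyProkhorov (ProbabilityMeasure (HiddenUnit dx da)) × (M.SA → ℝ) × (M.SA → ℝ)

end MDP

/-- The empirical measure `N⁻¹ ∑ᵢ δ_{θᵢ}`. -/
def empirical {S : Type*} [MeasurableSpace S] (N : ℕ+) (θ : Fin N → S) : ProbabilityMeasure S :=
  ⟨((N : ℕ) : ℝ≥0∞)⁻¹ • ∑ i, Measure.dirac (θ i), ⟨by
    simp [ENNReal.inv_mul_cancel]⟩⟩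

namespace MDP

variable {dx da : ℕ} (M : MDP dx da)

/-- The process `t ↦ (μ_t^N, ν_t^N, P_t^N, Q_t^N)`, `0 ≤ t ≤ T`, where `(·)_t^N` is the value after
`⌊N t⌋` updates. -/
def NACData.process {M : MDP dx da} {N : ℕ+} {Ω : Type*} (D : M.NACData N Ω) (act : ℝ → ℝ)
    (α T : ℝ) (ω : Ω) : CadlagPath T M.E :=
  CadlagPath.ofSeq T N fun k =>
    (.ofMeasure (empirical N (D.state act α k ω).1), .ofMeasure (empirical N (D.state act α k ω).2),
      D.P act α k ω, D.Q act α k ω)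

/-! ### The limit system -/

/-- The kernel
`A_{ξ,ξ'} = ∫ σ(w·ξ') σ(w·ξ) + c² σ'(w·ξ') σ'(w·ξ) (ξ·ξ') ν₀(dc,dw)`. -/
def kernelA (act : ℝ → ℝ) (ν₀ : Measure (HiddenUnit dx da)) (ξ ξ' : M.SA) : ℝ :=
  ∫ z, (act (M.dot z.2 ξ') * act (M.dot z.2 ξ)
    + z.1 ^ 2 * (deriv act (M.dot z.2 ξ') * deriv act (M.dot z.2 ξ)
      * inner ℝ (M.vec ξ) (M.vec ξ'))) ∂ν₀

/-- The covariance `∫ c² σ(w·ξ) σ(w·ξ') ν₀(dc,dw)` of the limits of the initial outputs. -/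
def initCov (act : ℝ → ℝ) (ν₀ : Measure (HiddenUnit dx da)) (ξ ξ' : M.SA) : ℝ :=
  ∫ z, z.1 ^ 2 * (act (M.dot z.2 ξ) * act (M.dot z.2 ξ')) ∂ν₀

/-- The right-hand side of the critic equation at time `t`. -/
def criticField (act : ℝ → ℝ) (α : ℝ) (ν₀ : Measure (HiddenUnit dx da)) (t : ℝ) (P Q : M.SA → ℝ)
    (ξ : M.SA) : ℝ :=
  let g := M.explore (eta t) P
  α * ∑ ξ', M.kernelA act ν₀ ξ ξ'
    * (M.r ξ' + M.γ * ∑ y : M.SA, Q y * g y * M.p ξ' y.1 - Q ξ') * M.stat g ξ'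

/-- The right-hand side of the actor equation at time `t`. -/
def actorField (act : ℝ → ℝ) (ν₀ : Measure (HiddenUnit dx da)) (t : ℝ) (P Q : M.SA → ℝ)
    (ξ : M.SA) : ℝ :=
  let g := M.explore (eta t) P
  ∑ ξ', zeta t * clip (Q ξ')
    * (M.kernelA act ν₀ ξ ξ' - ∑ a'', M.softmax P (ξ'.1, a'') * M.kernelA act ν₀ ξ (ξ'.1, a''))
    * M.visit g ξ'

/-- The path `z = (μ, ν, P, Q)` solves the limit system on `[0,T]` with `P_0 = p₀`, `Q_0 = q₀`. -/
def IsLimitPath (act : ℝ → ℝ) (α T : ℝ) (ν₀ : ProbabilityMeasure (HiddenUnit dx da))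
    (p₀ q₀ : M.SA → ℝ) (z : CadlagPath T M.E) : Prop :=
  ∃ P Q : ℝ → M.SA → ℝ,
    (∀ t : Set.Icc (0 : ℝ) T, z t = (.ofMeasure ν₀, .ofMeasure ν₀, P t, Q t)) ∧
    P 0 = p₀ ∧ Q 0 = q₀ ∧
    ∀ t ∈ Set.Icc (0 : ℝ) T, ∀ ξ,
      HasDerivWithinAt (fun s => Q s ξ) (M.criticField act α ν₀ t (P t) (Q t) ξ)
        (Set.Icc 0 T) t ∧
      HasDerivWithinAt (fun s => P s ξ) (M.actorField act ν₀ t (P t) (Q t) ξ)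
        (Set.Icc 0 T) t

end MDP

end

/-! The limit dynamics is deterministic given its starting point, so no tightness argument or
martingale problem is needed. The process is compared, on the same probability space, with the
solution of the limit system that starts from the random outputs `(P_0^N, Q_0^N)` of the finite
network. The two are close in probability, uniformly over starting outputs in a ball
(`MDP.eventually_edist_process_limitPath_lt`). The starting outputs converge in law by the central
limit theorem (`MDP.exists_gaussian_limit`), and the solution map is continuous
(`MDP.continuous_limitPath`). These three facts give weak convergence
(`tendstoInDistribution_of_local_approx`). The networks of different width live on unrelated
probability spaces, and convergence in probability is expressed by the filter `probFilter`.

The comparison rests on a separation of scales. One update moves a hidden unit by `O(N^{-3/2})`,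
hence by `O(N^{-1/2})` during the `N T` updates. The empirical measures therefore stay near `ν₀`,
and the neural tangent kernel of the finite network stays near its initial value, which is near `A`
by the law of large numbers. A second-order expansion of one step shows that `N` times an output
increment is a drift, evaluated at the current outputs and at the current samples of the two chains,
up to a small error (`MDP.exists_outputPath_bounds`).

The samples vary fast and the outputs slowly, so the drift has to be averaged over the stationary
distribution of the chain with the current policy. Exploration makes every policy positive, hence
every chain irreducible. The matrix `1 - K + 1 ⊗ π` is then invertible, and the Poisson equation has
a solution `h` that depends continuously on time and on the outputs (`poissonSol_sub`,
`continuousOn_poissonSol`). With `h`, the sum of the centred drifts becomes a martingale, a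
telescoping boundary term and a sum of small variations of `h` along the slow variable. Doob's
inequality (`measure_exists_le_chainNoise`) and the uniform continuity of `h` on compact sets make
this `o(N)` (`eventually_abs_sum_sub_average_le`).

The outputs thus follow a perturbed Euler scheme for the limit system. Its vector field has linear
growth and is locally Lipschitz, because the stationary distributions are Lipschitz in the policy
(`MDP.isTameField_field`). Such a field has unique global solutions, and the scheme follows them
uniformly on `[0,T]` (`IsTameField.exists_euler_le`). -/

/-! ### Convergence in probability along a sequence of probability spaces -/

section ProbFilter

variable {Ω : ℕ+ → Type*} [∀ N, MeasurableSpace (Ω N)] (Pr : ∀ N, Measure (Ω N))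

/-- The filter of events of `(N, ω)` whose `N`-th section has probability tending to one.
Convergence in probability is convergence along this filter. -/
def probFilter : Filter (Σ N, Ω N) where
  sets := {S | Tendsto (fun N => Pr N {ω | (⟨N, ω⟩ : Σ N, Ω N) ∉ S}) atTop (𝓝 0)}
  univ_sets := by simp
  sets_of_superset {S S'} hS h :=
    tendsto_of_tendsto_of_tendsto_of_le_of_le tendsto_const_nhds hS (fun _ => zero_le)
      fun N => measure_mono fun ω hω hS => hω (h hS)
  inter_sets {S S'} hS hS' := by
    have := hS.add hS'
    rw [add_zero] at this
    refine tendsto_of_tendsto_of_tendsto_of_le_of_le tendsto_const_nhds this (fun _ => zero_le)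
      fun N => (measure_mono ?_).trans (measure_union_le _ _)
    intro ω hω
    by_cases h : (⟨N, ω⟩ : Σ N, Ω N) ∈ S
    · exact Or.inr fun h' => hω ⟨h, h'⟩
    · exact Or.inl h

variable {Pr}

lemma eventually_probFilter {q : (Σ N, Ω N) → Prop} :
    (∀ᶠ p in probFilter Pr, q p) ↔ Tendsto (fun N => Pr N {ω | ¬ q ⟨N, ω⟩}) atTop (𝓝 0) :=
  Iff.rfl

lemma tendsto_fst_probFilter : Tendsto Sigma.fst (probFilter Pr) atTop := by
  intro S hS
  refine (tendsto_congr' ?_).2 tendsto_const_nhds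
  filter_upwards [hS] with N hN
  simp [hN]

lemma eventually_probFilter_of_ae {q : (Σ N, Ω N) → Prop}
    (h : ∀ N, ∀ᵐ ω ∂Pr N, q ⟨N, ω⟩) : ∀ᶠ p in probFilter Pr, q p := by
  rw [eventually_probFilter]
  refine (tendsto_congr fun N => ?_).2 tendsto_const_nhds
  exact ae_iff.1 (h N)

lemma eventually_probFilter_of_le {q : (Σ N, Ω N) → Prop} {u : ℕ+ → ℝ}
    (hu : Tendsto u atTop (𝓝 0)) (h : ∀ N, Pr N {ω | ¬ q ⟨N, ω⟩} ≤ ENNReal.ofReal (u N)) :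
    ∀ᶠ p in probFilter Pr, q p := by
  rw [eventually_probFilter]
  have := ENNReal.tendsto_ofReal hu
  rw [ENNReal.ofReal_zero] at this
  exact tendsto_of_tendsto_of_tendsto_of_le_of_le tendsto_const_nhds this (fun _ => zero_le) h

/-- Between two levels `c' < c` above `liminf w`, the error `v` is eventually smaller than the gap,
while `w` is frequently below the lower level. -/
lemma liminf_le_liminf_of_le_add {u v w : ℕ+ → ℝ≥0∞} (hv : Tendsto v atTop (𝓝 0))
    (h : ∀ N, u N ≤ v N + w N) : liminf u atTop ≤ liminf w atTop := by
  refine le_of_forall_gt_imp_ge_of_dense fun c hc => ?_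
  obtain ⟨c', hc', hcc⟩ := exists_between hc
  have h2 := frequently_lt_of_liminf_lt (by isBoundedDefault) hc'
  refine liminf_le_of_frequently_le ((h2.and_eventually
    (hv.eventually_lt_const (tsub_pos_of_lt hcc))).mono fun N hN => ?_)
  calc u N ≤ v N + w N := h N
    _ ≤ (c - c') + c' := add_le_add hN.2.le hN.1.le
    _ = c := tsub_add_cancel_of_le hcc.le

/-- An exhaustion of the preimage of an open set. -/
lemma exists_isOpen_exhaustion {V S : Type*} [NormedAddCommGroup V] [PseudoEMetricSpace S]
    {Φ : V → S} (hΦ : Continuous Φ) {G : Set S} (hG : IsOpen G) :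
    ∃ O : ℕ → Set V, (∀ n, IsOpen (O n)) ∧ Monotone O ∧ ⋃ n, O n = Φ ⁻¹' G ∧
      ∀ n x, x ∈ O n → ‖x‖ < n ∧ ∀ s, edist s (Φ x) < ((n : ℝ≥0∞) + 1)⁻¹ → s ∈ G := by
  have hmem : ∀ (n : ℕ) (x : V), x ∈ ({x | ‖x‖ < n} ∩
      {x | ((n : ℝ≥0∞) + 1)⁻¹ < Metric.infEDist (Φ x) Gᶜ} : Set V) ↔
      ‖x‖ < n ∧ ((n : ℝ≥0∞) + 1)⁻¹ < Metric.infEDist (Φ x) Gᶜ := fun n x => Iff.rfl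
  -- The norm bound keeps `O n` where the approximation is uniform; the distance to the complement
  -- of `G` leaves room to replace `Φ x` by a nearby point.
  refine ⟨fun n => {x | ‖x‖ < n} ∩
      {x | ((n : ℝ≥0∞) + 1)⁻¹ < Metric.infEDist (Φ x) Gᶜ}, fun n => ?_, ?_, ?_, ?_⟩
  · exact (isOpen_lt continuous_norm continuous_const).inter
      (isOpen_lt continuous_const (Metric.continuous_infEDist.comp hΦ))
  · intro m n hmn x hx
    rw [hmem] at hx ⊢
    refine ⟨hx.1.trans_le (Nat.cast_le.2 hmn), lt_of_le_of_lt ?_ hx.2⟩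
    exact ENNReal.inv_le_inv.2 (by gcongr)
  · ext x
    simp only [Set.mem_iUnion, hmem, Set.mem_preimage]
    constructor
    · rintro ⟨n, -, hn⟩
      by_contra hx
      have : Metric.infEDist (Φ x) Gᶜ = 0 := Metric.infEDist_zero_of_mem hx
      simp [this] at hn
    · intro hx
      have h0 : Metric.infEDist (Φ x) Gᶜ ≠ 0 := fun h =>
        (Metric.mem_iff_infEDist_zero_of_closed hG.isClosed_compl).2 h hx
      obtain ⟨n₁, hn₁⟩ := ENNReal.exists_inv_nat_lt h0
      obtain ⟨n₂, hn₂⟩ := exists_nat_gt ‖x‖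
      refine ⟨max n₁ n₂, hn₂.trans_le (Nat.cast_le.2 (le_max_right _ _)), lt_of_le_of_lt ?_ hn₁⟩
      exact ENNReal.inv_le_inv.2 (le_trans (Nat.cast_le.2 (le_max_left _ _)) le_self_add)
  · intro n x hx
    rw [hmem] at hx
    refine ⟨hx.1, fun s hs => ?_⟩
    by_contra hsG
    have h1 : Metric.infEDist (Φ x) Gᶜ ≤ edist (Φ x) s := Metric.infEDist_le_edist_of_mem hsG
    rw [edist_comm] at h1
    exact absurd (hx.2.trans_le h1) (not_lt.2 hs.le)

/-- If `X_N` converges in distribution and `Y_N` is close to `Φ X_N` in probability, locally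
uniformly in `X_N`, then `Y_N` converges in distribution to the image under `Φ` of the limit. -/
theorem tendstoInDistribution_of_local_approx [∀ N, IsProbabilityMeasure (Pr N)]
    {Ω' : Type*} [MeasurableSpace Ω'] {Pr' : Measure Ω'} [IsProbabilityMeasure Pr']
    {V S : Type*} [NormedAddCommGroup V] [MeasurableSpace V] [BorelSpace V]
    [PseudoEMetricSpace S] [MeasurableSpace S] [BorelSpace S]
    {X : ∀ N, Ω N → V} {Y : ∀ N, Ω N → S} {X' : Ω' → V}
    (hX : TendstoInDistribution X atTop X' Pr Pr') {Φ : V → S} (hΦ : Continuous Φ)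
    (hY : ∀ N, AEMeasurable (Y N) (Pr N))
    (happrox : ∀ R : ℝ, ∀ δ : ℝ≥0∞, 0 < δ → ∀ᶠ p in probFilter Pr,
      ‖X p.1 p.2‖ < R → edist (Y p.1 p.2) (Φ (X p.1 p.2)) < δ) :
    TendstoInDistribution Y atTop (fun ω => Φ (X' ω)) Pr Pr' where
  forall_aemeasurable := hY
  aemeasurable_limit := hΦ.measurable.comp_aemeasurable hX.aemeasurable_limit
  tendsto := by
    refine tendsto_of_forall_isOpen_le_liminf' fun G hG => ?_
    obtain ⟨O, hO, hmono, hunion, hmem⟩ := exists_isOpen_exhaustion hΦ hG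
    have hX'm := hX.aemeasurable_limit
    have hlim : Tendsto (fun n => (Pr'.map X') (O n)) atTop (𝓝 ((Pr'.map X') (Φ ⁻¹' G))) := by
      rw [← hunion]
      exact tendsto_measure_iUnion_atTop hmono
    have hcomp : (Pr'.map (fun ω => Φ (X' ω))) G = (Pr'.map X') (Φ ⁻¹' G) := by
      rw [← Measure.map_apply hΦ.measurable hG.measurableSet,
        AEMeasurable.map_map_of_aemeasurable hΦ.measurable.aemeasurable hX'm]
      rfl
    -- It suffices to treat each `O n`: there `‖X N‖ < n`, so the local approximation applies, and a
    -- point within `1/(n+1)` of `Φ (X N)` lies in `G`. Letting `n → ∞` at the end takes the place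
    -- of tightness.
    refine hcomp.trans_le (le_of_tendsto' hlim fun n => ?_)
    refine (ProbabilityMeasure.le_liminf_measure_open_of_tendsto hX.tendsto (hO n)).trans ?_
    refine liminf_le_liminf_of_le_add
      (eventually_probFilter.1 (happrox n ((n : ℝ≥0∞) + 1)⁻¹ (by simp))) fun N => ?_
    refine (Measure.map_apply_of_aemeasurable (hX.forall_aemeasurable N)
      (hO n).measurableSet).trans_le ?_
    have h2 := Measure.map_apply_of_aemeasurable (hY N) hG.measurableSet
    refine le_trans ?_ (add_le_add_right h2.ge _)
    refine (measure_mono ?_).trans (measure_union_le _ _)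
    intro ω hω
    have h3 := hmem n _ hω
    by_cases hc : edist (Y N ω) (Φ (X N ω)) < ((n : ℝ≥0∞) + 1)⁻¹
    · exact Or.inr (h3.2 _ hc)
    · exact Or.inl fun h => hc (h h3.1)

end ProbFilter

/-! ### A maximal inequality for sums of martingale differences of a finite chain -/

section Martingale

variable {Ω S : Type*} {mΩ : MeasurableSpace Ω} {Pr : Measure Ω} [IsProbabilityMeasure Pr]

/-- A bounded `m`-measurable weight can be pulled out of the conditional expectation. This is how
the conditional law of the next state enters the orthogonality of the increments. -/
lemma integral_mul_eq_of_condExp_eq {m : MeasurableSpace Ω} (hm : m ≤ mΩ) {W f g : Ω → ℝ}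
    (hW : StronglyMeasurable[m] W) {B : ℝ} (hB : ∀ ω, |W ω| ≤ B) (hf : Integrable f Pr)
    (hg : Pr[f | m] =ᵐ[Pr] g) : ∫ ω, W ω * f ω ∂Pr = ∫ ω, W ω * g ω ∂Pr := by
  have h := condExp_stronglyMeasurable_mul_of_bound hm hW hf B (Eventually.of_forall hB)
  have h2 := integral_condExp (μ := Pr) (f := W * f) hm
  calc ∫ ω, W ω * f ω ∂Pr = ∫ ω, (Pr[W * f | m]) ω ∂Pr := h2.symm
    _ = ∫ ω, W ω * g ω ∂Pr := by
        refine integral_congr_ae ?_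
        filter_upwards [h, hg] with ω h1 h2
        rw [h1, Pi.mul_apply, h2]

variable [Fintype S] [MeasurableSpace S] [MeasurableSingletonClass S]

/-- The sums of `a_k(ξ_{k+1}) - ∑_y κ_k(y) a_k(y)`, where `κ_k` is the conditional law of `ξ_{k+1}`
given the history. -/
def chainNoise (a κ : ℕ → Ω → S → ℝ) (ξ : ℕ → Ω → S) (n : ℕ) (ω : Ω) : ℝ :=
  ∑ k ∈ Finset.range n, (a k ω (ξ (k + 1) ω) - ∑ y, κ k ω y * a k ω y)

/-- Doob's maximal inequality for the square of a martingale: the increments are bounded by `2 * B`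
and orthogonal to the past, so the second moment at time `n` is at most `4 * B ^ 2 * n`. -/
theorem measure_exists_le_chainNoise (𝓕 : Filtration ℕ mΩ) {a κ : ℕ → Ω → S → ℝ} {ξ : ℕ → Ω → S}
    {B : ℝ} (hB : 0 ≤ B) (haB : ∀ k ω y, |a k ω y| ≤ B)
    (ha : ∀ k y, Measurable[𝓕 k] fun ω => a k ω y)
    (hκ0 : ∀ k ω y, 0 ≤ κ k ω y) (hκ1 : ∀ k ω, ∑ y, κ k ω y = 1)
    (hκ : ∀ k y, Measurable[𝓕 k] fun ω => κ k ω y)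
    (hξ : ∀ k, Measurable[𝓕 k] (ξ k))
    (hcond : ∀ k y, Pr[{ω | ξ (k + 1) ω = y}.indicator (fun _ => (1 : ℝ)) | 𝓕 k]
      =ᵐ[Pr] fun ω => κ k ω y) {lam : ℝ} (hlam : 0 < lam) (n : ℕ) :
    Pr {ω | ∃ k ≤ n, lam ≤ |chainNoise a κ ξ k ω|} ≤ ENNReal.ofReal (4 * B ^ 2 * n / lam ^ 2) := by
  classical
  set M := chainNoise a κ ξ with hM
  let d : ℕ → Ω → ℝ := fun k ω => a k ω (ξ (k + 1) ω) - ∑ y, κ k ω y * a k ω y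
  have hsucc : ∀ k ω, M (k + 1) ω = M k ω + d k ω := fun k ω => Finset.sum_range_succ _ _
  -- Expanding over the finitely many states expresses the increment through the indicators of the
  -- next state, whose conditional expectations are given, with coefficients measurable for `𝓕 k`.
  have hd_eq : ∀ k ω, d k ω = ∑ y, a k ω y *
      ({ω | ξ (k + 1) ω = y}.indicator (fun _ => (1 : ℝ)) ω - κ k ω y) := by
    intro k ω
    simp only [mul_sub, Finset.sum_sub_distrib, d]
    congr 1
    · simp [Set.indicator_apply]
    · exact Finset.sum_congr rfl fun y _ => mul_comm _ _
  have hd_bound : ∀ k ω, |d k ω| ≤ 2 * B := by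
    intro k ω
    have h2 : |∑ y, κ k ω y * a k ω y| ≤ B := by
      calc |∑ y, κ k ω y * a k ω y| ≤ ∑ y, |κ k ω y * a k ω y| := Finset.abs_sum_le_sum_abs _ _
        _ ≤ ∑ y, κ k ω y * B := by
            refine Finset.sum_le_sum fun y _ => ?_
            rw [abs_mul, abs_of_nonneg (hκ0 k ω y)]
            exact mul_le_mul_of_nonneg_left (haB k ω y) (hκ0 k ω y)
        _ = B := by rw [← Finset.sum_mul, hκ1, one_mul]
    calc |d k ω| ≤ |a k ω (ξ (k + 1) ω)| + |∑ y, κ k ω y * a k ω y| := abs_sub _ _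
      _ ≤ 2 * B := by linarith [haB k ω (ξ (k + 1) ω)]
  have hind_meas : ∀ k y, Measurable[𝓕 (k + 1)]
      ({ω | ξ (k + 1) ω = y}.indicator (fun _ => (1 : ℝ))) := fun k y =>
    measurable_const.indicator (hξ (k + 1) (measurableSet_singleton y))
  have hd_meas : ∀ k, Measurable[𝓕 (k + 1)] (d k) := by
    intro k
    have : d k = fun ω => _ := funext (hd_eq k)
    rw [this]
    have hle := 𝓕.mono (Nat.le_succ k)
    exact Finset.measurable_sum _ fun y _ => ((ha k y).mono hle le_rfl).mul
      ((hind_meas k y).sub ((hκ k y).mono hle le_rfl))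
  have hM_meas : ∀ k, Measurable[𝓕 k] (M k) := by
    intro k
    induction k with
    | zero =>
      have : M 0 = fun _ => 0 := by ext; simp [hM, chainNoise]
      rw [this]; exact measurable_const
    | succ k ih =>
      rw [show M (k + 1) = fun ω => M k ω + d k ω from funext (hsucc k)]
      exact (ih.mono (𝓕.mono (Nat.le_succ k)) le_rfl).add (hd_meas k)
  have hM_bound : ∀ k ω, |M k ω| ≤ k * (2 * B) := by
    intro k ω
    induction k with
    | zero => simp [hM, chainNoise]
    | succ k ih =>
      rw [hsucc]
      push_cast
      linarith [abs_add_le (M k ω) (d k ω), hd_bound k ω]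
  have hbdd_int : ∀ {f : Ω → ℝ} {c : ℝ}, Measurable f → (∀ ω, |f ω| ≤ c) → Integrable f Pr :=
    fun hf hc => Integrable.of_bound hf.aestronglyMeasurable _ (Eventually.of_forall hc)
  -- Each increment is orthogonal to every bounded variable of the past, since `W * a k y` is again
  -- a bounded weight for `𝓕 k`.
  have horth : ∀ k (W : Ω → ℝ) (c : ℝ), Measurable[𝓕 k] W → (∀ ω, |W ω| ≤ c) →
      ∫ ω, W ω * d k ω ∂Pr = 0 := by
    intro k W c hW hc
    have hterm : ∀ y, ∫ ω, W ω * (a k ω y *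
        ({ω | ξ (k + 1) ω = y}.indicator (fun _ => (1 : ℝ)) ω - κ k ω y)) ∂Pr = 0 := by
      intro y
      have hWa : Measurable[𝓕 k] fun ω => W ω * a k ω y := hW.mul (ha k y)
      have hWab : ∀ ω, |W ω * a k ω y| ≤ c * B := fun ω => by
        rw [abs_mul]
        exact mul_le_mul (hc ω) (haB k ω y) (abs_nonneg _) ((abs_nonneg _).trans (hc ω))
      have hi : Integrable ({ω | ξ (k + 1) ω = y}.indicator (fun _ => (1 : ℝ))) Pr :=
        (integrable_const _).indicator
          (((hξ (k + 1)).mono (𝓕.le _) le_rfl) (measurableSet_singleton y))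
      have h1 := integral_mul_eq_of_condExp_eq (𝓕.le k) hWa.stronglyMeasurable hWab hi (hcond k y)
      have hκint : Integrable (fun ω => κ k ω y) Pr :=
        integrable_condExp.congr (hcond k y)
      simp_rw [← mul_assoc, mul_sub]
      rw [integral_sub, h1, sub_self]
      · exact hi.bdd_mul (hWa.mono (𝓕.le k) le_rfl).aestronglyMeasurable
          (Eventually.of_forall hWab)
      · exact hκint.bdd_mul (hWa.mono (𝓕.le k) le_rfl).aestronglyMeasurable
          (Eventually.of_forall hWab)
    simp_rw [hd_eq, Finset.mul_sum]
    rw [integral_finsetSum]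
    · exact Finset.sum_eq_zero fun y _ => hterm y
    · intro y _
      have hκint : Integrable (fun ω => κ k ω y) Pr := integrable_condExp.congr (hcond k y)
      have hi : Integrable ({ω | ξ (k + 1) ω = y}.indicator (fun _ => (1 : ℝ))) Pr :=
        (integrable_const _).indicator
          (((hξ (k + 1)).mono (𝓕.le _) le_rfl) (measurableSet_singleton y))
      have h3 := (hi.sub hκint).bdd_mul (c := c * B)
        (((hW.mul (ha k y)).mono (𝓕.le k) le_rfl).aestronglyMeasurable (μ := Pr))
        (Eventually.of_forall fun ω => by
          change |W ω * a k ω y| ≤ _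
          rw [abs_mul]
          exact mul_le_mul (hc ω) (haB k ω y) (abs_nonneg _) ((abs_nonneg _).trans (hc ω)))
      refine h3.congr (Eventually.of_forall fun ω => ?_)
      simp only [Pi.mul_apply, Pi.sub_apply]
      ring
  have hMsq_int : ∀ k, Integrable (fun ω => M k ω ^ 2) Pr := fun k =>
    hbdd_int (c := (k * (2 * B)) ^ 2) (((hM_meas k).mono (𝓕.le k) le_rfl).pow_const 2) fun ω => by
      rw [abs_pow]; exact pow_le_pow_left₀ (abs_nonneg _) (hM_bound k ω) 2
  have hdsq_int : ∀ k, Integrable (fun ω => d k ω ^ 2) Pr := fun k =>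
    hbdd_int (c := (2 * B) ^ 2) (((hd_meas k).mono (𝓕.le _) le_rfl).pow_const 2) fun ω => by
      rw [abs_pow]; exact pow_le_pow_left₀ (abs_nonneg _) (hd_bound k ω) 2
  have hMd_int : ∀ k, Integrable (fun ω => M k ω * d k ω) Pr := fun k =>
    hbdd_int (c := k * (2 * B) * (2 * B))
      (((hM_meas k).mono (𝓕.le _) le_rfl).mul ((hd_meas k).mono (𝓕.le _) le_rfl)) fun ω => by
        rw [abs_mul]
        exact mul_le_mul (hM_bound k ω) (hd_bound k ω) (abs_nonneg _) (by positivity)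
  have hexp : ∀ k ω, M (k + 1) ω ^ 2 = M k ω ^ 2 + (2 * (M k ω * d k ω) + d k ω ^ 2) := by
    intro k ω; rw [hsucc]; ring
  -- Pythagoras on an event `s` of the past. The added term is nonnegative, which gives the
  -- submartingale property; `s = univ` gives the recursion for the second moments.
  have hset : ∀ k, ∀ s, MeasurableSet[𝓕 k] s →
      ∫ ω in s, M (k + 1) ω ^ 2 ∂Pr = ∫ ω in s, M k ω ^ 2 ∂Pr + ∫ ω in s, d k ω ^ 2 ∂Pr := by
    intro k s hs
    have h0 : ∫ ω in s, M k ω * d k ω ∂Pr = 0 := by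
      rw [← integral_indicator (𝓕.le k s hs)]
      have := horth k (s.indicator (M k)) (k * (2 * B)) ((hM_meas k).indicator hs) fun ω => by
        by_cases hω : ω ∈ s
        · simpa [hω] using hM_bound k ω
        · simp only [hω, not_false_eq_true, Set.indicator_of_notMem, abs_zero]; positivity
      rw [← this]
      refine integral_congr_ae (Eventually.of_forall fun ω => ?_)
      by_cases hω : ω ∈ s <;> simp [hω]
    have h5 : Integrable (fun ω => 2 * (M k ω * d k ω) + d k ω ^ 2) Pr :=
      ((hMd_int k).const_mul 2).add (hdsq_int k)
    simp_rw [hexp]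
    rw [integral_add (hMsq_int k).integrableOn h5.integrableOn,
      integral_add ((hMd_int k).const_mul 2).integrableOn (hdsq_int k).integrableOn,
      integral_const_mul, h0, mul_zero, zero_add]
  have hsub : Submartingale (fun k ω => M k ω ^ 2) 𝓕 Pr := by
    refine submartingale_of_setIntegral_le_succ
      (fun k => ((hM_meas k).pow_const 2).stronglyMeasurable) hMsq_int fun k s hs => ?_
    rw [hset k s hs]
    have : 0 ≤ ∫ ω in s, d k ω ^ 2 ∂Pr := integral_nonneg fun ω => sq_nonneg _
    linarith
  have hvar : ∀ k, ∫ ω, M k ω ^ 2 ∂Pr ≤ 4 * B ^ 2 * k := by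
    intro k
    induction k with
    | zero => simp [hM, chainNoise]
    | succ k ih =>
      have h1 := hset k Set.univ MeasurableSet.univ
      simp only [Measure.restrict_univ] at h1
      have h2 : ∫ ω, d k ω ^ 2 ∂Pr ≤ ∫ _, (2 * B) ^ 2 ∂Pr :=
        integral_mono (hdsq_int k) (integrable_const _) fun ω => by
          have := pow_le_pow_left₀ (abs_nonneg _) (hd_bound k ω) 2
          simpa using this
      simp only [integral_const, probReal_univ, one_smul] at h2
      rw [h1]
      push_cast
      linarith
  have hmax := maximal_ineq (ε := (lam ^ 2).toNNReal) hsub (fun k ω => sq_nonneg _) n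
  have hcoe : ((lam ^ 2).toNNReal : ℝ) = lam ^ 2 := Real.coe_toNNReal _ (by positivity)
  rw [hcoe] at hmax
  set A := {ω | lam ^ 2 ≤ (Finset.range (n + 1)).sup' Finset.nonempty_range_add_one
    fun k => M k ω ^ 2} with hA
  have hsubset : {ω | ∃ k ≤ n, lam ≤ |M k ω|} ⊆ A := by
    rintro ω ⟨k, hk, hl⟩
    refine le_trans ?_ (Finset.le_sup' (fun k => M k ω ^ 2)
      (Finset.mem_range.2 (by omega : k < n + 1)))
    rw [← sq_abs (M k ω)]
    exact pow_le_pow_left₀ hlam.le hl 2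
  have h1 : ∫ ω in A, M n ω ^ 2 ∂Pr ≤ 4 * B ^ 2 * n :=
    (setIntegral_le_integral (hMsq_int n) (Eventually.of_forall fun ω => sq_nonneg _)).trans
      (hvar n)
  have h2 : ENNReal.ofReal (lam ^ 2) * Pr A ≤ ENNReal.ofReal (4 * B ^ 2 * n) :=
    hmax.trans (ENNReal.ofReal_le_ofReal h1)
  refine (measure_mono hsubset).trans ?_
  rw [ENNReal.ofReal_div_of_pos (by positivity), ENNReal.le_div_iff_mul_le
    (Or.inl (by simp [hlam.ne'])) (Or.inl ENNReal.ofReal_ne_top), mul_comm]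
  exact h2

end Martingale

/-! ### Averaging of a slowly varying functional of a chain -/

lemma measurable_comp_finite {Ω S V Y : Type*} {m : MeasurableSpace Ω} [Finite S]
    [MeasurableSpace S] [MeasurableSingletonClass S] [MeasurableSpace V] [MeasurableSpace Y]
    {f : S → V → Y} (hf : ∀ y, Measurable (f y))
    {ξ : Ω → S} (hξ : Measurable ξ) {X : Ω → V} (hX : Measurable X) :
    Measurable fun ω => f (ξ ω) (X ω) := by
  have h : Measurable fun p : S × V => f p.1 p.2 := measurable_from_prod_countable_right hf
  exact h.comp (hξ.prodMk hX)

lemma continuous_of_continuousOn_slab {V : Type*} [TopologicalSpace V] {f : ℝ → V → ℝ}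
    (hf : ContinuousOn (fun p : ℝ × V => f p.1 p.2) (Set.Ici 0 ×ˢ Set.univ)) {t : ℝ} (ht : 0 ≤ t) :
    Continuous (f t) := by
  rw [← continuousOn_univ]
  exact hf.comp (f := fun x => (t, x)) (by fun_prop) fun x _ => ⟨ht, trivial⟩

section Averaging

variable {Ω : ℕ+ → Type*} [mΩ : ∀ N, MeasurableSpace (Ω N)] {Pr : ∀ N, Measure (Ω N)}
  [∀ N, IsProbabilityMeasure (Pr N)]
  {S : Type*} [Fintype S] [MeasurableSpace S] [MeasurableSingletonClass S]
  {V : Type*} [NormedAddCommGroup V] [ProperSpace V] [MeasurableSpace V] [BorelSpace V]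

/-- The averaging principle for a chain `ξ` whose transition matrix `κ` depends on the slow variable
`X`: a functional `ψ` of the transitions of the chain can be replaced by `ψbar`, when the
corresponding Poisson equation has a continuous solution `h`. -/
theorem eventually_abs_sum_sub_average_le {T : ℝ}
    (𝓕 : ∀ N, Filtration ℕ (mΩ N)) {X : ∀ N, ℕ → Ω N → V} {ξ : ∀ N, ℕ → Ω N → S}
    (hX : ∀ N k, Measurable[𝓕 N k] (X N k)) (hξ : ∀ N k, Measurable[𝓕 N k] (ξ N k))
    {κ ψ : ℝ → V → S → S → ℝ} {ψbar : ℝ → V → ℝ} {h : ℝ → V → S → ℝ}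
    (hκ0 : ∀ t, 0 ≤ t → ∀ x y z, 0 ≤ κ t x y z) (hκ1 : ∀ t, 0 ≤ t → ∀ x y, ∑ z, κ t x y z = 1)
    (hκc : ∀ y z, ContinuousOn (fun p : ℝ × V => κ p.1 p.2 y z) (Set.Ici 0 ×ˢ Set.univ))
    (hψc : ∀ y z, ContinuousOn (fun p : ℝ × V => ψ p.1 p.2 y z) (Set.Ici 0 ×ˢ Set.univ))
    (hhc : ∀ y, ContinuousOn (fun p : ℝ × V => h p.1 p.2 y) (Set.Ici 0 ×ˢ Set.univ))
    (hpoisson : ∀ t, 0 ≤ t → ∀ x y, h t x y - ∑ z, κ t x y z * h t x z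
      = ∑ z, κ t x y z * ψ t x y z - ψbar t x)
    (hcond : ∀ N k y, (Pr N)[{ω | ξ N (k + 1) ω = y}.indicator (fun _ => (1 : ℝ)) | 𝓕 N k]
      =ᵐ[Pr N] fun ω => κ ((k : ℝ) / N) (X N k ω) (ξ N k ω) y)
    {G : ∀ N, Set (Ω N)} (hG : ∀ N, MeasurableSet[𝓕 N 0] (G N)) {R : ℝ}
    (hGX : ∀ N, ∀ ω ∈ G N, ∀ k : ℕ, (k : ℝ) ≤ N * T → ‖X N k ω‖ ≤ R)
    (hGd : ∀ N, ∀ ω ∈ G N, ∀ k : ℕ, (k : ℝ) + 1 ≤ N * T →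
      ‖X N (k + 1) ω - X N k ω‖ ≤ R / N) {ε : ℝ} (hε : 0 < ε) :
    ∀ᶠ p in probFilter Pr, p.2 ∈ G p.1 → ∀ n : ℕ, (n : ℝ) ≤ p.1 * T →
      |∑ k ∈ Finset.range n, (ψ ((k : ℝ) / p.1) (X p.1 k p.2) (ξ p.1 k p.2) (ξ p.1 (k + 1) p.2)
        - ψbar ((k : ℝ) / p.1) (X p.1 k p.2))| ≤ ε * p.1 := by
  classical
  rcases lt_or_ge T 0 with hT | hT
  · refine Eventually.of_forall fun p _ n hn => absurd hn (not_le.2 ?_)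
    have : (0 : ℝ) < p.1 := by exact_mod_cast p.1.pos
    have : (p.1 : ℝ) * T < 0 := mul_neg_of_pos_of_neg this hT
    have : (0 : ℝ) ≤ n := n.cast_nonneg
    linarith
  set Kc : Set (ℝ × V) := Set.Icc 0 T ×ˢ Metric.closedBall 0 R with hKc
  have hKcomp : IsCompact Kc := isCompact_Icc.prod (isCompact_closedBall _ _)
  have hKsub : Kc ⊆ Set.Ici 0 ×ˢ Set.univ := fun p hp => ⟨hp.1.1, trivial⟩
  obtain ⟨B₁, hB₁⟩ := hKcomp.exists_bound_of_continuousOn (f := fun p : ℝ × V =>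
    fun yz : S × S => ψ p.1 p.2 yz.1 yz.2)
    (continuousOn_pi.2 fun yz => (hψc yz.1 yz.2).mono hKsub)
  have hhK : ContinuousOn (fun p : ℝ × V => fun y : S => h p.1 p.2 y) Kc :=
    continuousOn_pi.2 fun y => (hhc y).mono hKsub
  obtain ⟨B₂, hB₂⟩ := hKcomp.exists_bound_of_continuousOn hhK
  set B : ℝ := max B₁ 0 + max B₂ 0 with hBdef
  have hB : 0 ≤ B := by positivity
  have hψB : ∀ p ∈ Kc, ∀ y z, |ψ p.1 p.2 y z| ≤ max B₁ 0 := fun p hp y z =>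
    ((norm_le_pi_norm (fun yz : S × S => ψ p.1 p.2 yz.1 yz.2) (y, z)).trans (hB₁ p hp)).trans
      (le_max_left _ _)
  have hhB : ∀ p ∈ Kc, ∀ y, |h p.1 p.2 y| ≤ max B₂ 0 := fun p hp y =>
    ((norm_le_pi_norm (fun y : S => h p.1 p.2 y) y).trans (hB₂ p hp)).trans (le_max_left _ _)
  have hmemK : ∀ N, ∀ ω ∈ G N, ∀ k : ℕ, (k : ℝ) ≤ N * T → ((k : ℝ) / N, X N k ω) ∈ Kc := by
    intro N ω hω k hk
    have hN : (0 : ℝ) < N := by exact_mod_cast N.pos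
    refine ⟨⟨by positivity, ?_⟩, by simpa using hGX N ω hω k hk⟩
    rw [div_le_iff₀ hN]; linarith
  -- The martingale must absorb both `ψ` and `h`. Truncation off `G` and beyond time `T` provides
  -- the deterministic bound `B`, and it keeps `a` measurable for `𝓕 N k` because `G` is an event at
  -- time `0`.
  let a : ∀ N, ℕ → Ω N → S → ℝ := fun N k ω y =>
    if ω ∈ G N ∧ (k : ℝ) ≤ N * T then
      ψ ((k : ℝ) / N) (X N k ω) (ξ N k ω) y + h ((k : ℝ) / N) (X N k ω) y else 0
  let κ' : ∀ N, ℕ → Ω N → S → ℝ := fun N k ω y => κ ((k : ℝ) / N) (X N k ω) (ξ N k ω) y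
  have htime : ∀ (N : ℕ+) (k : ℕ), 0 ≤ (k : ℝ) / N := fun N k => by positivity
  have haB : ∀ N k ω y, |a N k ω y| ≤ B := by
    intro N k ω y
    simp only [a]
    split_ifs with hc
    · have hK := hmemK N ω hc.1 k hc.2
      exact (abs_add_le _ _).trans (add_le_add (hψB _ hK _ _) (hhB _ hK _))
    · simpa using hB
  have ham : ∀ N k y, Measurable[𝓕 N k] fun ω => a N k ω y := by
    intro N k y
    refine Measurable.ite ?_ ?_ measurable_const
    · exact ((𝓕 N).mono (Nat.zero_le k) _ (hG N)).inter (MeasurableSet.const _)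
    · refine Measurable.add ?_ ?_
      · exact measurable_comp_finite (f := fun s x => ψ ((k : ℝ) / N) x s y)
          (fun s => (continuous_of_continuousOn_slab (f := fun t x => ψ t x s y) (hψc s y)
            (htime N k)).measurable)
          (hξ N k) (hX N k)
      · exact (continuous_of_continuousOn_slab (f := fun t x => h t x y) (hhc y)
          (htime N k)).measurable.comp (hX N k)
  have hκm : ∀ N k y, Measurable[𝓕 N k] fun ω => κ' N k ω y := fun N k y =>
    measurable_comp_finite (f := fun s x => κ ((k : ℝ) / N) x s y)
      (fun s => (continuous_of_continuousOn_slab (f := fun t x => κ t x s y) (hκc s y)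
        (htime N k)).measurable)
      (hξ N k) (hX N k)
  -- At most `N * T` variations of `h` are summed, so a bound `ε / (4 * (T + 1))` for each makes
  -- their total at most `ε / 4 * N`.
  obtain ⟨δ, hδ, hunif⟩ := Metric.uniformContinuousOn_iff.1
    (hKcomp.uniformContinuousOn_of_continuous hhK) (ε / (4 * (T + 1))) (by positivity)
  -- About `N * T` bounded increments against the level `ε / 4 * N`: the maximal inequality leaves a
  -- probability of order `1 / N`.
  have hnoise : ∀ᶠ p in probFilter Pr, ∀ k ≤ ⌊(p.1 : ℝ) * T⌋₊,
      |chainNoise (a p.1) (κ' p.1) (ξ p.1) k p.2| < ε / 4 * p.1 := by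
    refine eventually_probFilter_of_le (u := fun N => 4 * B ^ 2 * T / (ε / 4) ^ 2 * (N : ℝ)⁻¹)
      ?_ fun N => ?_
    · rw [← mul_zero (4 * B ^ 2 * T / (ε / 4) ^ 2)]
      refine Tendsto.const_mul _ (tendsto_inv_atTop_zero.comp ?_)
      exact tendsto_natCast_atTop_atTop.comp tendsto_PNat_val_atTop_atTop
    · have hN : (0 : ℝ) < N := by exact_mod_cast N.pos
      have := measure_exists_le_chainNoise (Pr := Pr N) (κ := κ' N) (𝓕 N) hB (haB N) (ham N)
        (fun k ω y => hκ0 _ (htime N k) _ _ _) (fun k ω => hκ1 _ (htime N k) _ _) (hκm N) (hξ N)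
        (hcond N) (lam := ε / 4 * N) (by positivity) ⌊(N : ℝ) * T⌋₊
      refine (measure_mono fun ω hω => ?_).trans (this.trans (ENNReal.ofReal_le_ofReal ?_))
      · simp only [Set.mem_ofPred_eq, not_forall, not_lt] at hω ⊢
        obtain ⟨k, hk, hl⟩ := hω
        exact ⟨k, hk, hl⟩
      · have hfl : (⌊(N : ℝ) * T⌋₊ : ℝ) ≤ N * T := Nat.floor_le (by positivity)
        calc 4 * B ^ 2 * (⌊(N : ℝ) * T⌋₊ : ℝ) / (ε / 4 * N) ^ 2
            ≤ 4 * B ^ 2 * (N * T) / (ε / 4 * N) ^ 2 := by gcongr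
          _ = 4 * B ^ 2 * T / (ε / 4) ^ 2 * (N : ℝ)⁻¹ := by field_simp
  have hlarge : ∀ᶠ p in probFilter Pr, 2 * B ≤ ε / 4 * p.1 ∧ (1 : ℝ) / p.1 < δ ∧ R / p.1 < δ := by
    have hcast : Tendsto (fun p : Σ N, Ω N => (p.1 : ℝ)) (probFilter Pr) atTop :=
      (tendsto_natCast_atTop_atTop.comp tendsto_PNat_val_atTop_atTop).comp tendsto_fst_probFilter
    have h1 := (hcast.const_mul_atTop (by positivity : 0 < ε / 4)).eventually_ge_atTop (2 * B)
    have h2 := (hcast.const_div_atTop 1).eventually_lt_const hδ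
    have h3 := (hcast.const_div_atTop R).eventually_lt_const hδ
    filter_upwards [h1, h2, h3] with p h1 h2 h3 using ⟨h1, h2, h3⟩
  filter_upwards [hnoise, hlarge] with p hp hl hGp n hn
  obtain ⟨N, ω⟩ := p
  simp only at hp hl hGp hn ⊢
  have hN : (0 : ℝ) < N := by exact_mod_cast N.pos
  have hnfl : n ≤ ⌊(N : ℝ) * T⌋₊ := Nat.le_floor hn
  have hK : ∀ k ≤ n, ((k : ℝ) / N, X N k ω) ∈ Kc := fun k hk =>
    hmemK N ω hGp k (le_trans (by exact_mod_cast hk) hn)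
  -- By the Poisson equation, with `K` the transition matrix, `ψ(y,z) - ψbar = (ψ(y,z) + h(z)) - (Kψ
  -- + Kh)(y) + (h(y) - h(z))`. The first two terms form the martingale increment. In the last one,
  -- `h` at step `k` is compared with `h` at step `k + 1`, which leaves a telescoping sum and the
  -- variations of `h`.
  have hdecomp : ∑ k ∈ Finset.range n, (ψ ((k : ℝ) / N) (X N k ω) (ξ N k ω) (ξ N (k + 1) ω)
      - ψbar ((k : ℝ) / N) (X N k ω)) = chainNoise (a N) (κ' N) (ξ N) n ω
      + ((h ((0 : ℕ) / N) (X N 0 ω) (ξ N 0 ω) - h ((n : ℝ) / N) (X N n ω) (ξ N n ω))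
      + ∑ k ∈ Finset.range n, (h (((k + 1 : ℕ) : ℝ) / N) (X N (k + 1) ω) (ξ N (k + 1) ω)
        - h ((k : ℝ) / N) (X N k ω) (ξ N (k + 1) ω))) := by
    rw [← Finset.sum_range_sub' (fun k : ℕ => h ((k : ℝ) / N) (X N k ω) (ξ N k ω)) n, chainNoise,
      ← Finset.sum_add_distrib, ← Finset.sum_add_distrib]
    refine Finset.sum_congr rfl fun k hk => ?_
    have hkn := Finset.mem_range.1 hk
    have hkT : (k : ℝ) ≤ N * T := le_trans (by exact_mod_cast hkn.le) hn
    have ha : ∀ y, a N k ω y = ψ ((k : ℝ) / N) (X N k ω) (ξ N k ω) y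
        + h ((k : ℝ) / N) (X N k ω) y := fun y => if_pos ⟨hGp, hkT⟩
    have hP := hpoisson _ (htime N k) (X N k ω) (ξ N k ω)
    simp only [ha, κ', mul_add, Finset.sum_add_distrib]
    linarith
  rw [hdecomp]
  have h1 := (hp n hnfl).le
  have h2 : |h ((0 : ℕ) / N) (X N 0 ω) (ξ N 0 ω) - h ((n : ℝ) / N) (X N n ω) (ξ N n ω)|
      ≤ 2 * B := by
    have e1 := hhB _ (hK 0 (Nat.zero_le _)) (ξ N 0 ω)
    have e2 := hhB _ (hK n le_rfl) (ξ N n ω)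
    have e3 : max B₂ 0 ≤ B := le_add_of_nonneg_left (le_max_right _ _)
    have e4 := abs_sub (h ((0 : ℕ) / N) (X N 0 ω) (ξ N 0 ω)) (h ((n : ℝ) / N) (X N n ω) (ξ N n ω))
    simp only at e1 e2
    linarith
  have h3 : |∑ k ∈ Finset.range n, (h (((k + 1 : ℕ) : ℝ) / N) (X N (k + 1) ω) (ξ N (k + 1) ω)
        - h ((k : ℝ) / N) (X N k ω) (ξ N (k + 1) ω))| ≤ n * (ε / (4 * (T + 1))) := by
    refine (Finset.abs_sum_le_sum_abs _ _).trans ?_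
    refine (Finset.sum_le_card_nsmul _ _ (ε / (4 * (T + 1))) fun k hk => ?_).trans (by simp)
    have hkn := Finset.mem_range.1 hk
    have hk1 : ((k : ℝ) + 1) ≤ N * T := le_trans (by exact_mod_cast hkn) hn
    have hdist : dist ((((k + 1 : ℕ) : ℝ) / N, X N (k + 1) ω) : ℝ × V)
        ((k : ℝ) / N, X N k ω) < δ := by
      rw [Prod.dist_eq, max_lt_iff]
      constructor
      · simp only [Real.dist_eq]
        rw [← sub_div, Nat.cast_succ, add_sub_cancel_left, abs_of_pos (by positivity)]
        exact hl.2.1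
      · simp only [dist_eq_norm]
        exact (hGd N ω hGp k hk1).trans_lt hl.2.2
    have := hunif _ (hK (k + 1) hkn) _ (hK k hkn.le) hdist
    exact ((dist_le_pi_dist (fun y => h (((k + 1 : ℕ) : ℝ) / N) (X N (k + 1) ω) y)
      (fun y => h ((k : ℝ) / N) (X N k ω) y) (ξ N (k + 1) ω)).trans_lt this).le
  have h4 : n * (ε / (4 * (T + 1))) ≤ ε / 4 * N := by
    calc n * (ε / (4 * (T + 1))) ≤ (N * T) * (ε / (4 * (T + 1))) := by gcongr
      _ = ε / 4 * N * (T / (T + 1)) := by field_simp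
      _ ≤ ε / 4 * N * 1 := by
          gcongr
          rw [div_le_one (by positivity)]
          linarith
      _ = ε / 4 * N := mul_one _
  have h5 := hl.1
  have h6 := abs_add_le (chainNoise (a N) (κ' N) (ξ N) n ω)
    ((h ((0 : ℕ) / N) (X N 0 ω) (ξ N 0 ω) - h ((n : ℝ) / N) (X N n ω) (ξ N n ω))
      + ∑ k ∈ Finset.range n, (h (((k + 1 : ℕ) : ℝ) / N) (X N (k + 1) ω) (ξ N (k + 1) ω)
        - h ((k : ℝ) / N) (X N k ω) (ξ N (k + 1) ω)))
  have h7 := abs_add_le (h ((0 : ℕ) / N) (X N 0 ω) (ξ N 0 ω) - h ((n : ℝ) / N) (X N n ω) (ξ N n ω))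
    (∑ k ∈ Finset.range n, (h (((k + 1 : ℕ) : ℝ) / N) (X N (k + 1) ω) (ξ N (k + 1) ω)
        - h ((k : ℝ) / N) (X N k ω) (ξ N (k + 1) ω)))
  have h8 : 0 < ε * N := by positivity
  linarith

end Averaging

/-! ### Stationary distributions and the Poisson equation of a finite chain -/

section FiniteChain

open Matrix

variable {ι : Type*} [Fintype ι] {K : Matrix ι ι ℝ}

/-- The constant vector is in the kernel of `K - 1`, so there is also a left kernel vector `v`. Then
`|v| ≤ |v| K` coordinatewise while both sides have the same total mass, so `|v|` is invariant and
can be normalised. -/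
lemma exists_isStationaryDist [Nonempty ι] (hK0 : ∀ i j, 0 ≤ K i j) (hK1 : ∀ i, ∑ j, K i j = 1) :
    ∃ π, IsStationaryDist K π := by
  classical
  have hdet : (K - 1).det = 0 := by
    refine Matrix.exists_mulVec_eq_zero_iff.1 ⟨fun _ => 1, ?_, ?_⟩
    · exact fun h => one_ne_zero (congrFun h (Classical.arbitrary ι))
    · rw [Matrix.sub_mulVec, Matrix.one_mulVec]
      ext i
      simp [Matrix.mulVec, dotProduct, hK1]
  obtain ⟨v, hv0, hv⟩ := Matrix.exists_vecMul_eq_zero_iff.2 hdet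
  have hvK : ∀ j, ∑ i, v i * K i j = v j := by
    intro j
    have := congrFun hv j
    rw [Matrix.vecMul_sub, Matrix.vecMul_one] at this
    simp only [Pi.sub_apply, Pi.zero_apply, Matrix.vecMul, dotProduct] at this
    linarith
  have hle : ∀ j, |v j| ≤ ∑ i, |v i| * K i j := by
    intro j
    rw [← hvK j]
    refine (Finset.abs_sum_le_sum_abs _ _).trans_eq (Finset.sum_congr rfl fun i _ => ?_)
    rw [abs_mul, abs_of_nonneg (hK0 i j)]
  have hsum : ∑ j, ∑ i, |v i| * K i j = ∑ j, |v j| := by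
    rw [Finset.sum_comm]
    simp_rw [← Finset.mul_sum, hK1, mul_one]
  have heq : ∀ j, |v j| = ∑ i, |v i| * K i j := fun j =>
    (Finset.sum_eq_sum_iff_of_le fun j _ => hle j).1 hsum.symm j (Finset.mem_univ j)
  have hpos : 0 < ∑ j, |v j| := by
    obtain ⟨j, hj⟩ := Function.ne_iff.1 hv0
    exact Finset.sum_pos' (fun _ _ => abs_nonneg _) ⟨j, Finset.mem_univ j, abs_pos.2 hj⟩
  refine ⟨fun i => |v i| / ∑ j, |v j|, fun i => by positivity, ?_, fun j => ?_⟩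
  · rw [← Finset.sum_div, div_self hpos.ne']
  · simp_rw [div_mul_eq_mul_div]
    rw [← Finset.sum_div, ← heq]

lemma isStationaryDist_statDist [Nonempty ι] (hK0 : ∀ i j, 0 ≤ K i j)
    (hK1 : ∀ i, ∑ j, K i j = 1) : IsStationaryDist K (statDist K) :=
  Classical.epsilon_spec (exists_isStationaryDist hK0 hK1)

/-- Harmonic functions of an irreducible chain are constant. -/
lemma eq_of_harmonic (hK1 : ∀ i, ∑ j, K i j = 1) (hK : K.IsIrreducible) {h : ι → ℝ}
    (hh : K *ᵥ h = h) (i j : ι) : h i = h j := by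
  classical
  have hpow : ∀ n, K ^ n *ᵥ h = h := by
    intro n
    induction n with
    | zero => simp
    | succ n ih => rw [pow_succ, ← Matrix.mulVec_mulVec, hh, ih]
  have hpow1 : ∀ n, K ^ n *ᵥ (fun _ => 1) = fun _ => 1 := by
    intro n
    induction n with
    | zero => simp
    | succ n ih =>
      have : K *ᵥ (fun _ => (1 : ℝ)) = fun _ => 1 := by
        ext i; simp [Matrix.mulVec, dotProduct, hK1]
      rw [pow_succ, ← Matrix.mulVec_mulVec, this, ih]
  have hpow0 : ∀ n i j, 0 ≤ (K ^ n) i j := by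
    intro n
    induction n with
    | zero => intro i j; rw [pow_zero, Matrix.one_apply]; split_ifs <;> norm_num
    | succ n ih =>
      intro i j
      rw [pow_succ, Matrix.mul_apply]
      exact Finset.sum_nonneg fun l _ => mul_nonneg (ih i l) (hK.nonneg l j)
  have hne : (Finset.univ : Finset ι).Nonempty := ⟨i, Finset.mem_univ i⟩
  obtain ⟨m, -, hm⟩ := Finset.exists_max_image Finset.univ h hne
  -- Maximum principle: the maximal value `h m` is the average of `h` with weights `(K ^ n) m`, and
  -- irreducibility supplies an `n` that gives `j` positive weight.
  have key : ∀ j, h j = h m := by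
    intro j
    obtain ⟨n, -, hn⟩ := (Matrix.isIrreducible_iff_exists_pow_pos hK.nonneg).1 hK m j
    have h1 : ∑ l, (K ^ n) m l * (h m - h l) = 0 := by
      have e1 := congrFun (hpow n) m
      have e2 := congrFun (hpow1 n) m
      simp only [Matrix.mulVec, dotProduct, mul_one] at e1 e2
      simp_rw [mul_sub]
      rw [Finset.sum_sub_distrib, ← Finset.sum_mul, e1, e2, one_mul, sub_self]
    have h2 := (Finset.sum_eq_zero_iff_of_nonneg fun l _ =>
      mul_nonneg (hpow0 n m l) (sub_nonneg.2 (hm l (Finset.mem_univ l)))).1 h1 j (Finset.mem_univ j)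
    rcases mul_eq_zero.1 h2 with h3 | h3
    · exact absurd h3 hn.ne'
    · linarith
  rw [key i, key j]

open Classical in
/-- The matrix `1 - K + 1 ⊗ π`, whose inverse solves the Poisson equation of the chain `K`. -/
noncomputable def fundamentalMatrix (K : Matrix ι ι ℝ) (π : ι → ℝ) : Matrix ι ι ℝ :=
  1 - K + Matrix.of fun _ j => π j

lemma fundamentalMatrix_mulVec (K : Matrix ι ι ℝ) (π h : ι → ℝ) :
    fundamentalMatrix K π *ᵥ h = h - K *ᵥ h + fun _ => ∑ j, π j * h j := by
  classical
  unfold fundamentalMatrix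
  rw [Matrix.add_mulVec, Matrix.sub_mulVec]
  congr 1
  congr 1
  convert! Matrix.one_mulVec h

/-- From the left, `π` annihilates `1 - K`, and the rank-one term preserves the `π`-mean. -/
lemma dotProduct_fundamentalMatrix_mulVec {π : ι → ℝ} (hπ : IsStationaryDist K π) (h : ι → ℝ) :
    ∑ i, π i * (fundamentalMatrix K π *ᵥ h) i = ∑ i, π i * h i := by
  have h1 : ∑ i, π i * (K *ᵥ h) i = ∑ j, π j * h j := by
    simp only [Matrix.mulVec, dotProduct, Finset.mul_sum]
    rw [Finset.sum_comm]
    refine Finset.sum_congr rfl fun j _ => ?_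
    rw [← hπ.invariant j, Finset.sum_mul]
    exact Finset.sum_congr rfl fun i _ => by ring
  rw [fundamentalMatrix_mulVec]
  simp only [Pi.add_apply, Pi.sub_apply, mul_add, mul_sub, Finset.sum_add_distrib,
    Finset.sum_sub_distrib]
  rw [h1, ← Finset.sum_mul, hπ.sum_eq_one]
  ring

-- A kernel vector has `π`-mean zero, so it is harmonic, so it is constant, and this constant is its
-- mean.
open Classical in
lemma det_fundamentalMatrix_ne_zero (hK1 : ∀ i, ∑ j, K i j = 1) (hK : K.IsIrreducible) {π : ι → ℝ}
    (hπ : IsStationaryDist K π) : (fundamentalMatrix K π).det ≠ 0 := by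
  intro hdet
  obtain ⟨v, hv0, hv⟩ := Matrix.exists_mulVec_eq_zero_iff.2 hdet
  have h1 := dotProduct_fundamentalMatrix_mulVec hπ v
  rw [hv] at h1
  simp only [Pi.zero_apply, mul_zero, Finset.sum_const_zero] at h1
  rw [fundamentalMatrix_mulVec] at hv
  have hKv : K *ᵥ v = v := by
    ext i
    have := congrFun hv i
    simp only [Pi.add_apply, Pi.sub_apply, Pi.zero_apply, ← h1] at this
    linarith
  refine hv0 (funext fun i => ?_)
  have h2 : ∑ j, π j * v j = v i := by
    simp_rw [fun j => eq_of_harmonic hK1 hK hKv j i]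
    rw [← Finset.sum_mul, hπ.sum_eq_one, one_mul]
  rw [← h2, ← h1, Pi.zero_apply]

open Classical in
/-- The solution of the Poisson equation of the chain `K` with the right-hand side `φ`. -/
noncomputable def poissonSol (K : Matrix ι ι ℝ) (π φ : ι → ℝ) : ι → ℝ :=
  (fundamentalMatrix K π)⁻¹ *ᵥ φ

/-- Inverting the fundamental matrix gives `h - K h + π(h) = φ`, and `π(h) = π(φ)` because the
matrix preserves `π`-means. -/
lemma poissonSol_sub (hK1 : ∀ i, ∑ j, K i j = 1) (hK : K.IsIrreducible) {π : ι → ℝ}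
    (hπ : IsStationaryDist K π) (φ : ι → ℝ) (i : ι) :
    poissonSol K π φ i - ∑ j, K i j * poissonSol K π φ j = φ i - ∑ j, π j * φ j := by
  classical
  have h1 : fundamentalMatrix K π *ᵥ poissonSol K π φ = φ := by
    rw [poissonSol, Matrix.mulVec_mulVec, Matrix.mul_nonsing_inv _
      (isUnit_iff_ne_zero.2 (det_fundamentalMatrix_ne_zero hK1 hK hπ)), Matrix.one_mulVec]
  have h2 := dotProduct_fundamentalMatrix_mulVec hπ (poissonSol K π φ)
  rw [h1] at h2
  rw [fundamentalMatrix_mulVec] at h1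
  have h3 := congrFun h1 i
  simp only [Pi.add_apply, Pi.sub_apply, Matrix.mulVec, dotProduct] at h3
  linarith

-- The inverse is the adjugate divided by the determinant, hence continuous in the entries wherever
-- the determinant does not vanish.
open Classical in
lemma continuousOn_poissonSol {Y : Type*} [TopologicalSpace Y] {s : Set Y} {K : Y → Matrix ι ι ℝ}
    {π φ : Y → ι → ℝ} (hK : ∀ i j, ContinuousOn (fun y => K y i j) s)
    (hπ : ∀ i, ContinuousOn (fun y => π y i) s) (hφ : ∀ i, ContinuousOn (fun y => φ y i) s)
    (hdet : ∀ y ∈ s, (fundamentalMatrix (K y) (π y)).det ≠ 0) (i : ι) :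
    ContinuousOn (fun y => poissonSol (K y) (π y) (φ y) i) s := by
  rw [continuousOn_iff_continuous_domRestrict]
  have hF : Continuous fun y : s => fundamentalMatrix (K y) (π y) := by
    refine continuous_matrix fun i j => ?_
    have h1 := continuousOn_iff_continuous_domRestrict.1 (hK i j)
    have h2 := continuousOn_iff_continuous_domRestrict.1 (hπ j)
    exact (continuous_const.sub h1).add h2
  have hinv : Continuous fun y : s => (fundamentalMatrix (K y) (π y))⁻¹ := by
    simp_rw [Matrix.inv_def, Ring.inverse_eq_inv']
    exact (hF.matrix_det.inv₀ fun y => hdet y y.2).smul hF.matrix_adjugate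
  have hφ' : Continuous fun y : s => φ y :=
    continuous_pi fun i => continuousOn_iff_continuous_domRestrict.1 (hφ i)
  exact (continuous_apply i).comp (hinv.matrix_mulVec hφ')

end FiniteChain

/-! ### Flows of vector fields of linear growth -/

section Cutoff

variable {V : Type*} [NormedAddCommGroup V]

/-- A Lipschitz cutoff: `1` on the ball of radius `R` and `0` outside the ball of radius `R + 1`. -/
noncomputable def cutoff (R : ℝ) (x : V) : ℝ := max 0 (min 1 (R + 1 - ‖x‖))

lemma cutoff_nonneg (R : ℝ) (x : V) : 0 ≤ cutoff R x := le_max_left _ _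

lemma cutoff_le_one (R : ℝ) (x : V) : cutoff R x ≤ 1 := max_le zero_le_one (min_le_left _ _)

lemma cutoff_eq_one {R : ℝ} {x : V} (hx : ‖x‖ ≤ R) : cutoff R x = 1 := by
  rw [cutoff, min_eq_left (by linarith), max_eq_right zero_le_one]

lemma cutoff_eq_zero {R : ℝ} {x : V} (hx : R + 1 ≤ ‖x‖) : cutoff R x = 0 := by
  rw [cutoff, max_eq_left]
  exact (min_le_right _ _).trans (by linarith)

lemma abs_cutoff_sub_le (R : ℝ) (x y : V) : |cutoff R x - cutoff R y| ≤ ‖x - y‖ := by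
  unfold cutoff
  have h1 := abs_max_sub_max_le_abs (min 1 (R + 1 - ‖x‖)) (min 1 (R + 1 - ‖y‖)) 0
  rw [max_comm _ (0 : ℝ), max_comm _ (0 : ℝ)] at h1
  have h2 := abs_min_sub_min_le_max (1 : ℝ) (R + 1 - ‖x‖) 1 (R + 1 - ‖y‖)
  refine h1.trans (h2.trans ?_)
  rw [sub_self, abs_zero, max_eq_right (abs_nonneg _)]
  have h3 := abs_norm_sub_norm_le y x
  rw [norm_sub_rev] at h3
  refine le_trans (le_of_eq ?_) h3
  congr 1
  ring

/-- Discrete Grönwall inequality. The induction runs on the right-hand side of the hypothesis, which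
grows by a factor of at most `1 + c ≤ exp c` per step. -/
lemma le_mul_exp_of_le_add_sum {u : ℕ → ℝ} {E c : ℝ} (hE : 0 ≤ E) (hc : 0 ≤ c) {m : ℕ}
    (hu : ∀ n ≤ m, u n ≤ E + c * ∑ k ∈ Finset.range n, u k) {n : ℕ} (hn : n ≤ m) :
    u n ≤ E * Real.exp (c * n) := by
  have key : ∀ n ≤ m, E + c * ∑ k ∈ Finset.range n, u k ≤ E * Real.exp (c * n) := by
    intro n
    induction n with
    | zero => simp
    | succ n ih =>
      intro hn
      have h1 := ih (by omega)
      have h2 := hu n (by omega)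
      rw [Finset.sum_range_succ]
      have h3 : Real.exp (c * (n + 1 : ℕ)) = Real.exp (c * n) * Real.exp c := by
        rw [← Real.exp_add]; push_cast; ring_nf
      rw [h3]
      have h4 := Real.add_one_le_exp c
      calc E + c * (∑ k ∈ Finset.range n, u k + u n)
          ≤ (E + c * ∑ k ∈ Finset.range n, u k) * (1 + c) := by nlinarith
        _ ≤ (E * Real.exp (c * n)) * (1 + c) := by gcongr
        _ ≤ E * Real.exp (c * n) * Real.exp c := by
            have : 0 ≤ E * Real.exp (c * n) := by positivity
            gcongr; linarith
        _ = E * (Real.exp (c * n) * Real.exp c) := by ring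
  exact (hu n hn).trans (key n hn)

/-- Grönwall bound for an error whose increments have three parts: `a` is controlled only through
its partial sums, as the averaging error is; `b` is Lipschitz in the error; `c` is small term by
term. -/
lemma norm_le_of_telescope {D a b : ℕ → V} (c : ℕ → V) {m : ℕ} {E η L : ℝ} (hη : 0 ≤ η)
    (hE : 0 ≤ E) (hL : 0 ≤ L) (h0 : D 0 = 0) (hD : ∀ k, D (k + 1) - D k = a k + b k - c k)
    (ha : ∀ n ≤ m, ‖∑ k ∈ Finset.range n, a k‖ ≤ E)
    (hb : ∀ k < m, ‖b k‖ ≤ L * ‖D k‖) (hc : ∀ k < m, ‖c k‖ ≤ η) {n : ℕ} (hn : n ≤ m) :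
    ‖D n‖ ≤ (E + m * η) * Real.exp (L * n) := by
  refine le_mul_exp_of_le_add_sum (u := fun n => ‖D n‖) (by positivity) hL (fun n hn => ?_) hn
  have h1 : D n = ∑ k ∈ Finset.range n, a k + ∑ k ∈ Finset.range n, b k
      - ∑ k ∈ Finset.range n, c k := by
    rw [← Finset.sum_add_distrib, ← Finset.sum_sub_distrib,
      ← Finset.sum_congr rfl fun k _ => hD k, Finset.sum_range_sub, h0, sub_zero]
  have h2 : ‖∑ k ∈ Finset.range n, b k‖ ≤ L * ∑ k ∈ Finset.range n, ‖D k‖ := by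
    rw [Finset.mul_sum]
    exact norm_sum_le_of_le _ fun k hk => hb k ((Finset.mem_range.1 hk).trans_le hn)
  have h3 : ‖∑ k ∈ Finset.range n, c k‖ ≤ m * η := by
    refine (norm_sum_le_of_le _ fun k hk => hc k ((Finset.mem_range.1 hk).trans_le hn)).trans ?_
    rw [Finset.sum_const, Finset.card_range, nsmul_eq_mul]
    gcongr
  rw [h1]
  refine (norm_sub_le _ _).trans ?_
  have := norm_add_le (∑ k ∈ Finset.range n, a k) (∑ k ∈ Finset.range n, b k)
  linarith [ha n hn]

end Cutoff

/-! ### Ordinary differential equations: a priori bounds, existence, uniqueness, Euler scheme. -/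

section Flow

open scoped NNReal

variable {V : Type*} [NormedAddCommGroup V] [NormedSpace ℝ V] {F : ℝ → V → V} {T K : ℝ}

/-- `φ` is a solution on `[0,T]` of the differential equation given by the vector field `F`. -/
def IsODESolution (F : ℝ → V → V) (T : ℝ) (φ : ℝ → V) : Prop :=
  ∀ t ∈ Set.Icc (0 : ℝ) T, HasDerivWithinAt φ (F t (φ t)) (Set.Icc 0 T) t

lemma IsODESolution.continuousOn {φ : ℝ → V} (hφ : IsODESolution F T φ) :
    ContinuousOn φ (Set.Icc 0 T) := fun t ht => (hφ t ht).continuousWithinAt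

lemma IsODESolution.hasDerivWithinAt_Ici {φ : ℝ → V} (hφ : IsODESolution F T φ) {t : ℝ}
    (ht : t ∈ Set.Ico (0 : ℝ) T) : HasDerivWithinAt φ (F t (φ t)) (Set.Ici t) t :=
  (hφ t ⟨ht.1, ht.2.le⟩).mono_of_mem_nhdsWithin (Icc_mem_nhdsGE_of_mem ht)

/-- A bound for the solutions that start in the ball of radius `r`. -/
noncomputable def flowBound (K T r : ℝ) : ℝ := gronwallBound r K K T

lemma IsODESolution.norm_le {φ : ℝ → V} (hφ : IsODESolution F T φ) (hK : 0 ≤ K)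
    (hgrow : ∀ t ∈ Set.Icc (0 : ℝ) T, ∀ x, ‖F t x‖ ≤ K * (1 + ‖x‖)) {r : ℝ} (hr : ‖φ 0‖ ≤ r)
    {t : ℝ} (ht : t ∈ Set.Icc (0 : ℝ) T) : ‖φ t‖ ≤ flowBound K T r := by
  have h := norm_le_gronwallBound_of_norm_deriv_right_le (K := K) (ε := K) hφ.continuousOn
    (fun s hs => hφ.hasDerivWithinAt_Ici hs) hr (fun s hs => by
      have := hgrow s ⟨hs.1, hs.2.le⟩ (φ s); linarith) t ht
  refine h.trans ?_
  rw [sub_zero]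
  exact gronwallBound_mono ((norm_nonneg _).trans hr) hK hK ht.2

lemma IsODESolution.dist_le {φ ψ : ℝ → V} (hφ : IsODESolution F T φ) (hψ : IsODESolution F T ψ)
    {R : ℝ} {L : ℝ≥0}
    (hlip : ∀ t ∈ Set.Icc (0 : ℝ) T,
      LipschitzOnWith L (F t) (Metric.closedBall 0 R))
    (hφR : ∀ t ∈ Set.Icc (0 : ℝ) T, ‖φ t‖ ≤ R) (hψR : ∀ t ∈ Set.Icc (0 : ℝ) T, ‖ψ t‖ ≤ R)
    {t : ℝ} (ht : t ∈ Set.Icc (0 : ℝ) T) :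
    dist (φ t) (ψ t) ≤ dist (φ 0) (ψ 0) * Real.exp (L * T) := by
  have h := dist_le_of_trajectories_ODE_of_mem (v := F) (s := fun _ => Metric.closedBall 0 R)
    (fun t ht => hlip t ⟨ht.1, ht.2.le⟩) hφ.continuousOn (fun s hs => hφ.hasDerivWithinAt_Ici hs)
    (fun s hs => by simpa using hφR s ⟨hs.1, hs.2.le⟩) hψ.continuousOn
    (fun s hs => hψ.hasDerivWithinAt_Ici hs)
    (fun s hs => by simpa using hψR s ⟨hs.1, hs.2.le⟩) le_rfl t ht
  refine h.trans (mul_le_mul_of_nonneg_left (Real.exp_le_exp.2 ?_) dist_nonneg)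
  have := ht.2
  rw [sub_zero]
  gcongr

/-- Product rule with a cutoff of Lipschitz constant `1`. One of the two points may be assumed to
lie in the ball of radius `R + 1`, since the product vanishes outside. -/
lemma lipschitzWith_cutoff_smul {f : V → V} {R : ℝ} {L B : ℝ≥0}
    (hlip : LipschitzOnWith L f (Metric.closedBall 0 (R + 1)))
    (hB : ∀ x, ‖x‖ ≤ R + 1 → ‖f x‖ ≤ B) : LipschitzWith (L + B) fun x => cutoff R x • f x := by
  refine LipschitzWith.of_dist_le_mul fun x y => ?_
  have key : ∀ x y : V, ‖x‖ ≤ R + 1 → dist (cutoff R x • f x) (cutoff R y • f y)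
      ≤ (L + B : ℝ≥0) * dist x y := by
    intro x y hx
    rw [dist_eq_norm, dist_eq_norm]
    have h1 := abs_cutoff_sub_le R x y
    have h2 : ‖(cutoff R x - cutoff R y) • f x‖ ≤ B * ‖x - y‖ := by
      rw [norm_smul, Real.norm_eq_abs, mul_comm]
      exact mul_le_mul (hB x hx) h1 (abs_nonneg _) B.2
    have h3 : ‖cutoff R y • (f x - f y)‖ ≤ L * ‖x - y‖ := by
      rcases le_or_gt ‖y‖ (R + 1) with hy | hy
      · rw [norm_smul, Real.norm_eq_abs, abs_of_nonneg (cutoff_nonneg R y)]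
        have h4 := hlip.dist_le_mul x (by simpa using hx) y (by simpa using hy)
        rw [dist_eq_norm, dist_eq_norm] at h4
        exact (mul_le_of_le_one_left (norm_nonneg _) (cutoff_le_one R y)).trans h4
      · rw [cutoff_eq_zero hy.le, zero_smul, norm_zero]
        positivity
    calc ‖cutoff R x • f x - cutoff R y • f y‖
        = ‖(cutoff R x - cutoff R y) • f x + cutoff R y • (f x - f y)‖ := by
          congr 1; rw [sub_smul, smul_sub]; abel
      _ ≤ _ := norm_add_le _ _
      _ ≤ B * ‖x - y‖ + L * ‖x - y‖ := add_le_add h2 h3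
      _ = (L + B : ℝ≥0) * ‖x - y‖ := by push_cast; ring
  rcases le_or_gt ‖x‖ (R + 1) with hx | hx
  · exact key x y hx
  rcases le_or_gt ‖y‖ (R + 1) with hy | hy
  · rw [dist_comm, dist_comm x y]
    exact key y x hy
  · rw [cutoff_eq_zero hx.le, cutoff_eq_zero hy.le, zero_smul, zero_smul, dist_self]
    positivity

/-- Global existence for a locally Lipschitz vector field of linear growth. -/
theorem exists_isODESolution [CompleteSpace V] (hT : 0 ≤ T) (hK : 0 ≤ K)
    (hgrow : ∀ t ∈ Set.Icc (0 : ℝ) T, ∀ x, ‖F t x‖ ≤ K * (1 + ‖x‖))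
    (hlip : ∀ R, ∃ L : ℝ≥0, ∀ t ∈ Set.Icc (0 : ℝ) T,
      LipschitzOnWith L (F t) (Metric.closedBall 0 R))
    (hcont : ∀ x, ContinuousOn (fun t => F t x) (Set.Icc 0 T)) (x : V) :
    ∃ φ, φ 0 = x ∧ IsODESolution F T φ := by
  -- The a priori bound from Grönwall. The field cut off at `R` obeys the same growth condition, so
  -- its solution stays in the ball of radius `R`, where the cutoff is `1`; it therefore solves the
  -- original equation.
  set R := flowBound K T ‖x‖ with hR
  have hR0 : 0 ≤ R := by
    have := gronwallBound_mono (norm_nonneg x) hK hK hT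
    rw [gronwallBound_x0] at this
    exact (norm_nonneg x).trans this
  obtain ⟨L, hL⟩ := hlip (R + 1)
  let B : ℝ≥0 := ⟨K * (1 + (R + 1)), by positivity⟩
  have hB : ∀ t ∈ Set.Icc (0 : ℝ) T, ∀ y, ‖y‖ ≤ R + 1 → ‖F t y‖ ≤ B := fun t ht y hy =>
    (hgrow t ht y).trans (by change _ ≤ K * (1 + (R + 1)); gcongr)
  let F' : ℝ → V → V := fun t y => cutoff R y • F t y
  have hF'B : ∀ t ∈ Set.Icc (0 : ℝ) T, ∀ y, ‖F' t y‖ ≤ B := by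
    intro t ht y
    rcases le_or_gt ‖y‖ (R + 1) with hy | hy
    · simp only [F', norm_smul, Real.norm_eq_abs, abs_of_nonneg (cutoff_nonneg R y)]
      exact (mul_le_of_le_one_left (norm_nonneg _) (cutoff_le_one R y)).trans (hB t ht y hy)
    · simp only [F', cutoff_eq_zero hy.le, zero_smul, norm_zero]
      exact B.2
  let t₀ : Set.Icc (0 : ℝ) T := ⟨0, le_rfl, hT⟩
  -- The truncated field is bounded by `B` and globally Lipschitz, so the radius `B * T` lets
  -- Picard–Lindelöf cover all of `[0,T]` at once.
  have hPL : IsPicardLindelof F' t₀ x (B * T.toNNReal) 0 B (L + B) := by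
    refine ⟨fun t ht => ?_, fun y _ => ?_, fun t ht y _ => hF'B t ht y, ?_⟩
    · exact (lipschitzWith_cutoff_smul (hL t ht) (hB t ht)).lipschitzOnWith
    · exact (hcont y).const_smul _
    · change (B : ℝ) * max (T - 0) (0 - 0) ≤ (B * T.toNNReal : ℝ≥0) - ((0 : ℝ≥0) : ℝ)
      rw [sub_zero, sub_zero, max_eq_left hT, NNReal.coe_zero, sub_zero, NNReal.coe_mul,
        Real.coe_toNNReal T hT]
  obtain ⟨φ, hφ0, hφ⟩ := hPL.exists_eq_forall_mem_Icc_hasDerivWithinAt₀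
  have hφ0' : φ 0 = x := hφ0
  have hφ' : IsODESolution F' T φ := hφ
  refine ⟨φ, hφ0', fun t ht => ?_⟩
  have hgrow' : ∀ t ∈ Set.Icc (0 : ℝ) T, ∀ x, ‖F' t x‖ ≤ K * (1 + ‖x‖) := by
    intro t ht y
    simp only [F', norm_smul, Real.norm_eq_abs, abs_of_nonneg (cutoff_nonneg R y)]
    exact (mul_le_of_le_one_left (norm_nonneg _) (cutoff_le_one R y)).trans (hgrow t ht y)
  have hle : ‖φ t‖ ≤ R := hφ'.norm_le hK hgrow' (by rw [hφ0']) ht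
  have := hφ' t ht
  simp only [F', cutoff_eq_one hle, one_smul] at this
  exact this

lemma IsODESolution.eqOn {φ ψ : ℝ → V} (hφ : IsODESolution F T φ) (hψ : IsODESolution F T ψ)
    (hK : 0 ≤ K) (hgrow : ∀ t ∈ Set.Icc (0 : ℝ) T, ∀ x, ‖F t x‖ ≤ K * (1 + ‖x‖))
    (hlip : ∀ R, ∃ L : ℝ≥0, ∀ t ∈ Set.Icc (0 : ℝ) T,
      LipschitzOnWith L (F t) (Metric.closedBall 0 R))
    (h0 : φ 0 = ψ 0) : Set.EqOn φ ψ (Set.Icc 0 T) := by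
  intro t ht
  obtain ⟨L, hL⟩ := hlip (flowBound K T ‖φ 0‖)
  have := hφ.dist_le hψ hL (fun s hs => hφ.norm_le hK hgrow le_rfl hs)
    (fun s hs => hψ.norm_le hK hgrow (congrArg norm h0).ge hs) ht
  rw [h0, dist_self, zero_mul] at this
  exact dist_le_zero.1 this

/-- A locally Lipschitz continuous vector field of linear growth. -/
structure IsTameField (F : ℝ → V → V) (T : ℝ) : Prop where
  growth : ∃ K : ℝ, 0 ≤ K ∧ ∀ t ∈ Set.Icc (0 : ℝ) T, ∀ x, ‖F t x‖ ≤ K * (1 + ‖x‖)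
  lipschitz : ∀ R, ∃ L : ℝ≥0, ∀ t ∈ Set.Icc (0 : ℝ) T,
    LipschitzOnWith L (F t) (Metric.closedBall 0 R)
  continuousOn : ContinuousOn (fun p : ℝ × V => F p.1 p.2) (Set.Icc 0 T ×ˢ Set.univ)

/-- The solution of the differential equation that starts in `x`. -/
noncomputable def flow (F : ℝ → V → V) (T : ℝ) (x : V) : ℝ → V :=
  Classical.epsilon fun φ => φ 0 = x ∧ IsODESolution F T φ

namespace IsTameField

lemma flow_spec [CompleteSpace V] (hF : IsTameField F T) (hT : 0 ≤ T) (x : V) :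
    flow F T x 0 = x ∧ IsODESolution F T (flow F T x) := by
  obtain ⟨K, hK, hgrow⟩ := hF.growth
  refine Classical.epsilon_spec (exists_isODESolution hT hK hgrow hF.lipschitz (fun x => ?_) x)
  exact hF.continuousOn.comp (f := fun t => (t, x)) (by fun_prop) fun t ht => ⟨ht, trivial⟩

lemma eqOn (hF : IsTameField F T) {φ ψ : ℝ → V} (hφ : IsODESolution F T φ)
    (hψ : IsODESolution F T ψ) (h0 : φ 0 = ψ 0) : Set.EqOn φ ψ (Set.Icc 0 T) := by
  obtain ⟨K, hK, hgrow⟩ := hF.growth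
  exact hφ.eqOn hψ hK hgrow hF.lipschitz h0

lemma exists_norm_flow_le [CompleteSpace V] (hF : IsTameField F T) (hT : 0 ≤ T) (R : ℝ) :
    ∃ R', R ≤ R' ∧ ∀ x, ‖x‖ ≤ R → ∀ t ∈ Set.Icc (0 : ℝ) T, ‖flow F T x t‖ ≤ R' := by
  obtain ⟨K, hK, hgrow⟩ := hF.growth
  refine ⟨max R (flowBound K T R), le_max_left _ _, fun x hx t ht => ?_⟩
  obtain ⟨h0, hφ⟩ := hF.flow_spec hT x
  exact (hφ.norm_le hK hgrow (by rwa [h0]) ht).trans (le_max_right _ _)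

lemma exists_dist_flow_le [CompleteSpace V] (hF : IsTameField F T) (hT : 0 ≤ T) (R : ℝ) :
    ∃ C, 0 ≤ C ∧ ∀ x y, ‖x‖ ≤ R → ‖y‖ ≤ R → ∀ t ∈ Set.Icc (0 : ℝ) T,
      dist (flow F T x t) (flow F T y t) ≤ C * dist x y := by
  obtain ⟨R', -, hR'⟩ := hF.exists_norm_flow_le hT R
  obtain ⟨L, hL⟩ := hF.lipschitz R'
  refine ⟨Real.exp (L * T), by positivity, fun x y hx hy t ht => ?_⟩
  obtain ⟨hx0, hφ⟩ := hF.flow_spec hT x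
  obtain ⟨hy0, hψ⟩ := hF.flow_spec hT y
  have := hφ.dist_le hψ hL (hR' x hx) (hR' y hy) ht
  rwa [hx0, hy0, mul_comm] at this

end IsTameField

/-- Mean value inequality for `φ r - r • v`. With `v = 0` it is a Lipschitz bound in time; with `v`
the field at the left endpoint it is the local error of an Euler step. -/
lemma IsODESolution.norm_sub_sub_smul_le {φ : ℝ → V} (hφ : IsODESolution F T φ) {s t η : ℝ}
    (hs : 0 ≤ s) (hst : s ≤ t) (ht : t ≤ T) {v : V}
    (h : ∀ r ∈ Set.Icc s t, ‖F r (φ r) - v‖ ≤ η) : ‖φ t - φ s - (t - s) • v‖ ≤ η * (t - s) := by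
  have h1 : ∀ r ∈ Set.Icc s t, HasDerivWithinAt (fun r => φ r - r • v) (F r (φ r) - v)
      (Set.Icc s t) r := by
    intro r hr
    have e1 := (hφ r ⟨hs.trans hr.1, hr.2.trans ht⟩).mono (Set.Icc_subset_Icc hs ht)
    have e2 := ((hasDerivWithinAt_id r (Set.Icc s t)).smul_const v)
    simp only [one_smul, id] at e2
    exact e1.sub e2
  have h2 := (convex_Icc s t).norm_image_sub_le_of_norm_hasDerivWithin_le h1 h
    (Set.left_mem_Icc.2 hst) (Set.right_mem_Icc.2 hst)
  rw [Real.norm_eq_abs, abs_of_nonneg (sub_nonneg.2 hst)] at h2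
  refine le_trans (le_of_eq ?_) h2
  congr 1
  rw [sub_smul]
  abel

/-- Convergence of a perturbed Euler scheme, uniformly over bounded initial conditions. -/
theorem IsTameField.exists_euler_le [ProperSpace V] (hF : IsTameField F T) (hT : 0 ≤ T) (R : ℝ)
    {ε : ℝ} (hε : 0 < ε) : ∃ δ > 0, ∃ N₀ : ℕ, ∀ N : ℕ, N₀ ≤ N → 0 < N → ∀ X : ℕ → V,
      (∀ n : ℕ, (n : ℝ) ≤ N * T → ‖X n‖ ≤ R) →
      (∀ n : ℕ, (n : ℝ) ≤ N * T → ‖∑ k ∈ Finset.range n,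
        ((N : ℝ) • (X (k + 1) - X k) - F ((k : ℝ) / N) (X k))‖ ≤ δ * N) →
      ∀ n : ℕ, (n : ℝ) ≤ N * T → ‖X n - flow F T (X 0) ((n : ℝ) / N)‖ ≤ ε := by
  obtain ⟨R', hRR', hR'⟩ := hF.exists_norm_flow_le hT R
  obtain ⟨L, hL⟩ := hF.lipschitz R'
  set Kc : Set (ℝ × V) := Set.Icc 0 T ×ˢ Metric.closedBall 0 R' with hKc
  have hKcomp : IsCompact Kc := isCompact_Icc.prod (isCompact_closedBall _ _)
  have hFK : ContinuousOn (fun p : ℝ × V => F p.1 p.2) Kc :=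
    hF.continuousOn.mono fun p hp => ⟨hp.1, trivial⟩
  obtain ⟨B, hB⟩ := hKcomp.exists_bound_of_continuousOn hFK
  set c := Real.exp (L * T) with hc
  have hc0 : 0 < c := Real.exp_pos _
  -- The local errors, at most `η / N` each over at most `N * T` steps, add up to at most `ε / (2 *
  -- c)`, as does the perturbation. Grönwall multiplies the total by at most `c`.
  set η := ε / (2 * (T + 1) * c) with hη
  have hη0 : 0 < η := by positivity
  obtain ⟨δ₀, hδ₀, hunif⟩ := Metric.uniformContinuousOn_iff.1
    (hKcomp.uniformContinuousOn_of_continuous hFK) η hη0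
  -- Within a step of length `1 / N` the solution moves by at most `max 1 B / N`. The `1` in the
  -- maximum makes the same bound cover the change of time.
  obtain ⟨N₀, hN₀⟩ := exists_nat_gt ((max 1 B + 1) / δ₀)
  refine ⟨ε / (2 * c), by positivity, N₀, fun N hNN hNpos X hXR hXE n hn => ?_⟩
  have hN : (0 : ℝ) < N := by exact_mod_cast hNpos
  have hsmall : max 1 B / N < δ₀ := by
    rw [div_lt_iff₀ hN]
    rw [div_lt_iff₀ hδ₀] at hN₀
    have : (N₀ : ℝ) ≤ N := by exact_mod_cast hNN
    nlinarith
  obtain ⟨hφ0, hφ⟩ := hF.flow_spec hT (X 0)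
  have hX0 : ‖X 0‖ ≤ R := hXR 0 (by simp; positivity)
  set φ := flow F T (X 0) with hφdef
  have hφK : ∀ t ∈ Set.Icc (0 : ℝ) T, (t, φ t) ∈ Kc := fun t ht =>
    ⟨ht, by simpa using hR' (X 0) hX0 t ht⟩
  have htime : ∀ k : ℕ, (k : ℝ) ≤ N * T → (k : ℝ) / N ∈ Set.Icc (0 : ℝ) T := fun k hk =>
    ⟨by positivity, by rw [div_le_iff₀ hN]; linarith⟩
  have hφlip : ∀ s t : ℝ, 0 ≤ s → s ≤ t → t ≤ T → ‖φ t - φ s‖ ≤ max 1 B * (t - s) := by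
    intro s t hs hst ht
    have := hφ.norm_sub_sub_smul_le (v := 0) (η := max 1 B) hs hst ht fun r hr => by
      rw [sub_zero]
      exact (hB _ (hφK r ⟨hs.trans hr.1, hr.2.trans ht⟩)).trans (le_max_right _ _)
    simpa using this
  have hstep : ∀ k : ℕ, ((k + 1 : ℕ) : ℝ) / N - (k : ℝ) / N = 1 / N := fun k => by
    push_cast; field_simp; ring
  set m := ⌊(N : ℝ) * T⌋₊ with hm
  have hmT : (m : ℝ) ≤ N * T := Nat.floor_le (by positivity)
  have hle : ∀ k ≤ m, (k : ℝ) ≤ N * T := fun k hk => le_trans (by exact_mod_cast hk) hmT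
  -- Here `a` is the given perturbation, `b` the difference of the fields at the scheme and at the
  -- solution, and `c` the local Euler error of the solution.
  have key := norm_le_of_telescope (D := fun k => X k - φ ((k : ℝ) / N))
    (a := fun k => (1 / N : ℝ) • ((N : ℝ) • (X (k + 1) - X k) - F ((k : ℝ) / N) (X k)))
    (b := fun k => (1 / N : ℝ) • (F ((k : ℝ) / N) (X k) - F ((k : ℝ) / N) (φ ((k : ℝ) / N))))
    (fun k => φ (((k + 1 : ℕ) : ℝ) / N) - φ ((k : ℝ) / N)
      - (1 / N : ℝ) • F ((k : ℝ) / N) (φ ((k : ℝ) / N)))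
    (m := m) (E := ε / (2 * c)) (η := η * (1 / N)) (L := L / N)
    (by positivity) (by positivity) (by positivity) (by simp [hφ0]) (fun k => ?_) (fun j hj => ?_)
    (fun k hk => ?_) (fun k hk => ?_) (Nat.le_floor hn)
  · refine key.trans ?_
    have h1 : (m : ℝ) * (η * (1 / N)) ≤ ε / (2 * c) := by
      calc (m : ℝ) * (η * (1 / N)) ≤ (N * T) * (η * (1 / N)) := by gcongr
        _ = ε / (2 * c) * (T / (T + 1)) := by rw [hη]; field_simp
        _ ≤ ε / (2 * c) * 1 := by
            gcongr
            rw [div_le_one (by positivity)]; linarith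
        _ = ε / (2 * c) := mul_one _
    have h2 : Real.exp (L / N * n) ≤ c := by
      rw [hc]
      refine Real.exp_le_exp.2 ?_
      calc (L : ℝ) / N * n ≤ L / N * (N * T) := by gcongr
        _ = L * T := by field_simp
    calc (ε / (2 * c) + m * (η * (1 / N))) * Real.exp (L / N * n)
        ≤ (ε / (2 * c) + ε / (2 * c)) * c := by gcongr
      _ = ε := by field_simp; ring
  · have : (1 / N : ℝ) • ((N : ℝ) • (X (k + 1) - X k)) = X (k + 1) - X k := by
      rw [smul_smul, one_div_mul_cancel hN.ne', one_smul]
    rw [smul_sub (1 / (N : ℝ)) ((N : ℝ) • (X (k + 1) - X k)), this, smul_sub]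
    abel
  · rw [← Finset.smul_sum, norm_smul, Real.norm_eq_abs, abs_of_pos (by positivity)]
    calc 1 / (N : ℝ) * _ ≤ 1 / N * (ε / (2 * c) * N) := by
          gcongr
          exact hXE j (hle j hj)
      _ = ε / (2 * c) := by field_simp
  · rw [norm_smul, Real.norm_eq_abs, abs_of_pos (by positivity)]
    have hk' := hle k hk.le
    have h1 := (hL _ (htime k hk')).dist_le_mul (X k)
      (by simpa using (hXR k hk').trans hRR') (φ ((k : ℝ) / N)) (hφK _ (htime k hk')).2
    rw [dist_eq_norm, dist_eq_norm] at h1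
    calc 1 / (N : ℝ) * _ ≤ 1 / N * (L * ‖X k - φ ((k : ℝ) / N)‖) := by gcongr
      _ = L / N * ‖X k - φ ((k : ℝ) / N)‖ := by ring
  · have hk1 := htime (k + 1) (hle (k + 1) hk)
    have hk0 := htime k (hle k hk.le)
    have hkle : (k : ℝ) / N ≤ ((k + 1 : ℕ) : ℝ) / N := by
      have := hstep k
      have : 0 < 1 / (N : ℝ) := by positivity
      linarith
    have h1 := hφ.norm_sub_sub_smul_le (v := F ((k : ℝ) / N) (φ ((k : ℝ) / N))) (η := η)
      hk0.1 hkle hk1.2 fun r hr => ?_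
    · rw [hstep] at h1
      exact h1
    · rw [← dist_eq_norm]
      have hr' : r ∈ Set.Icc (0 : ℝ) T := ⟨hk0.1.trans hr.1, hr.2.trans hk1.2⟩
      have hrk : r - (k : ℝ) / N ≤ 1 / N := by rw [← hstep k]; linarith [hr.2]
      refine (hunif _ (hφK r hr') _ (hφK _ hk0) ?_).le
      have hmax : (1 : ℝ) / N ≤ max 1 B / N := by gcongr; exact le_max_left _ _
      rw [Prod.dist_eq, max_lt_iff]
      constructor
      · simp only [Real.dist_eq]
        rw [abs_of_nonneg (sub_nonneg.2 hr.1)]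
        linarith
      · simp only [dist_eq_norm]
        refine (hφlip _ _ hk0.1 hr.1 hr'.2).trans_lt (lt_of_le_of_lt ?_ hsmall)
        calc max 1 B * (r - (k : ℝ) / N) ≤ max 1 B * (1 / N) := by gcongr
          _ = max 1 B / N := by ring

end Flow

/-! ### Policies and their stationary distributions -/

lemma eta_pos (t : ℝ) : 0 < eta t := by unfold eta; positivity

lemma eta_le_one (t : ℝ) : eta t ≤ 1 := by
  unfold eta
  rw [div_le_one (by positivity)]
  nlinarith [sq_nonneg (Real.log (t + 1))]

lemma continuousOn_eta : ContinuousOn eta (Set.Ici 0) := by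
  unfold eta
  refine continuousOn_const.div ?_ fun t _ => by positivity
  refine continuousOn_const.add (ContinuousOn.pow ?_ 2)
  exact ContinuousOn.log (by fun_prop) fun t ht => by
    have : (0 : ℝ) ≤ t := ht
    positivity

lemma zeta_nonneg {t : ℝ} (ht : 0 ≤ t) : 0 ≤ zeta t := by unfold zeta; positivity

lemma zeta_le_one {t : ℝ} (ht : 0 ≤ t) : zeta t ≤ 1 := by
  unfold zeta
  rw [div_le_one (by positivity)]
  linarith

lemma continuousOn_zeta : ContinuousOn zeta (Set.Ici 0) := by
  unfold zeta
  refine continuousOn_const.div (by fun_prop) fun t ht => ?_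
  have : (0 : ℝ) ≤ t := ht
  positivity

lemma clip_nonneg (x : ℝ) : 0 ≤ clip x := le_max_right _ _

lemma clip_le_two (x : ℝ) : clip x ≤ 2 := max_le (min_le_right _ _) (by norm_num)

lemma continuous_clip : Continuous clip := by unfold clip; fun_prop

lemma abs_clip_sub_le (x y : ℝ) : |clip x - clip y| ≤ |x - y| := by
  unfold clip
  refine (abs_max_sub_max_le_abs _ _ _).trans ?_
  have := abs_min_sub_min_le_max x 2 y 2
  rwa [sub_self, abs_zero, max_eq_left (abs_nonneg _)] at this

namespace MDP

variable {dx da : ℕ} (M : MDP dx da)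

lemma sum_exp_pos (P : M.SA → ℝ) (x : M.X) : 0 < ∑ a', Real.exp (P (x, a')) :=
  Finset.sum_pos (fun _ _ => Real.exp_pos _) Finset.univ_nonempty

lemma softmax_pos (P : M.SA → ℝ) (ξ : M.SA) : 0 < M.softmax P ξ :=
  div_pos (Real.exp_pos _) (M.sum_exp_pos P _)

lemma sum_softmax (P : M.SA → ℝ) (x : M.X) : ∑ a, M.softmax P (x, a) = 1 := by
  change ∑ a, Real.exp (P (x, a)) / ∑ a', Real.exp (P (x, a')) = 1
  rw [← Finset.sum_div, div_self (M.sum_exp_pos P x).ne']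

lemma softmax_le_one (P : M.SA → ℝ) (ξ : M.SA) : M.softmax P ξ ≤ 1 := by
  rw [← M.sum_softmax P ξ.1]
  exact Finset.single_le_sum (f := fun a => M.softmax P (ξ.1, a))
    (fun a _ => (M.softmax_pos P _).le) (Finset.mem_univ ξ.2)

lemma contDiff_softmax (ξ : M.SA) : ContDiff ℝ 1 fun P : M.SA → ℝ => M.softmax P ξ := by
  unfold softmax
  refine ContDiff.div (by fun_prop) (ContDiff.sum fun a _ => by fun_prop) fun P => ?_
  exact (M.sum_exp_pos P _).ne'

lemma isPositivePolicy_explore {η : ℝ} (h0 : 0 < η) (h1 : η ≤ 1) (P : M.SA → ℝ) :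
    M.IsPositivePolicy (M.explore η P) where
  pos ξ := by
    have hA : (0 : ℝ) < Fintype.card M.A := by exact_mod_cast Fintype.card_pos
    have := mul_nonneg (sub_nonneg.2 h1) (M.softmax_pos P ξ).le
    unfold explore
    positivity
  sum_eq_one x := by
    have hA : (Fintype.card M.A : ℝ) ≠ 0 := by exact_mod_cast Fintype.card_ne_zero
    unfold explore
    rw [Finset.sum_add_distrib, ← Finset.mul_sum, M.sum_softmax, Finset.sum_const, Finset.card_univ,
      nsmul_eq_mul]
    field_simp
    ring

lemma pAux_nonneg (ξ : M.SA) (x' : M.X) : 0 ≤ M.pAux ξ x' := by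
  have h1 := M.p_nonneg ξ x'
  have h2 : 0 ≤ ∑ a, M.ρ₀ (x', a) := Finset.sum_nonneg fun a _ => M.ρ₀_nonneg _
  have h3 := M.γ_pos
  have h4 := sub_nonneg.2 M.γ_lt_one.le
  unfold pAux
  positivity

lemma sum_pAux (ξ : M.SA) : ∑ x', M.pAux ξ x' = 1 := by
  unfold pAux
  rw [Finset.sum_add_distrib, ← Finset.mul_sum, ← Finset.mul_sum, M.p_sum,
    ← Fintype.sum_prod_type, M.ρ₀_sum]
  ring

lemma sum_mul_policy {q : M.SA → M.X → ℝ} (hq : ∀ ξ, ∑ x', q ξ x' = 1) {f : M.SA → ℝ}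
    (hf : M.IsPositivePolicy f) (ξ : M.SA) : ∑ ξ' : M.SA, q ξ ξ'.1 * f ξ' = 1 := by
  rw [Fintype.sum_prod_type]
  simp_rw [← Finset.mul_sum, hf.sum_eq_one, mul_one, hq]

lemma sum_chain {f : M.SA → ℝ} (hf : M.IsPositivePolicy f) (ξ : M.SA) :
    ∑ ξ', M.chain f ξ ξ' = 1 := M.sum_mul_policy M.p_sum hf ξ

lemma sum_auxChain {f : M.SA → ℝ} (hf : M.IsPositivePolicy f) (ξ : M.SA) :
    ∑ ξ', M.auxChain f ξ ξ' = 1 := M.sum_mul_policy M.sum_pAux hf ξ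

lemma chain_nonneg {f : M.SA → ℝ} (hf : M.IsPositivePolicy f) (ξ ξ' : M.SA) :
    0 ≤ M.chain f ξ ξ' := mul_nonneg (M.p_nonneg _ _) (hf.pos _).le

lemma auxChain_nonneg {f : M.SA → ℝ} (hf : M.IsPositivePolicy f) (ξ ξ' : M.SA) :
    0 ≤ M.auxChain f ξ ξ' := mul_nonneg (M.pAux_nonneg _ _) (hf.pos _).le

lemma isStationaryDist_stat {f : M.SA → ℝ} (hf : M.IsPositivePolicy f) :
    IsStationaryDist (M.chain f) (M.stat f) :=
  isStationaryDist_statDist (M.chain_nonneg hf) (M.sum_chain hf)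

lemma isStationaryDist_visit {f : M.SA → ℝ} (hf : M.IsPositivePolicy f) :
    IsStationaryDist (M.auxChain f) (M.visit f) :=
  isStationaryDist_statDist (M.auxChain_nonneg hf) (M.sum_auxChain hf)

/-- A family of probability distributions on the state-action pairs that is Lipschitz in the
policy. -/
structure IsLipschitzPolicyMap (s : (M.SA → ℝ) → M.SA → ℝ) : Prop where
  nonneg : ∀ f, M.IsPositivePolicy f → ∀ ξ, 0 ≤ s f ξ
  sum_eq_one : ∀ f, M.IsPositivePolicy f → ∑ ξ, s f ξ = 1
  lipschitz : ∃ C : ℝ, 0 ≤ C ∧ ∀ f f', M.IsPositivePolicy f → M.IsPositivePolicy f' → ∀ ξ,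
    |s f ξ - s f' ξ| ≤ C * ∑ ξ', |f ξ' - f' ξ'|

variable {M}

/-- A coordinate difference is at most the `ℓ¹` distance, and the factors `1 / 2` on both sides
cancel. -/
lemma IsErgodic.isLipschitzPolicyMap_aux (hM : M.IsErgodic) : ∃ C : ℝ, 0 ≤ C ∧
    ∀ f f', M.IsPositivePolicy f → M.IsPositivePolicy f' → ∀ ξ,
    |M.stat f ξ - M.stat f' ξ| ≤ C * ∑ ξ', |f ξ' - f' ξ'| ∧
    |M.visit f ξ - M.visit f' ξ| ≤ C * ∑ ξ', |f ξ' - f' ξ'| := by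
  obtain ⟨C, hC⟩ := hM.lipschitz
  refine ⟨max C 0, le_max_right _ _, fun f f' hf hf' ξ => ?_⟩
  have h := hC f f' hf hf'
  have hsum : 0 ≤ ∑ ξ', |f ξ' - f' ξ'| := Finset.sum_nonneg fun _ _ => abs_nonneg _
  have hbound : ∀ u v : M.SA → ℝ, dTV u v ≤ C * dTV f f' →
      |u ξ - v ξ| ≤ max C 0 * ∑ ξ', |f ξ' - f' ξ'| := by
    intro u v huv
    unfold dTV at huv
    have h1 : |u ξ - v ξ| ≤ ∑ i, |u i - v i| :=
      Finset.single_le_sum (f := fun i => |u i - v i|) (fun _ _ => abs_nonneg _) (Finset.mem_univ ξ)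
    have h2 := mul_le_mul_of_nonneg_right (le_max_left C 0) hsum
    linarith
  exact ⟨hbound _ _ ((le_max_left _ _).trans h), hbound _ _ ((le_max_right _ _).trans h)⟩

lemma IsErgodic.isLipschitzPolicyMap_stat (hM : M.IsErgodic) : M.IsLipschitzPolicyMap M.stat where
  nonneg _ hf := (M.isStationaryDist_stat hf).nonneg
  sum_eq_one _ hf := (M.isStationaryDist_stat hf).sum_eq_one
  lipschitz := by
    obtain ⟨C, hC0, hC⟩ := hM.isLipschitzPolicyMap_aux
    exact ⟨C, hC0, fun f f' hf hf' ξ => (hC f f' hf hf' ξ).1⟩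

lemma IsErgodic.isLipschitzPolicyMap_visit (hM : M.IsErgodic) :
    M.IsLipschitzPolicyMap M.visit where
  nonneg _ hf := (M.isStationaryDist_visit hf).nonneg
  sum_eq_one _ hf := (M.isStationaryDist_visit hf).sum_eq_one
  lipschitz := by
    obtain ⟨C, hC0, hC⟩ := hM.isLipschitzPolicyMap_aux
    exact ⟨C, hC0, fun f f' hf hf' ξ => (hC f f' hf hf' ξ).2⟩

lemma IsLipschitzPolicyMap.le_one {s : (M.SA → ℝ) → M.SA → ℝ} (hs : M.IsLipschitzPolicyMap s)
    {f : M.SA → ℝ} (hf : M.IsPositivePolicy f) (ξ : M.SA) : s f ξ ≤ 1 := by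
  rw [← hs.sum_eq_one f hf]
  exact Finset.single_le_sum (f := fun ξ => s f ξ) (fun ξ _ => hs.nonneg f hf ξ)
    (Finset.mem_univ ξ)

end MDP

/-! ### Bounded Lipschitz functionals -/

/-- `f t` is bounded and Lipschitz on the ball of radius `R`, uniformly in `t ∈ [0,T]`. -/
def IsBddLip {V : Type*} [NormedAddCommGroup V] (T R : ℝ) (f : ℝ → V → ℝ) : Prop :=
  ∃ C, 0 ≤ C ∧ ∀ t ∈ Set.Icc (0 : ℝ) T, ∀ x ∈ Metric.closedBall (0 : V) R,
    |f t x| ≤ C ∧ ∀ y ∈ Metric.closedBall (0 : V) R, |f t x - f t y| ≤ C * ‖x - y‖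

namespace IsBddLip

variable {V : Type*} [NormedAddCommGroup V] {T R : ℝ} {f g : ℝ → V → ℝ}

lemma of_bounds {C D : ℝ}
    (h1 : ∀ t ∈ Set.Icc (0 : ℝ) T, ∀ x ∈ Metric.closedBall (0 : V) R, |f t x| ≤ C)
    (h2 : ∀ t ∈ Set.Icc (0 : ℝ) T, ∀ x ∈ Metric.closedBall (0 : V) R,
      ∀ y ∈ Metric.closedBall (0 : V) R, |f t x - f t y| ≤ D * ‖x - y‖) : IsBddLip T R f :=
  ⟨max C 0 + max D 0, by positivity, fun t ht x hx => ⟨(h1 t ht x hx).trans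
    ((le_max_left C 0).trans (le_add_of_nonneg_right (le_max_right _ _))), fun y hy =>
    (h2 t ht x hx y hy).trans (mul_le_mul_of_nonneg_right
      ((le_max_left D 0).trans (le_add_of_nonneg_left (le_max_right _ _))) (norm_nonneg _))⟩⟩

lemma of_time {c : ℝ → ℝ} {C : ℝ} (hc : ∀ t ∈ Set.Icc (0 : ℝ) T, |c t| ≤ C) :
    IsBddLip (V := V) T R fun t _ => c t :=
  of_bounds (C := C) (D := 0) (fun t ht _ _ => hc t ht) fun t ht x hx y hy => by simp

lemma const (c : ℝ) : IsBddLip (V := V) T R fun _ _ => c := of_time (C := |c|) fun _ _ => le_rfl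

lemma add (hf : IsBddLip T R f) (hg : IsBddLip T R g) : IsBddLip T R fun t x => f t x + g t x := by
  obtain ⟨C, hC, h⟩ := hf
  obtain ⟨D, hD, k⟩ := hg
  refine ⟨C + D, by positivity, fun t ht x hx => ⟨?_, fun y hy => ?_⟩⟩
  · exact (abs_add_le _ _).trans (add_le_add (h t ht x hx).1 (k t ht x hx).1)
  · rw [add_sub_add_comm, add_mul]
    exact (abs_add_le _ _).trans (add_le_add ((h t ht x hx).2 y hy) ((k t ht x hx).2 y hy))

lemma mul (hf : IsBddLip T R f) (hg : IsBddLip T R g) : IsBddLip T R fun t x => f t x * g t x := by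
  obtain ⟨C, hC, h⟩ := hf
  obtain ⟨D, hD, k⟩ := hg
  refine of_bounds (C := C * D) (D := 2 * (C * D)) (fun t ht x hx => ?_) fun t ht x hx y hy => ?_
  · rw [abs_mul]
    exact mul_le_mul (h t ht x hx).1 (k t ht x hx).1 (abs_nonneg _) hC
  · have e : f t x * g t x - f t y * g t y = f t x * (g t x - g t y) + (f t x - f t y) * g t y := by
      ring
    rw [e]
    refine (abs_add_le _ _).trans ?_
    rw [abs_mul, abs_mul]
    have h1 := mul_le_mul (h t ht x hx).1 ((k t ht x hx).2 y hy) (abs_nonneg _) hC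
    have h2 := mul_le_mul ((h t ht x hx).2 y hy) (k t ht y hy).1 (abs_nonneg _) (by positivity)
    linarith

lemma sub (hf : IsBddLip T R f) (hg : IsBddLip T R g) : IsBddLip T R fun t x => f t x - g t x := by
  have := hf.add ((const (-1)).mul hg)
  convert this using 3
  ring

lemma sum {ι : Type*} (s : Finset ι) {f : ι → ℝ → V → ℝ} (hf : ∀ i ∈ s, IsBddLip T R (f i)) :
    IsBddLip T R fun t x => ∑ i ∈ s, f i t x := by
  classical
  induction s using Finset.induction_on with
  | empty => simpa using const 0
  | insert i s hi ih =>
    simp_rw [Finset.sum_insert hi]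
    exact (hf i (Finset.mem_insert_self i s)).add
      (ih fun j hj => hf j (Finset.mem_insert_of_mem hj))

end IsBddLip

/-! ### The vector field of the limit system -/

namespace MDP

variable {dx da : ℕ} (M : MDP dx da)

/-- The space of pairs `(P, Q)` of network outputs. -/
abbrev Outputs : Type := (M.SA → ℝ) × (M.SA → ℝ)

/-- The right-hand side of the limit system. -/
noncomputable def field (act : ℝ → ℝ) (α : ℝ) (ν₀ : Measure (HiddenUnit dx da)) (t : ℝ)
    (x : M.Outputs) : M.Outputs :=
  (M.actorField act ν₀ t x.1 x.2, M.criticField act α ν₀ t x.1 x.2)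

variable {M} {T R : ℝ}

lemma isBddLip_snd (ξ : M.SA) : IsBddLip (V := M.Outputs) T R fun _ x => x.2 ξ := by
  refine IsBddLip.of_bounds (C := R) (D := 1) (fun t _ x hx => ?_) fun t _ x _ y _ => ?_
  · exact ((norm_le_pi_norm x.2 ξ).trans (norm_snd_le x)).trans (by simpa using hx)
  · rw [one_mul]
    exact (norm_le_pi_norm (x - y).2 ξ).trans (norm_snd_le _)

lemma isBddLip_clip (ξ : M.SA) : IsBddLip (V := M.Outputs) T R fun _ x => clip (x.2 ξ) := by
  refine IsBddLip.of_bounds (C := 2) (D := 1) (fun t _ x hx => ?_) fun t _ x _ y _ => ?_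
  · rw [abs_of_nonneg (clip_nonneg _)]
    exact clip_le_two _
  · rw [one_mul]
    exact (abs_clip_sub_le _ _).trans ((norm_le_pi_norm (x - y).2 ξ).trans (norm_snd_le _))

/-- A `C¹` function is locally Lipschitz, hence Lipschitz on a compact ball. -/
lemma isBddLip_softmax (ξ : M.SA) : IsBddLip (V := M.Outputs) T R fun _ x => M.softmax x.1 ξ := by
  obtain ⟨L, hL⟩ := LocallyLipschitzOn.exists_lipschitzOnWith_of_compact
    (isCompact_closedBall (0 : M.SA → ℝ) R)
    ((M.contDiff_softmax ξ).locallyLipschitz.locallyLipschitzOn)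
  refine IsBddLip.of_bounds (C := 1) (D := L) (fun t _ x hx => ?_) fun t _ x hx y hy => ?_
  · rw [abs_of_pos (M.softmax_pos _ _)]
    exact M.softmax_le_one _ _
  · have hx' : x.1 ∈ Metric.closedBall (0 : M.SA → ℝ) R := by
      simpa using (norm_fst_le x).trans (by simpa using hx)
    have hy' : y.1 ∈ Metric.closedBall (0 : M.SA → ℝ) R := by
      simpa using (norm_fst_le y).trans (by simpa using hy)
    have := hL.dist_le_mul _ hx' _ hy'
    rw [Real.dist_eq, dist_eq_norm] at this
    exact this.trans (mul_le_mul_of_nonneg_left (norm_fst_le (x - y)) L.2)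

lemma abs_eta_le (t : ℝ) : |eta t| ≤ 1 := by
  rw [abs_of_pos (eta_pos t)]; exact eta_le_one t

lemma isBddLip_explore (ξ : M.SA) :
    IsBddLip (V := M.Outputs) T R fun t x => M.explore (eta t) x.1 ξ := by
  have he : IsBddLip (V := M.Outputs) T R fun t _ => eta t := .of_time fun t _ => abs_eta_le t
  have := (he.mul (.const (Fintype.card M.A : ℝ)⁻¹)).add
    (((IsBddLip.const 1).sub he).mul (isBddLip_softmax ξ))
  simpa only [explore, div_eq_mul_inv] using this

lemma isPositivePolicy_explore_eta (t : ℝ) (P : M.SA → ℝ) :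
    M.IsPositivePolicy (M.explore (eta t) P) :=
  M.isPositivePolicy_explore (eta_pos t) (eta_le_one t) P

/-- The Lipschitz dependence on the policy is composed with the local Lipschitz dependence of the
exploration policy on the outputs. -/
lemma isBddLip_policyMap {s : (M.SA → ℝ) → M.SA → ℝ} (hs : M.IsLipschitzPolicyMap s) (ξ : M.SA) :
    IsBddLip (V := M.Outputs) T R fun t x => s (M.explore (eta t) x.1) ξ := by
  obtain ⟨C, hC0, hC⟩ := hs.lipschitz
  choose D hD0 hD using fun ξ' : M.SA => isBddLip_explore (T := T) (R := R) ξ'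
  refine IsBddLip.of_bounds (C := 1) (D := C * ∑ ξ', D ξ') (fun t _ x hx => ?_)
    fun t ht x hx y hy => ?_
  · rw [abs_of_nonneg (hs.nonneg _ (isPositivePolicy_explore_eta t _) ξ)]
    exact hs.le_one (isPositivePolicy_explore_eta t _) ξ
  · refine (hC _ _ (isPositivePolicy_explore_eta t _) (isPositivePolicy_explore_eta t _) ξ).trans ?_
    rw [mul_assoc, Finset.sum_mul]
    gcongr with ξ' _
    exact (hD ξ' t ht x hx).2 y hy

/-- The domain `[0,∞) × V` of the coefficients. -/
abbrev slab (M : MDP dx da) : Set (ℝ × M.Outputs) := Set.Ici 0 ×ˢ Set.univ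

lemma continuousOn_time {c : ℝ → ℝ} (hc : ContinuousOn c (Set.Ici 0)) :
    ContinuousOn (fun p : ℝ × M.Outputs => c p.1) M.slab :=
  hc.comp continuousOn_fst fun _ hp => hp.1

lemma continuous_softmax (ξ : M.SA) : Continuous fun P : M.SA → ℝ => M.softmax P ξ :=
  (M.contDiff_softmax ξ).continuous

lemma continuousOn_softmax (ξ : M.SA) :
    ContinuousOn (fun p : ℝ × M.Outputs => M.softmax p.2.1 ξ) M.slab :=
  ((continuous_softmax ξ).comp (continuous_fst.comp continuous_snd)).continuousOn

lemma continuousOn_explore (ξ : M.SA) :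
    ContinuousOn (fun p : ℝ × M.Outputs => M.explore (eta p.1) p.2.1 ξ) M.slab := by
  have he := continuousOn_time (M := M) continuousOn_eta
  unfold explore
  exact (he.div_const _).add ((continuousOn_const.sub he).mul (continuousOn_softmax ξ))

/-- The stationary distributions are obtained by choice and have no formula to differentiate; their
continuity comes from the Lipschitz bound in the policy alone. -/
lemma continuousOn_policyMap {s : (M.SA → ℝ) → M.SA → ℝ} (hs : M.IsLipschitzPolicyMap s)
    (ξ : M.SA) :
    ContinuousOn (fun p : ℝ × M.Outputs => s (M.explore (eta p.1) p.2.1) ξ) M.slab := by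
  obtain ⟨C, hC0, hC⟩ := hs.lipschitz
  intro p hp
  have h1 : Tendsto (fun p' : ℝ × M.Outputs => C * ∑ ξ', |M.explore (eta p'.1) p'.2.1 ξ'
      - M.explore (eta p.1) p.2.1 ξ'|) (𝓝[M.slab] p) (𝓝 0) := by
    have : ContinuousWithinAt (fun p' : ℝ × M.Outputs => C * ∑ ξ', |M.explore (eta p'.1) p'.2.1 ξ'
      - M.explore (eta p.1) p.2.1 ξ'|) M.slab p :=
      continuousWithinAt_const.mul (tendsto_finsetSum _ fun ξ' _ =>
        ((continuousOn_explore ξ' p hp).sub continuousWithinAt_const).abs)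
    simpa [ContinuousWithinAt] using this
  refine tendsto_iff_dist_tendsto_zero.2 (squeeze_zero (fun _ => dist_nonneg) (fun p' => ?_) h1)
  exact hC _ _ (isPositivePolicy_explore_eta _ _) (isPositivePolicy_explore_eta _ _) ξ

lemma continuousOn_Q (ξ : M.SA) : ContinuousOn (fun p : ℝ × M.Outputs => p.2.2 ξ) M.slab := by
  fun_prop

lemma continuousOn_clip (ξ : M.SA) :
    ContinuousOn (fun p : ℝ × M.Outputs => clip (p.2.2 ξ)) M.slab :=
  (continuous_clip.comp (by fun_prop)).continuousOn

section Field

variable {act : ℝ → ℝ} {α : ℝ} {ν₀ : Measure (HiddenUnit dx da)}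

lemma isBddLip_criticField (hM : M.IsErgodic) (ξ : M.SA) :
    IsBddLip (V := M.Outputs) T R fun t x => M.criticField act α ν₀ t x.1 x.2 ξ := by
  unfold criticField
  refine (IsBddLip.const α).mul (IsBddLip.sum _ fun ξ' _ => ?_)
  refine ((IsBddLip.const _).mul (((IsBddLip.const _).add ((IsBddLip.const _).mul
    (IsBddLip.sum _ fun y _ => ?_))).sub (isBddLip_snd ξ'))).mul
    (isBddLip_policyMap hM.isLipschitzPolicyMap_stat ξ')
  exact ((isBddLip_snd y).mul (isBddLip_explore y)).mul (IsBddLip.const _)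

lemma isBddLip_actorField (hM : M.IsErgodic) (ξ : M.SA) :
    IsBddLip (V := M.Outputs) T R fun t x => M.actorField act ν₀ t x.1 x.2 ξ := by
  unfold actorField
  refine IsBddLip.sum _ fun ξ' _ => ?_
  refine (((IsBddLip.of_time (C := 1) fun t ht => ?_).mul (isBddLip_clip ξ')).mul
    ((IsBddLip.const _).sub (IsBddLip.sum _ fun a _ => ?_))).mul
    (isBddLip_policyMap hM.isLipschitzPolicyMap_visit ξ')
  · rw [abs_of_nonneg (zeta_nonneg ht.1)]
    exact zeta_le_one ht.1
  · exact (isBddLip_softmax (ξ'.1, a)).mul (IsBddLip.const _)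

lemma continuousOn_criticField (hM : M.IsErgodic) (ξ : M.SA) :
    ContinuousOn (fun p : ℝ × M.Outputs => M.criticField act α ν₀ p.1 p.2.1 p.2.2 ξ) M.slab := by
  unfold criticField
  refine continuousOn_const.mul (continuousOn_finsetSum _ fun ξ' _ => ?_)
  refine (continuousOn_const.mul ((continuousOn_const.add (continuousOn_const.mul
    (continuousOn_finsetSum _ fun y _ => ?_))).sub (continuousOn_Q ξ'))).mul
    (continuousOn_policyMap hM.isLipschitzPolicyMap_stat ξ')
  exact ((continuousOn_Q y).mul (continuousOn_explore y)).mul continuousOn_const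

lemma continuousOn_actorField (hM : M.IsErgodic) (ξ : M.SA) :
    ContinuousOn (fun p : ℝ × M.Outputs => M.actorField act ν₀ p.1 p.2.1 p.2.2 ξ) M.slab := by
  unfold actorField
  refine continuousOn_finsetSum _ fun ξ' _ => ?_
  exact (((continuousOn_time continuousOn_zeta).mul (continuousOn_clip ξ')).mul
    (continuousOn_const.sub (continuousOn_finsetSum _ fun a _ =>
      (continuousOn_softmax (ξ'.1, a)).mul continuousOn_const))).mul
    (continuousOn_policyMap hM.isLipschitzPolicyMap_visit ξ')

lemma exists_abs_kernelA_le (M : MDP dx da) (act : ℝ → ℝ) (ν₀ : Measure (HiddenUnit dx da)) :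
    ∃ C, 0 ≤ C ∧ ∀ ξ ξ', |M.kernelA act ν₀ ξ ξ'| ≤ C := by
  obtain ⟨C, hC⟩ := (Set.finite_range fun y : M.SA × M.SA => |M.kernelA act ν₀ y.1 y.2|).bddAbove
  exact ⟨max C 0, le_max_right _ _, fun ξ ξ' => (hC ⟨(ξ, ξ'), rfl⟩).trans (le_max_left _ _)⟩

/-- The actor field is bounded by `4 * C`: the clipped critic is at most `2`, the bracket at most `2
* C`, and `visit` has total mass one. The critic field grows linearly, since rewards are at most `1`
and the discounted average of `Q` is at most its supremum. -/
lemma exists_field_growth (hM : M.IsErgodic) (hα : 0 ≤ α) : ∃ K : ℝ, 0 ≤ K ∧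
    ∀ t, 0 ≤ t → ∀ x : M.Outputs, ‖M.field act α ν₀ t x‖ ≤ K * (1 + ‖x‖) := by
  obtain ⟨C, hC0, hC⟩ := exists_abs_kernelA_le M act ν₀
  have hγ0 := M.γ_pos
  have hγ1 := M.γ_lt_one
  have hg : ∀ t (P : M.SA → ℝ), M.IsPositivePolicy (M.explore (eta t) P) := fun t P =>
    isPositivePolicy_explore_eta t P
  refine ⟨2 * α * C + 4 * C, by positivity, fun t ht x => ?_⟩
  have hQ : ∀ ξ, |x.2 ξ| ≤ ‖x‖ := fun ξ => (norm_le_pi_norm x.2 ξ).trans (norm_snd_le x)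
  have hx := norm_nonneg x
  rw [norm_prod_le_iff]
  constructor
  · refine (pi_norm_le_iff_of_nonneg (by positivity)).2 fun ξ => ?_
    have hs := hM.isLipschitzPolicyMap_visit
    have hterm : ∀ ξ', |zeta t * clip (x.2 ξ') * (M.kernelA act ν₀ ξ ξ'
        - ∑ a'', M.softmax x.1 (ξ'.1, a'') * M.kernelA act ν₀ ξ (ξ'.1, a''))
        * M.visit (M.explore (eta t) x.1) ξ'|
        ≤ 4 * C * M.visit (M.explore (eta t) x.1) ξ' := by
      intro ξ'
      have h1 : |∑ a'', M.softmax x.1 (ξ'.1, a'') * M.kernelA act ν₀ ξ (ξ'.1, a'')| ≤ C := by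
        calc _ ≤ ∑ a'', |M.softmax x.1 (ξ'.1, a'') * M.kernelA act ν₀ ξ (ξ'.1, a'')| :=
              Finset.abs_sum_le_sum_abs _ _
          _ ≤ ∑ a'', M.softmax x.1 (ξ'.1, a'') * C := by
              refine Finset.sum_le_sum fun a _ => ?_
              rw [abs_mul, abs_of_pos (M.softmax_pos _ _)]
              exact mul_le_mul_of_nonneg_left (hC _ _) (M.softmax_pos _ _).le
          _ = C := by rw [← Finset.sum_mul, M.sum_softmax, one_mul]
      have h2 := abs_sub (M.kernelA act ν₀ ξ ξ')
        (∑ a'', M.softmax x.1 (ξ'.1, a'') * M.kernelA act ν₀ ξ (ξ'.1, a''))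
      have h3 := hC ξ ξ'
      have hv := hs.nonneg _ (hg t x.1) ξ'
      rw [abs_mul, abs_mul, abs_mul, abs_of_nonneg hv, abs_of_nonneg (zeta_nonneg ht),
        abs_of_nonneg (clip_nonneg _)]
      refine mul_le_mul_of_nonneg_right ?_ hv
      calc zeta t * clip (x.2 ξ') * _ ≤ 1 * 2 * (2 * C) := by
            gcongr
            · exact clip_nonneg _
            · exact zeta_le_one ht
            · exact clip_le_two _
            · linarith
        _ = 4 * C := by ring
    calc |M.actorField act ν₀ t x.1 x.2 ξ|
        ≤ ∑ ξ', 4 * C * M.visit (M.explore (eta t) x.1) ξ' :=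
          (Finset.abs_sum_le_sum_abs _ _).trans (Finset.sum_le_sum fun ξ' _ => hterm ξ')
      _ = 4 * C := by rw [← Finset.mul_sum, hs.sum_eq_one _ (hg t x.1), mul_one]
      _ ≤ (2 * α * C + 4 * C) * (1 + ‖x‖) := by
          have : 0 ≤ 2 * α * C := by positivity
          nlinarith [mul_nonneg (mul_nonneg (mul_nonneg zero_le_two hα) hC0) hx, mul_nonneg hC0 hx]
  · refine (pi_norm_le_iff_of_nonneg (by positivity)).2 fun ξ => ?_
    have hs := hM.isLipschitzPolicyMap_stat
    have hterm : ∀ ξ', |M.kernelA act ν₀ ξ ξ' * (M.r ξ' + M.γ * ∑ y : M.SA,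
        x.2 y * M.explore (eta t) x.1 y * M.p ξ' y.1 - x.2 ξ')
        * M.stat (M.explore (eta t) x.1) ξ'|
        ≤ 2 * C * (1 + ‖x‖) * M.stat (M.explore (eta t) x.1) ξ' := by
      intro ξ'
      have h1 : |∑ y : M.SA, x.2 y * M.explore (eta t) x.1 y * M.p ξ' y.1| ≤ ‖x‖ := by
        calc _ ≤ ∑ y : M.SA, |x.2 y * M.explore (eta t) x.1 y * M.p ξ' y.1| :=
              Finset.abs_sum_le_sum_abs _ _
          _ ≤ ∑ y : M.SA, ‖x‖ * M.chain (M.explore (eta t) x.1) ξ' y := by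
              refine Finset.sum_le_sum fun y _ => ?_
              have hy := M.chain_nonneg (hg t x.1) ξ' y
              have e : x.2 y * M.explore (eta t) x.1 y * M.p ξ' y.1
                  = x.2 y * M.chain (M.explore (eta t) x.1) ξ' y := by unfold chain; ring
              rw [e, abs_mul, abs_of_nonneg hy]
              exact mul_le_mul_of_nonneg_right (hQ y) hy
          _ = ‖x‖ := by rw [← Finset.mul_sum, M.sum_chain (hg t x.1), mul_one]
      have h2 : |M.r ξ' + M.γ * ∑ y : M.SA, x.2 y * M.explore (eta t) x.1 y * M.p ξ' y.1 - x.2 ξ'|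
          ≤ 2 * (1 + ‖x‖) := by
        have e1 := abs_le.1 (M.r_bound ξ')
        have e2 := abs_le.1 (hQ ξ')
        have e3 : |M.γ * ∑ y : M.SA, x.2 y * M.explore (eta t) x.1 y * M.p ξ' y.1| ≤ ‖x‖ := by
          rw [abs_mul, abs_of_pos hγ0]
          exact (mul_le_of_le_one_left (abs_nonneg _) hγ1.le).trans h1
        have e4 := abs_le.1 e3
        rw [abs_le]
        constructor <;> linarith [e1.1, e1.2, e2.1, e2.2, e4.1, e4.2]
      have hv := hs.nonneg _ (hg t x.1) ξ'
      rw [abs_mul, abs_mul, abs_of_nonneg hv]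
      refine mul_le_mul_of_nonneg_right ?_ hv
      calc |M.kernelA act ν₀ ξ ξ'| * _ ≤ C * (2 * (1 + ‖x‖)) := by
            gcongr
            exact hC _ _
        _ = 2 * C * (1 + ‖x‖) := by ring
    have hsum : |∑ ξ', M.kernelA act ν₀ ξ ξ' * (M.r ξ' + M.γ * ∑ y : M.SA,
        x.2 y * M.explore (eta t) x.1 y * M.p ξ' y.1 - x.2 ξ')
        * M.stat (M.explore (eta t) x.1) ξ'| ≤ 2 * C * (1 + ‖x‖) := by
      calc _ ≤ ∑ ξ', 2 * C * (1 + ‖x‖) * M.stat (M.explore (eta t) x.1) ξ' :=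
            (Finset.abs_sum_le_sum_abs _ _).trans (Finset.sum_le_sum fun ξ' _ => hterm ξ')
        _ = 2 * C * (1 + ‖x‖) := by rw [← Finset.mul_sum, hs.sum_eq_one _ (hg t x.1), mul_one]
    calc |M.criticField act α ν₀ t x.1 x.2 ξ| ≤ α * (2 * C * (1 + ‖x‖)) := by
          unfold criticField
          simp only
          rw [abs_mul, abs_of_nonneg hα]
          gcongr
      _ ≤ (2 * α * C + 4 * C) * (1 + ‖x‖) := by nlinarith [mul_nonneg hC0 hx]

theorem isTameField_field (hM : M.IsErgodic) (hα : 0 ≤ α) (T : ℝ) :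
    IsTameField (M.field act α ν₀) T where
  growth := by
    obtain ⟨K, hK0, hK⟩ := exists_field_growth (act := act) (ν₀ := ν₀) hM hα
    exact ⟨K, hK0, fun t ht x => hK t ht.1 x⟩
  lipschitz R := by
    choose C hC0 hC using fun ξ : M.SA =>
      isBddLip_actorField (act := act) (ν₀ := ν₀) (T := T) (R := R) hM ξ
    choose D hD0 hD using fun ξ : M.SA =>
      isBddLip_criticField (act := act) (α := α) (ν₀ := ν₀) (T := T) (R := R) hM ξ
    have hC' : 0 ≤ ∑ ξ, C ξ := Finset.sum_nonneg fun ξ _ => hC0 ξ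
    have hD' : 0 ≤ ∑ ξ, D ξ := Finset.sum_nonneg fun ξ _ => hD0 ξ
    refine ⟨(∑ ξ, C ξ + ∑ ξ, D ξ).toNNReal, fun t ht =>
      LipschitzOnWith.of_dist_le_mul fun x hx y hy => ?_⟩
    rw [Real.coe_toNNReal _ (by positivity), dist_eq_norm, dist_eq_norm, norm_prod_le_iff]
    constructor
    · refine (pi_norm_le_iff_of_nonneg (by positivity)).2 fun ξ => ?_
      refine ((hC ξ t ht x hx).2 y hy).trans (mul_le_mul_of_nonneg_right ?_ (norm_nonneg _))
      exact (Finset.single_le_sum (fun ξ _ => hC0 ξ) (Finset.mem_univ ξ)).trans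
        (le_add_of_nonneg_right hD')
    · refine (pi_norm_le_iff_of_nonneg (by positivity)).2 fun ξ => ?_
      refine ((hD ξ t ht x hx).2 y hy).trans (mul_le_mul_of_nonneg_right ?_ (norm_nonneg _))
      exact (Finset.single_le_sum (fun ξ _ => hD0 ξ) (Finset.mem_univ ξ)).trans
        (le_add_of_nonneg_left hC')
  continuousOn := by
    have h : ContinuousOn (fun p : ℝ × M.Outputs => M.field act α ν₀ p.1 p.2) M.slab :=
      (continuousOn_pi.2 fun ξ => continuousOn_actorField hM ξ).prodMk
        (continuousOn_pi.2 fun ξ => continuousOn_criticField hM ξ)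
    exact h.mono fun p hp => ⟨hp.1.1, trivial⟩

end Field

end MDP

/-! ### Measurability of the algorithm -/

namespace IsActivation

variable {act : ℝ → ℝ}

lemma differentiable (h : IsActivation act) : Differentiable ℝ act :=
  h.contDiff.differentiable (by norm_num)

lemma continuous (h : IsActivation act) : Continuous act := h.contDiff.continuous

lemma differentiable_deriv (h : IsActivation act) : Differentiable ℝ (deriv act) := by
  have h2 : ContDiff ℝ (1 + 1) act := by simpa [one_add_one_eq_two] using h.contDiff
  exact (contDiff_succ_iff_deriv.1 h2).2.2.differentiable (by norm_num)

lemma continuous_deriv (h : IsActivation act) : Continuous (deriv act) :=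
  h.differentiable_deriv.continuous

end IsActivation

namespace MDP

variable {dx da : ℕ} {M : MDP dx da}

lemma continuous_dot (ξ : M.SA) : Continuous fun w => M.dot w ξ := by unfold dot; fun_prop

lemma continuous_net {act : ℝ → ℝ} (hact : Continuous act) {N : ℕ} :
    Continuous fun θ : Fin N → HiddenUnit dx da => M.net act θ := by
  have h := fun ξ : M.SA => continuous_dot ξ
  refine continuous_pi fun ξ => continuous_const.mul (continuous_finsetSum _ fun i _ => ?_)
  exact ((continuous_apply i).fst).mul (hact.comp ((h ξ).comp (continuous_apply i).snd))

lemma continuous_criticStep {act : ℝ → ℝ} (hact : IsActivation act) (α : ℝ) {N : ℕ} (ξ ξ' : M.SA) :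
    Continuous fun θ : Fin N → HiddenUnit dx da => M.criticStep act α θ ξ ξ' := by
  have hn := fun ξ : M.SA => (continuous_apply ξ).comp
    (continuous_net (M := M) hact.continuous (N := N))
  have hd := fun ξ : M.SA => continuous_dot ξ
  have hc := hact.continuous
  have hc' := hact.continuous_deriv
  refine continuous_pi fun i => ?_
  have hw : Continuous fun θ : Fin N → HiddenUnit dx da => (θ i).2 := (continuous_apply i).snd
  have hv : Continuous fun θ : Fin N → HiddenUnit dx da => (θ i).1 := (continuous_apply i).fst
  have hδ : Continuous fun θ : Fin N → HiddenUnit dx da => α / N / √(N : ℝ)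
      * (M.r ξ + M.γ * M.net act θ ξ' - M.net act θ ξ) :=
    continuous_const.mul ((continuous_const.add (continuous_const.mul (hn ξ'))).sub (hn ξ))
  exact (hv.add (hδ.mul (hc.comp ((hd ξ).comp hw)))).prodMk
    (hw.add ((hδ.mul (hv.mul (hc'.comp ((hd ξ).comp hw)))).smul continuous_const))

lemma continuous_actorStep {act : ℝ → ℝ} (hact : IsActivation act) (ζ : ℝ) {N : ℕ} (ξ : M.SA) :
    Continuous fun p : (Fin N → HiddenUnit dx da) × (M.SA → ℝ) =>
      M.actorStep act ζ p.1 p.2 ξ := by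
  have hn := continuous_net (M := M) hact.continuous (N := N)
  have hd := fun ξ : M.SA => continuous_dot ξ
  have hc := hact.continuous
  have hc' := hact.continuous_deriv
  refine continuous_pi fun i => ?_
  have hw : Continuous fun p : (Fin N → HiddenUnit dx da) × (M.SA → ℝ) => (p.1 i).2 :=
    ((continuous_apply i).comp continuous_fst).snd
  have hv : Continuous fun p : (Fin N → HiddenUnit dx da) × (M.SA → ℝ) => (p.1 i).1 :=
    ((continuous_apply i).comp continuous_fst).fst
  have hf : ∀ ξ, Continuous fun p : (Fin N → HiddenUnit dx da) × (M.SA → ℝ) =>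
      M.softmax (M.net act p.1) ξ := fun ξ =>
    (continuous_softmax ξ).comp (hn.comp continuous_fst)
  have hδ : Continuous fun p : (Fin N → HiddenUnit dx da) × (M.SA → ℝ) =>
      ζ / (N * √(N : ℝ)) * clip (p.2 ξ) :=
    continuous_const.mul (continuous_clip.comp ((continuous_apply ξ).comp continuous_snd))
  have hσ : ∀ ξ, Continuous fun p : (Fin N → HiddenUnit dx da) × (M.SA → ℝ) =>
      act (M.dot (p.1 i).2 ξ) := fun ξ => hc.comp ((hd ξ).comp hw)
  have hσ' : ∀ ξ, Continuous fun p : (Fin N → HiddenUnit dx da) × (M.SA → ℝ) =>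
      (p.1 i).1 * deriv act (M.dot (p.1 i).2 ξ) := fun ξ => hv.mul (hc'.comp ((hd ξ).comp hw))
  exact (hv.add (hδ.mul ((hσ ξ).sub (continuous_finsetSum _ fun a _ =>
      (hf (ξ.1, a)).mul (hσ (ξ.1, a)))))).prodMk
    (hw.add (hδ.smul (((hσ' ξ).smul continuous_const).sub (continuous_finsetSum _ fun a _ =>
      ((hf (ξ.1, a)).mul (hσ' (ξ.1, a))).smul continuous_const))))

namespace NACData

variable {N : ℕ} {Ω : Type*} (D : M.NACData N Ω) {act : ℝ → ℝ} {α : ℝ}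

lemma measurable_history_θ₀ (k : ℕ) : Measurable[D.history k] D.θ₀ :=
  (comap_measurable _).fst

lemma measurable_history_ϑ₀ (k : ℕ) : Measurable[D.history k] D.ϑ₀ :=
  (comap_measurable _).snd.fst

lemma measurable_history_pair {j k : ℕ} (hjk : j ≤ k) :
    Measurable[D.history k] fun ω => (D.ξ j ω, D.ξt j ω) := by
  have h : Measurable[D.history k] fun ω => fun i : Fin (k + 1) => (D.ξ i ω, D.ξt i ω) :=
    (comap_measurable _).snd.snd
  let := D.history k
  exact (measurable_pi_iff.1 h) ⟨j, by omega⟩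

lemma measurable_history_ξ {j k : ℕ} (hjk : j ≤ k) : Measurable[D.history k] (D.ξ j) :=
  (D.measurable_history_pair hjk).fst

lemma measurable_history_ξt {j k : ℕ} (hjk : j ≤ k) : Measurable[D.history k] (D.ξt j) :=
  (D.measurable_history_pair hjk).snd

lemma history_mono {j k : ℕ} (hjk : j ≤ k) : D.history j ≤ D.history k := by
  refine Measurable.comap_le ?_
  refine (D.measurable_history_θ₀ k).prodMk ((D.measurable_history_ϑ₀ k).prodMk ?_)
  let := D.history k
  exact measurable_pi_iff.2 fun i => D.measurable_history_pair (by omega)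

lemma IsOnlineNAC.history_le {D : M.NACData N Ω} [mΩ : MeasurableSpace Ω]
    {ν₀ : Measure (HiddenUnit dx da)} {Pr : Measure Ω} (hD : D.IsOnlineNAC act α ν₀ Pr) (k : ℕ) :
    D.history k ≤ mΩ := by
  refine Measurable.comap_le ?_
  exact hD.measurable_θ₀.prodMk (hD.measurable_ϑ₀.prodMk
    (measurable_pi_iff.2 fun i => (hD.measurable_ξ i).prodMk (hD.measurable_ξt i)))

/-- The filtration of the histories. -/
def filtration {D : M.NACData N Ω} [mΩ : MeasurableSpace Ω] {ν₀ : Measure (HiddenUnit dx da)}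
    {Pr : Measure Ω} (hD : D.IsOnlineNAC act α ν₀ Pr) : Filtration ℕ mΩ where
  seq := D.history
  mono' _ _ h := D.history_mono h
  le' k := hD.history_le k

/-- The critic update from `k` to `k + 1` uses `ξ (k + 1)`, so the new state is measurable for the
history up to `k + 1` and no earlier. The samples take finitely many values, so continuity of each
update in the parameters suffices. -/
lemma measurable_state (hact : IsActivation act) (k : ℕ) :
    Measurable[D.history k] (D.state act α k) := by
  induction k with
  | zero => exact (D.measurable_history_θ₀ 0).prodMk (D.measurable_history_ϑ₀ 0)
  | succ k ih =>
    have h := ih.mono (D.history_mono (Nat.le_succ k)) le_rfl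
    have hθ := h.fst
    have hϑ := h.snd
    have hQ : Measurable[D.history (k + 1)] fun ω => M.net act (D.state act α k ω).2 :=
      (continuous_net hact.continuous).measurable.comp hϑ
    refine Measurable.prodMk ?_ ?_
    · exact measurable_comp_finite
        (f := fun ξ (p : (Fin N → HiddenUnit dx da) × (M.SA → ℝ)) =>
          M.actorStep act (zeta ((k : ℝ) / N)) p.1 p.2 ξ)
        (fun ξ => (continuous_actorStep hact _ ξ).measurable)
        (D.measurable_history_ξt (Nat.le_succ k)) (hθ.prodMk hQ)
    · exact measurable_comp_finite
        (f := fun (ξ : M.SA × M.SA) (θ : Fin N → HiddenUnit dx da) =>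
          M.criticStep act α θ ξ.1 ξ.2)
        (fun ξ => (continuous_criticStep hact α ξ.1 ξ.2).measurable)
        ((D.measurable_history_ξ (Nat.le_succ k)).prodMk (D.measurable_history_ξ le_rfl)) hϑ

/-- The pair of the network outputs after `k` updates. -/
noncomputable def outputs (act : ℝ → ℝ) (α : ℝ) (k : ℕ) (ω : Ω) : M.Outputs :=
  (D.P act α k ω, D.Q act α k ω)

lemma measurable_outputs (hact : IsActivation act) (k : ℕ) :
    Measurable[D.history k] (D.outputs act α k) :=
  ((continuous_net hact.continuous).measurable.comp (D.measurable_state hact k).fst).prodMk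
    ((continuous_net hact.continuous).measurable.comp (D.measurable_state hact k).snd)

end NACData

/-! ### Averaging for the critic and actor chains -/

section ChainAveraging

variable {q : M.SA → M.X → ℝ} {s : (M.SA → ℝ) → M.SA → ℝ}

/-- Transition probabilities of state-action pairs for the exploration policy. -/
noncomputable def policyKernel (q : M.SA → M.X → ℝ) (t : ℝ) (x : M.Outputs) :
    Matrix M.SA M.SA ℝ := fun y z => q y z.1 * M.explore (eta t) x.1 z

lemma continuousOn_policyKernel (q : M.SA → M.X → ℝ) (y z : M.SA) :
    ContinuousOn (fun p : ℝ × M.Outputs => policyKernel q p.1 p.2 y z) M.slab :=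
  continuousOn_const.mul (continuousOn_explore z)

/-- Averaging along a chain with transition probabilities `q` and the exploration policy. -/
theorem eventually_abs_sum_sub_policy_average_le (hq0 : ∀ ξ x, 0 ≤ q ξ x)
    (hq1 : ∀ ξ, ∑ x, q ξ x = 1) (hs : M.IsLipschitzPolicyMap s)
    (hstat : ∀ t (x : M.Outputs),
      IsStationaryDist (policyKernel q t x) (s (M.explore (eta t) x.1)))
    (hirr : ∀ t (x : M.Outputs), (policyKernel q t x).IsIrreducible)
    {Ω : ℕ+ → Type*} [mΩ : ∀ N, MeasurableSpace (Ω N)] {Pr : ∀ N, Measure (Ω N)}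
    [∀ N, IsProbabilityMeasure (Pr N)] {T : ℝ}
    (𝓕 : ∀ N, Filtration ℕ (mΩ N)) {X : ∀ N, ℕ → Ω N → M.Outputs} {ξ : ∀ N, ℕ → Ω N → M.SA}
    (hX : ∀ N k, Measurable[𝓕 N k] (X N k)) (hξ : ∀ N k, Measurable[𝓕 N k] (ξ N k))
    {ψ : ℝ → M.Outputs → M.SA → M.SA → ℝ}
    (hψc : ∀ y z, ContinuousOn (fun p : ℝ × M.Outputs => ψ p.1 p.2 y z) M.slab)
    {ψbar : ℝ → M.Outputs → ℝ} (hψbar : ∀ t, 0 ≤ t → ∀ x, ψbar t x =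
      ∑ y, s (M.explore (eta t) x.1) y * ∑ z, policyKernel q t x y z * ψ t x y z)
    (hcond : ∀ N k y, (Pr N)[{ω | ξ N (k + 1) ω = y}.indicator (fun _ => (1 : ℝ)) | 𝓕 N k]
      =ᵐ[Pr N] fun ω => policyKernel q ((k : ℝ) / N) (X N k ω) (ξ N k ω) y)
    {G : ∀ N, Set (Ω N)} (hG : ∀ N, MeasurableSet[𝓕 N 0] (G N)) {R : ℝ}
    (hGX : ∀ N, ∀ ω ∈ G N, ∀ k : ℕ, (k : ℝ) ≤ N * T → ‖X N k ω‖ ≤ R)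
    (hGd : ∀ N, ∀ ω ∈ G N, ∀ k : ℕ, (k : ℝ) + 1 ≤ N * T →
      ‖X N (k + 1) ω - X N k ω‖ ≤ R / N) {ε : ℝ} (hε : 0 < ε) :
    ∀ᶠ p in probFilter Pr, p.2 ∈ G p.1 → ∀ n : ℕ, (n : ℝ) ≤ p.1 * T →
      |∑ k ∈ Finset.range n, (ψ ((k : ℝ) / p.1) (X p.1 k p.2) (ξ p.1 k p.2) (ξ p.1 (k + 1) p.2)
        - ψbar ((k : ℝ) / p.1) (X p.1 k p.2))| ≤ ε * p.1 := by
  have hrow : ∀ t (x : M.Outputs) y, ∑ z, policyKernel q t x y z = 1 := fun t x y =>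
    M.sum_mul_policy hq1 (isPositivePolicy_explore_eta t x.1) y
  have hφ : ∀ y, ContinuousOn (fun p : ℝ × M.Outputs =>
      ∑ z, policyKernel q p.1 p.2 y z * ψ p.1 p.2 y z) M.slab := fun y =>
    continuousOn_finsetSum _ fun z _ => (continuousOn_policyKernel q y z).mul (hψc y z)
  -- The Poisson equation is solved for the expectation of `ψ` over the next state, whose stationary
  -- mean is `ψbar`.
  refine eventually_abs_sum_sub_average_le 𝓕 hX hξ (κ := fun t x => policyKernel q t x)
    (h := fun t x => poissonSol (policyKernel q t x) (s (M.explore (eta t) x.1))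
      fun y => ∑ z, policyKernel q t x y z * ψ t x y z)
    (fun t _ x y z => mul_nonneg (hq0 _ _) ((isPositivePolicy_explore_eta t x.1).pos z).le)
    (fun t _ x y => hrow t x y) (continuousOn_policyKernel q) hψc (fun y => ?_) ?_ hcond hG hGX hGd
    hε
  · exact continuousOn_poissonSol (K := fun p : ℝ × M.Outputs => policyKernel q p.1 p.2)
      (continuousOn_policyKernel q) (fun i => continuousOn_policyMap hs i) hφ
      (fun p _ => det_fundamentalMatrix_ne_zero (hrow _ _) (hirr _ _) (hstat _ _)) y
  · intro t ht x y
    rw [hψbar t ht x]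
    exact poissonSol_sub (hrow t x) (hirr t x) (hstat t x) _ y

end ChainAveraging

end MDP

/-! ### Gradient steps of a wide network -/

namespace IsActivation

variable {act : ℝ → ℝ}

lemma abs_sub_le (h : IsActivation act) (x y : ℝ) : |act y - act x| ≤ |y - x| := by
  have := Convex.norm_image_sub_le_of_norm_deriv_le (𝕜 := ℝ) (f := act) (C := 1) (s := Set.univ)
    (x := x) (y := y) (fun z _ => h.differentiable z) (fun z _ => h.bound_deriv z)
    convex_univ trivial trivial
  simpa using this

lemma abs_deriv_sub_le (h : IsActivation act) (x y : ℝ) :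
    |deriv act y - deriv act x| ≤ |y - x| := by
  have := Convex.norm_image_sub_le_of_norm_deriv_le (𝕜 := ℝ) (f := deriv act) (C := 1)
    (s := Set.univ) (x := x) (y := y) (fun z _ => h.differentiable_deriv z)
    (fun z _ => h.bound_deriv₂ z) convex_univ trivial trivial
  simpa using this

/-- Mean value inequality for `act z - deriv act x * z` between `x` and `y`, where its derivative is
at most `|y - x|`. -/
lemma abs_sub_sub_deriv_mul_le (h : IsActivation act) (x y : ℝ) :
    |act y - act x - deriv act x * (y - x)| ≤ |y - x| ^ 2 := by
  have hd : ∀ z, HasDerivAt (fun z => act z - deriv act x * z) (deriv act z - deriv act x) z :=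
    fun z => by
      have := (h.differentiable z).hasDerivAt.sub ((hasDerivAt_id z).const_mul (deriv act x))
      rw [mul_one] at this
      exact this
  have := Convex.norm_image_sub_le_of_norm_hasDerivWithin_le (𝕜 := ℝ) (C := |y - x|)
    (f := fun z => act z - deriv act x * z) (s := Set.uIcc x y) (x := x) (y := y)
    (fun z _ => (hd z).hasDerivWithinAt) (fun z hz => ?_) (convex_uIcc x y)
    Set.left_mem_uIcc Set.right_mem_uIcc
  · rw [Real.norm_eq_abs, Real.norm_eq_abs, ← sq] at this
    convert this using 2
    ring
  · exact (h.abs_deriv_sub_le x z).trans (Set.abs_sub_left_of_mem_uIcc hz)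

end IsActivation

namespace MDP

variable {dx da : ℕ} {M : MDP dx da}

/-- A bound for the state-action vectors. -/
noncomputable def radius (M : MDP dx da) : ℝ := 1 + ∑ ξ : M.SA, ‖M.vec ξ‖

lemma one_le_radius : 1 ≤ M.radius :=
  le_add_of_nonneg_right (Finset.sum_nonneg fun _ _ => norm_nonneg _)

lemma norm_vec_le (ξ : M.SA) : ‖M.vec ξ‖ ≤ M.radius := by
  have := Finset.single_le_sum (f := fun ξ : M.SA => ‖M.vec ξ‖) (fun _ _ => norm_nonneg _)
    (Finset.mem_univ ξ)
  unfold radius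
  linarith

lemma abs_dot_sub_le (w w' : Weight dx da) (ξ : M.SA) :
    |M.dot w' ξ - M.dot w ξ| ≤ ‖w' - w‖ * M.radius := by
  rw [dot, dot, ← inner_sub_left]
  exact (abs_real_inner_le_norm _ _).trans
    (mul_le_mul_of_nonneg_left (norm_vec_le ξ) (norm_nonneg _))

lemma abs_inner_vec_le (ξ y : M.SA) : |inner ℝ (M.vec ξ) (M.vec y)| ≤ M.radius ^ 2 := by
  refine (abs_real_inner_le_norm _ _).trans ?_
  rw [sq]
  exact mul_le_mul (norm_vec_le ξ) (norm_vec_le y) (norm_nonneg _)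
    (zero_le_one.trans one_le_radius)

/-- A step of the parameters in the direction of the gradient of `√N ∑ b_y net(θ)(y)`. -/
noncomputable def gradStep (act : ℝ → ℝ) {N : ℕ} (θ : Fin N → HiddenUnit dx da) (b : M.SA → ℝ) :
    Fin N → HiddenUnit dx da :=
  fun i => ((θ i).1 + ∑ y, b y * act (M.dot (θ i).2 y),
    (θ i).2 + ∑ y, (b y * ((θ i).1 * deriv act (M.dot (θ i).2 y))) • M.vec y)

/-- The integrand of `kernelA`. -/
noncomputable def unitKernel (act : ℝ → ℝ) (ξ ξ' : M.SA) (z : HiddenUnit dx da) : ℝ :=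
  act (M.dot z.2 ξ') * act (M.dot z.2 ξ)
    + z.1 ^ 2 * (deriv act (M.dot z.2 ξ') * deriv act (M.dot z.2 ξ)
      * inner ℝ (M.vec ξ) (M.vec ξ'))

/-- The neural tangent kernel of the finite network. -/
noncomputable def empKernel (act : ℝ → ℝ) {N : ℕ} (θ : Fin N → HiddenUnit dx da) (ξ ξ' : M.SA) :
    ℝ := 1 / (N : ℝ) * ∑ i, unitKernel act ξ ξ' (θ i)

section GradStep

variable {act : ℝ → ℝ} {N : ℕ} {θ : Fin N → HiddenUnit dx da} {b : M.SA → ℝ} {κ : ℝ}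

lemma abs_gradStep_fst_sub_le (hact : IsActivation act) (θ : Fin N → HiddenUnit dx da)
    (b : M.SA → ℝ) (i : Fin N) : |(gradStep act θ b i).1 - (θ i).1| ≤ ∑ y, |b y| := by
  simp only [gradStep, add_sub_cancel_left]
  refine (Finset.abs_sum_le_sum_abs _ _).trans (Finset.sum_le_sum fun y _ => ?_)
  rw [abs_mul]
  exact mul_le_of_le_one_right (abs_nonneg _) (hact.bound _)

lemma norm_gradStep_snd_sub_le (hact : IsActivation act) (hκ : ∀ i, |(θ i).1| ≤ κ)
    (b : M.SA → ℝ) (i : Fin N) :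
    ‖(gradStep act θ b i).2 - (θ i).2‖ ≤ (∑ y, |b y|) * (κ * M.radius) := by
  simp only [gradStep, add_sub_cancel_left]
  refine (norm_sum_le _ _).trans ?_
  rw [Finset.sum_mul]
  refine Finset.sum_le_sum fun y _ => ?_
  rw [norm_smul, Real.norm_eq_abs, abs_mul, abs_mul, mul_assoc]
  have h1 : |(θ i).1| * |deriv act (M.dot (θ i).2 y)| ≤ κ :=
    (mul_le_of_le_one_right (abs_nonneg _) (hact.bound_deriv _)).trans (hκ i)
  exact mul_le_mul_of_nonneg_left (mul_le_mul h1 (norm_vec_le y) (norm_nonneg _)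
    ((abs_nonneg _).trans (hκ i))) (abs_nonneg _)

lemma norm_gradStep_sub_le (hact : IsActivation act) (hκ1 : 1 ≤ κ) (hκ : ∀ i, |(θ i).1| ≤ κ)
    (b : M.SA → ℝ) (i : Fin N) :
    ‖gradStep act θ b i - θ i‖ ≤ (∑ y, |b y|) * (κ * M.radius) := by
  refine max_le ?_ (norm_gradStep_snd_sub_le hact hκ b i)
  refine (abs_gradStep_fst_sub_le hact θ b i).trans (le_mul_of_one_le_right
    (Finset.sum_nonneg fun _ _ => abs_nonneg _) ?_)
  exact one_le_mul_of_one_le_of_one_le hκ1 one_le_radius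

lemma abs_gradStep_dot_sub_le (hact : IsActivation act) (hκ : ∀ i, |(θ i).1| ≤ κ)
    (b : M.SA → ℝ) (i : Fin N) (ξ : M.SA) :
    |M.dot (gradStep act θ b i).2 ξ - M.dot (θ i).2 ξ| ≤ (∑ y, |b y|) * (κ * M.radius ^ 2) := by
  refine (abs_dot_sub_le _ _ ξ).trans ((mul_le_mul_of_nonneg_right
    (norm_gradStep_snd_sub_le hact hκ b i) (zero_le_one.trans one_le_radius)).trans_eq ?_)
  ring

lemma sum_le_card_mul {N : ℕ} {f : Fin N → ℝ} {c : ℝ} (h : ∀ i, |f i| ≤ c) :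
    |∑ i, f i| ≤ N * c := by
  refine (Finset.abs_sum_le_sum_abs _ _).trans ((Finset.sum_le_sum fun i _ => h i).trans_eq ?_)
  simp

lemma abs_one_div_sqrt_mul_sum_le {N : ℕ} {f : Fin N → ℝ} {c : ℝ} (h : ∀ i, |f i| ≤ c) :
    |1 / √(N : ℝ) * ∑ i, f i| ≤ √(N : ℝ) * c := by
  rw [abs_mul, abs_of_nonneg (by positivity)]
  refine (mul_le_mul_of_nonneg_left (sum_le_card_mul h) (by positivity)).trans_eq ?_
  rw [← mul_assoc, one_div_mul_eq_div, Real.div_sqrt]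

/-- Each of the `N` units changes its output by the order of `∑ |b y|`, and the normalisation `1 /
√N` turns the sum over the units into a factor `√N`. -/
lemma abs_net_gradStep_sub_le (hact : IsActivation act) (hκ1 : 1 ≤ κ) (hκ : ∀ i, |(θ i).1| ≤ κ)
    (b : M.SA → ℝ) (ξ : M.SA) :
    |M.net act (gradStep act θ b) ξ - M.net act θ ξ|
      ≤ √(N : ℝ) * (2 * κ ^ 2 * M.radius ^ 2 * ∑ y, |b y|) := by
  have hB := one_le_radius (M := M)
  have hb : 0 ≤ ∑ y, |b y| := Finset.sum_nonneg fun _ _ => abs_nonneg _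
  simp only [net]
  rw [← mul_sub, ← Finset.sum_sub_distrib]
  refine abs_one_div_sqrt_mul_sum_le fun i => ?_
  have e : (gradStep act θ b i).1 * act (M.dot (gradStep act θ b i).2 ξ)
      - (θ i).1 * act (M.dot (θ i).2 ξ)
      = ((gradStep act θ b i).1 - (θ i).1) * act (M.dot (gradStep act θ b i).2 ξ)
        + (θ i).1 * (act (M.dot (gradStep act θ b i).2 ξ) - act (M.dot (θ i).2 ξ)) := by ring
  rw [e]
  refine (abs_add_le _ _).trans ?_
  rw [abs_mul, abs_mul]
  have h1 := mul_le_mul (abs_gradStep_fst_sub_le hact θ b i)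
    (hact.bound (M.dot (gradStep act θ b i).2 ξ)) (abs_nonneg _) hb
  have h2 := mul_le_mul (hκ i) ((hact.abs_sub_le _ _).trans (abs_gradStep_dot_sub_le hact hκ b i ξ))
    (abs_nonneg _) (zero_le_one.trans hκ1)
  have h3 : (1 : ℝ) ≤ κ ^ 2 * M.radius ^ 2 :=
    one_le_mul_of_one_le_of_one_le (one_le_pow₀ hκ1) (one_le_pow₀ hB)
  nlinarith

/-- To first order the output of a unit changes by `∑ b y * unitKernel`, whose average over the
units is the empirical kernel. The remainder is quadratic in `b`: the product of the increments of
the two factors, and the Taylor remainder of the activation. -/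
lemma abs_net_gradStep_sub_sub_le (hact : IsActivation act) (hκ1 : 1 ≤ κ)
    (hκ : ∀ i, |(θ i).1| ≤ κ) (b : M.SA → ℝ) (ξ : M.SA) :
    |M.net act (gradStep act θ b) ξ - M.net act θ ξ
      - √(N : ℝ) * ∑ y, b y * empKernel act θ ξ y|
      ≤ √(N : ℝ) * (2 * κ ^ 3 * M.radius ^ 4 * (∑ y, |b y|) ^ 2) := by
  have hB := one_le_radius (M := M)
  have hb : 0 ≤ ∑ y, |b y| := Finset.sum_nonneg fun _ _ => abs_nonneg _
  have e0 : √(N : ℝ) * ∑ y, b y * empKernel act θ ξ y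
      = 1 / √(N : ℝ) * ∑ i, ∑ y, b y * unitKernel act ξ y (θ i) := by
    simp only [empKernel]
    rw [Finset.sum_comm]
    simp_rw [← Finset.mul_sum, mul_left_comm (b _) (1 / (N : ℝ)), ← Finset.mul_sum]
    rw [← mul_assoc]
    congr 1
    rcases Nat.eq_zero_or_pos N with rfl | hN
    · simp
    have hN' : (0 : ℝ) < N := by exact_mod_cast hN
    rw [mul_one_div, Real.sqrt_div_self, one_div]
  rw [e0]
  simp only [net]
  rw [← mul_sub, ← mul_sub, ← Finset.sum_sub_distrib, ← Finset.sum_sub_distrib]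
  refine abs_one_div_sqrt_mul_sum_le fun i => ?_
  set c := (θ i).1 with hc
  set x := M.dot (θ i).2 ξ with hx
  set c' := (gradStep act θ b i).1 with hc'
  set x' := M.dot (gradStep act θ b i).2 ξ with hx'
  have hdc : c' - c = ∑ y, b y * act (M.dot (θ i).2 y) := by
    simp [hc', hc, gradStep]
  have hdx : x' - x
      = ∑ y, b y * (c * deriv act (M.dot (θ i).2 y)) * inner ℝ (M.vec ξ) (M.vec y) := by
    rw [hx', hx, dot, dot, ← inner_sub_left]
    simp only [gradStep, add_sub_cancel_left, sum_inner, inner_smul_left]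
    refine Finset.sum_congr rfl fun y _ => ?_
    rw [real_inner_comm]
    rfl
  have e1 : ∑ y, b y * unitKernel act ξ y (θ i)
      = (c' - c) * act x + c * deriv act x * (x' - x) := by
    rw [hdc, hdx, Finset.sum_mul, Finset.mul_sum, ← Finset.sum_add_distrib]
    refine Finset.sum_congr rfl fun y _ => ?_
    rw [unitKernel]
    ring
  rw [e1]
  have e : c' * act x' - c * act x - ((c' - c) * act x + c * deriv act x * (x' - x))
      = (c' - c) * (act x' - act x) + c * (act x' - act x - deriv act x * (x' - x)) := by ring
  rw [e]
  refine (abs_add_le _ _).trans ?_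
  rw [abs_mul, abs_mul]
  have hΔ : |x' - x| ≤ _ := abs_gradStep_dot_sub_le hact hκ b i ξ
  have hκ0 : 0 ≤ κ := zero_le_one.trans hκ1
  have h1 := mul_le_mul (abs_gradStep_fst_sub_le hact θ b i) ((hact.abs_sub_le _ _).trans hΔ)
    (abs_nonneg _) hb
  have h2 := mul_le_mul (hκ i) ((hact.abs_sub_sub_deriv_mul_le x x').trans
    (pow_le_pow_left₀ (abs_nonneg _) hΔ 2)) (abs_nonneg _) hκ0
  have h3 : κ * M.radius ^ 2 ≤ κ ^ 3 * M.radius ^ 4 :=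
    mul_le_mul (le_self_pow₀ hκ1 (by norm_num)) (pow_le_pow_right₀ hB (by norm_num))
      (by positivity) (by positivity)
  calc _ ≤ _ := add_le_add h1 h2
    _ = (∑ y, |b y|) ^ 2 * (κ * M.radius ^ 2) + (∑ y, |b y|) ^ 2 * (κ ^ 3 * M.radius ^ 4) := by ring
    _ ≤ (∑ y, |b y|) ^ 2 * (κ ^ 3 * M.radius ^ 4)
        + (∑ y, |b y|) ^ 2 * (κ ^ 3 * M.radius ^ 4) := by gcongr
    _ = _ := by ring

/-- The factor `c ^ 2` is Lipschitz only for bounded output weights, hence the dependence on `κ`;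
everything else is bounded and Lipschitz by the assumptions on the activation. -/
lemma abs_unitKernel_sub_le (hact : IsActivation act) (hκ1 : 1 ≤ κ) {z z' : HiddenUnit dx da}
    (hz : |z.1| ≤ κ) (hz' : |z'.1| ≤ κ) (ξ y : M.SA) :
    |unitKernel act ξ y z' - unitKernel act ξ y z| ≤ 6 * κ ^ 2 * M.radius ^ 3 * ‖z' - z‖ := by
  have hB := one_le_radius (M := M)
  have hd := norm_nonneg (z' - z)
  have hκ0 : 0 ≤ κ := zero_le_one.trans hκ1
  have h1 : |z'.1 - z.1| ≤ ‖z' - z‖ := norm_fst_le (z' - z)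
  have h2 : ‖z'.2 - z.2‖ ≤ ‖z' - z‖ := norm_snd_le (z' - z)
  have hx : ∀ v : M.SA, |M.dot z'.2 v - M.dot z.2 v| ≤ ‖z' - z‖ * M.radius := fun v =>
    (abs_dot_sub_le _ _ v).trans (mul_le_mul_of_nonneg_right h2 (zero_le_one.trans hB))
  have hprod : ∀ {p q p' q' e : ℝ}, |p'| ≤ 1 → |q| ≤ 1 → |p' - p| ≤ e → |q' - q| ≤ e →
      |p' * q' - p * q| ≤ 2 * e := by
    intro p q p' q' e hp hq hp' hq'
    have : p' * q' - p * q = p' * (q' - q) + (p' - p) * q := by ring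
    rw [this]
    refine (abs_add_le _ _).trans ?_
    rw [abs_mul, abs_mul]
    have h1 := mul_le_of_le_one_left (abs_nonneg (q' - q)) hp
    have h2 := mul_le_of_le_one_right (abs_nonneg (p' - p)) hq
    linarith
  have t1 := hprod (hact.bound (M.dot z'.2 y)) (hact.bound (M.dot z.2 ξ))
    ((hact.abs_sub_le (M.dot z.2 y) _).trans (hx y))
      ((hact.abs_sub_le (M.dot z.2 ξ) _).trans (hx ξ))
  have t2 := hprod (hact.bound_deriv (M.dot z'.2 y)) (hact.bound_deriv (M.dot z.2 ξ))
    ((hact.abs_deriv_sub_le (M.dot z.2 y) _).trans (hx y))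
    ((hact.abs_deriv_sub_le (M.dot z.2 ξ) _).trans (hx ξ))
  have t3 : |deriv act (M.dot z.2 y) * deriv act (M.dot z.2 ξ)| ≤ 1 := by
    rw [abs_mul]
    exact mul_le_one₀ (hact.bound_deriv _) (abs_nonneg _) (hact.bound_deriv _)
  have t4 : |z'.1 ^ 2 - z.1 ^ 2| ≤ 2 * κ * ‖z' - z‖ := by
    rw [sq_sub_sq, abs_mul]
    exact mul_le_mul ((abs_add_le _ _).trans (by linarith)) h1 (abs_nonneg _) (by positivity)
  have t5 : |z'.1 ^ 2| ≤ κ ^ 2 := by rw [abs_pow]; exact pow_le_pow_left₀ (abs_nonneg _) hz' 2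
  have e : unitKernel act ξ y z' - unitKernel act ξ y z
      = (act (M.dot z'.2 y) * act (M.dot z'.2 ξ) - act (M.dot z.2 y) * act (M.dot z.2 ξ))
      + (z'.1 ^ 2 * (deriv act (M.dot z'.2 y) * deriv act (M.dot z'.2 ξ)
          - deriv act (M.dot z.2 y) * deriv act (M.dot z.2 ξ))
        + (z'.1 ^ 2 - z.1 ^ 2) * (deriv act (M.dot z.2 y) * deriv act (M.dot z.2 ξ)))
        * inner ℝ (M.vec ξ) (M.vec y) := by
    simp only [unitKernel]; ring
  rw [e]
  refine (abs_add_le _ _).trans ?_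
  rw [abs_mul]
  have t6 : |z'.1 ^ 2 * (deriv act (M.dot z'.2 y) * deriv act (M.dot z'.2 ξ)
          - deriv act (M.dot z.2 y) * deriv act (M.dot z.2 ξ))
        + (z'.1 ^ 2 - z.1 ^ 2) * (deriv act (M.dot z.2 y) * deriv act (M.dot z.2 ξ))|
      ≤ κ ^ 2 * (2 * (‖z' - z‖ * M.radius)) + 2 * κ * ‖z' - z‖ * 1 := by
    refine (abs_add_le _ _).trans ?_
    rw [abs_mul, abs_mul]
    exact add_le_add (mul_le_mul t5 t2 (abs_nonneg _) (by positivity))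
      (mul_le_mul t4 t3 (abs_nonneg _) (by positivity))
  have t7 := mul_le_mul t6 (abs_inner_vec_le ξ y) (abs_nonneg _) (by positivity)
  have u1 : M.radius ≤ κ ^ 2 * M.radius ^ 3 := by
    calc M.radius ≤ M.radius ^ 3 := le_self_pow₀ hB (by norm_num)
      _ ≤ _ := le_mul_of_one_le_left (by positivity) (one_le_pow₀ hκ1)
  have u2 : κ * M.radius ^ 2 ≤ κ ^ 2 * M.radius ^ 3 :=
    mul_le_mul (le_self_pow₀ hκ1 (by norm_num)) (pow_le_pow_right₀ hB (by norm_num))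
      (by positivity) (by positivity)
  calc _ ≤ _ := add_le_add t1 t7
    _ = 2 * ‖z' - z‖ * M.radius + 2 * ‖z' - z‖ * (κ * M.radius ^ 2)
        + 2 * ‖z' - z‖ * (κ ^ 2 * M.radius ^ 3) := by ring
    _ ≤ 2 * ‖z' - z‖ * (κ ^ 2 * M.radius ^ 3) + 2 * ‖z' - z‖ * (κ ^ 2 * M.radius ^ 3)
        + 2 * ‖z' - z‖ * (κ ^ 2 * M.radius ^ 3) := by gcongr
    _ = _ := by ring

lemma abs_empKernel_sub_le (hact : IsActivation act) (hκ1 : 1 ≤ κ) (hN : 0 < N)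
    {θ θ' : Fin N → HiddenUnit dx da} (hκ : ∀ i, |(θ i).1| ≤ κ) (hκ' : ∀ i, |(θ' i).1| ≤ κ)
    {e : ℝ} (he : ∀ i, ‖θ' i - θ i‖ ≤ e) (ξ y : M.SA) :
    |empKernel act θ' ξ y - empKernel act θ ξ y| ≤ 6 * κ ^ 2 * M.radius ^ 3 * e := by
  have hN' : (0 : ℝ) < N := by exact_mod_cast hN
  have hB := one_le_radius (M := M)
  rw [empKernel, empKernel, ← mul_sub, ← Finset.sum_sub_distrib, abs_mul,
    abs_of_nonneg (by positivity)]
  calc _ ≤ 1 / (N : ℝ) * (N * (6 * κ ^ 2 * M.radius ^ 3 * e)) := by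
        refine mul_le_mul_of_nonneg_left (sum_le_card_mul fun i => ?_) (by positivity)
        exact (abs_unitKernel_sub_le hact hκ1 (hκ i) (hκ' i) ξ y).trans
          (mul_le_mul_of_nonneg_left (he i) (by positivity))
    _ = _ := by field_simp

end GradStep

end MDP

/-! ### Bounds along the training trajectories -/

/-- Adding `1 / 2` makes the affine recursion homogeneous: `u + 1 / 2` is multiplied by at most `1 +
2 * c / N` in each step. -/
lemma add_half_le_mul_exp {N : ℕ} (hN : 0 < N) {c T : ℝ} (hc : 0 ≤ c) {u : ℕ → ℝ}
    (hu0 : ∀ k, 0 ≤ u k)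
    (hu : ∀ k : ℕ, (k : ℝ) + 1 ≤ N * T → u (k + 1) ≤ u k + c / N * (1 + 2 * u k)) (k : ℕ)
    (hk : (k : ℝ) ≤ N * T) : u k + 1 / 2 ≤ (u 0 + 1 / 2) * Real.exp (2 * c * T) := by
  have hN' : (0 : ℝ) < N := by exact_mod_cast hN
  have h : ∀ k : ℕ, (k : ℝ) ≤ N * T →
      u k + 1 / 2 ≤ (u 0 + 1 / 2) * Real.exp (2 * c / N * k) := by
    intro k
    induction k with
    | zero => simp
    | succ k ih =>
      intro hk
      push_cast at hk ⊢
      have ih := ih (by linarith)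
      have h1 : u (k + 1) + 1 / 2 ≤ (u k + 1 / 2) * (1 + 2 * c / N) := by
        have := hu k hk
        calc _ ≤ u k + c / N * (1 + 2 * u k) + 1 / 2 := by linarith
          _ = _ := by ring
      have h2 : 1 + 2 * c / N ≤ Real.exp (2 * c / N) := by
        linarith [Real.add_one_le_exp (2 * c / N)]
      calc _ ≤ _ := h1
        _ ≤ (u 0 + 1 / 2) * Real.exp (2 * c / N * k) * Real.exp (2 * c / N) := by
            have := hu0 0
            gcongr
        _ = _ := by rw [mul_assoc, ← Real.exp_add]; ring_nf
  refine (h k hk).trans ?_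
  have h0 := hu0 0
  refine mul_le_mul_of_nonneg_left (Real.exp_le_exp.2 ?_) (by linarith)
  rw [div_mul_eq_mul_div, div_le_iff₀ hN', mul_assoc (2 * c) T]
  exact mul_le_mul_of_nonneg_left (by linarith) (by positivity)

namespace MDP

variable {dx da : ℕ} {M : MDP dx da}

open scoped Classical in
/-- The coefficients of a critic update as a gradient step. -/
noncomputable def criticCoef (α : ℝ) (Q : M.SA → ℝ) (ξ ξ' y : M.SA) : ℝ :=
  if y = ξ then α * (M.r ξ + M.γ * Q ξ' - Q ξ) else 0

open scoped Classical in
/-- The coefficients of an actor update as a gradient step. -/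
noncomputable def actorCoef (ζ : ℝ) (P Q : M.SA → ℝ)
    (ξ y : M.SA) : ℝ :=
  ζ * clip (Q ξ) * ((if y = ξ then 1 else 0) - if y.1 = ξ.1 then M.softmax P y else 0)

/-- The expected scaled increment of the critic output at `ξ`, for the transition `y → z`. -/
noncomputable def criticDrift (α : ℝ) (A : M.SA → M.SA → ℝ) (ξ : M.SA) (x : M.Outputs)
    (y z : M.SA) : ℝ := A ξ y * (α * (M.r y + M.γ * x.2 z - x.2 y))

/-- The expected scaled increment of the actor output at `ξ`, for the sample `y`. -/
noncomputable def actorDrift (ζ : ℝ) (A : M.SA → M.SA → ℝ) (ξ : M.SA) (x : M.Outputs)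
    (y : M.SA) : ℝ :=
  ζ * clip (x.2 y) * (A ξ y - ∑ a, M.softmax x.1 (y.1, a) * A ξ (y.1, a))

section Coef

open scoped Classical

/-- Stated over an arbitrary module, so that one identity serves the scalar and the vector component
of a step as well as the drift. -/
lemma sum_criticCoef_smul {V : Type*} [AddCommGroup V] [Module ℝ V] (s α : ℝ) (Q : M.SA → ℝ)
    (ξ ξ' : M.SA) (f : M.SA → V) :
    ∑ y, (s * criticCoef α Q ξ ξ' y) • f y = (s * (α * (M.r ξ + M.γ * Q ξ' - Q ξ))) • f ξ := by
  rw [Finset.sum_eq_single ξ]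
  · simp [criticCoef]
  · intro y _ hy; simp [criticCoef, hy]
  · simp

lemma sum_fst_ite_smul {V : Type*} [AddCommGroup V] [Module ℝ V] (x : M.X) (g : M.SA → ℝ)
    (f : M.SA → V) :
    ∑ y : M.SA, (if y.1 = x then g y else 0) • f y = ∑ a, g (x, a) • f (x, a) := by
  rw [Fintype.sum_prod_type, Finset.sum_eq_single x]
  · simp
  · intro x' _ hx'; simp [hx']
  · simp

lemma sum_actorCoef_smul {V : Type*} [AddCommGroup V] [Module ℝ V] (s ζ : ℝ) (P Q : M.SA → ℝ)
    (ξ : M.SA) (f : M.SA → V) :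
    ∑ y, (s * actorCoef ζ P Q ξ y) • f y
      = (s * (ζ * clip (Q ξ))) • (f ξ - ∑ a, M.softmax P (ξ.1, a) • f (ξ.1, a)) := by
  have h : ∀ y, (s * actorCoef ζ P Q ξ y) • f y = (s * (ζ * clip (Q ξ))) •
      ((if y = ξ then (1 : ℝ) else 0) • f y
        - (if y.1 = ξ.1 then M.softmax P y else 0) • f y) := by
    intro y
    rw [← sub_smul, smul_smul, actorCoef]
    ring_nf
  simp_rw [h]
  rw [← Finset.smul_sum, Finset.sum_sub_distrib, sum_fst_ite_smul]
  simp

lemma sum_abs_criticCoef_le {α : ℝ} (hα : 0 ≤ α) (Q : M.SA → ℝ) (ξ ξ' : M.SA) :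
    ∑ y, |criticCoef α Q ξ ξ' y| ≤ α * (1 + 2 * ‖Q‖) := by
  rw [Finset.sum_eq_single ξ]
  · simp only [criticCoef, if_true]
    rw [abs_mul, abs_of_nonneg hα]
    refine mul_le_mul_of_nonneg_left ?_ hα
    have h1 := norm_le_pi_norm Q ξ
    have h2 := norm_le_pi_norm Q ξ'
    rw [Real.norm_eq_abs] at h1 h2
    have h3 : |M.γ * Q ξ'| ≤ |Q ξ'| := by
      rw [abs_mul, abs_of_pos M.γ_pos]
      exact mul_le_of_le_one_left (abs_nonneg _) M.γ_lt_one.le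
    calc _ ≤ |M.r ξ + M.γ * Q ξ'| + |Q ξ| := abs_sub _ _
      _ ≤ |M.r ξ| + |M.γ * Q ξ'| + |Q ξ| := by gcongr; exact abs_add_le _ _
      _ ≤ _ := by linarith [M.r_bound ξ]
  · intro y _ hy; simp [criticCoef, hy]
  · simp

/-- The prefactor is at most `2` thanks to the clipping; the indicator of the sample and the softmax
weights have mass one each. -/
lemma sum_abs_actorCoef_le {ζ : ℝ} (hζ0 : 0 ≤ ζ) (hζ1 : ζ ≤ 1) (P Q : M.SA → ℝ) (ξ : M.SA) :
    ∑ y, |actorCoef ζ P Q ξ y| ≤ 4 := by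
  have h : ∀ y, |actorCoef ζ P Q ξ y| ≤ 2 *
      ((if y = ξ then 1 else 0) + (if y.1 = ξ.1 then M.softmax P y else 0) * 1) := by
    intro y
    rw [actorCoef, abs_mul]
    refine mul_le_mul ?_ ?_ (abs_nonneg _) (by norm_num)
    · rw [abs_of_nonneg (mul_nonneg hζ0 (clip_nonneg _))]
      calc ζ * clip (Q ξ) ≤ 1 * 2 := mul_le_mul hζ1 (clip_le_two _) (clip_nonneg _) zero_le_one
        _ = 2 := by norm_num
    · refine (abs_sub _ _).trans (add_le_add ?_ ?_)
      · split_ifs <;> simp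
      · split_ifs
        · rw [abs_of_pos (M.softmax_pos _ _), mul_one]
        · simp
  refine (Finset.sum_le_sum fun y _ => h y).trans ?_
  rw [← Finset.mul_sum, Finset.sum_add_distrib]
  have h2 := sum_fst_ite_smul (M := M) ξ.1 (M.softmax P) (fun _ => (1 : ℝ))
  simp only [smul_eq_mul] at h2
  rw [h2]
  simp only [mul_one, Finset.sum_ite_eq', Finset.mem_univ, if_true, M.sum_softmax]
  norm_num

lemma criticStep_eq_gradStep (act : ℝ → ℝ) (α : ℝ) {N : ℕ} (θ : Fin N → HiddenUnit dx da)
    (ξ ξ' : M.SA) : M.criticStep act α θ ξ ξ' = gradStep act θ fun y =>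
      ((N : ℝ) * √(N : ℝ))⁻¹ * criticCoef α (M.net act θ) ξ ξ' y := by
  have e : α / N / √(N : ℝ) * (M.r ξ + M.γ * M.net act θ ξ' - M.net act θ ξ)
      = ((N : ℝ) * √(N : ℝ))⁻¹ * (α * (M.r ξ + M.γ * M.net act θ ξ' - M.net act θ ξ)) := by
    rw [mul_inv]; ring
  funext i
  refine Prod.ext ?_ ?_
  · simp only [criticStep, gradStep]
    rw [e]
    exact congrArg _ (sum_criticCoef_smul _ α _ ξ ξ' fun y => act (M.dot (θ i).2 y)).symm
  · simp only [criticStep, gradStep]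
    rw [e]
    simp_rw [← smul_smul _ _ (M.vec _)]
    rw [sum_criticCoef_smul]

lemma actorStep_eq_gradStep (act : ℝ → ℝ) (ζ : ℝ) {N : ℕ} (θ : Fin N → HiddenUnit dx da)
    (Q : M.SA → ℝ) (ξ : M.SA) : M.actorStep act ζ θ Q ξ = gradStep act θ fun y =>
      ((N : ℝ) * √(N : ℝ))⁻¹ * actorCoef ζ (M.net act θ) Q ξ y := by
  have e : ζ / (N * √(N : ℝ)) * clip (Q ξ) = ((N : ℝ) * √(N : ℝ))⁻¹ * (ζ * clip (Q ξ)) := by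
    ring
  funext i
  refine Prod.ext ?_ ?_
  · simp only [actorStep, gradStep]
    rw [e]
    exact congrArg _ (sum_actorCoef_smul _ ζ _ Q ξ fun y => act (M.dot (θ i).2 y)).symm
  · simp only [actorStep, gradStep]
    rw [e]
    simp_rw [← smul_smul _ _ (M.vec _)]
    rw [sum_actorCoef_smul]

lemma sum_criticCoef_mul (α : ℝ) (A : M.SA → M.SA → ℝ) (ξ₀ : M.SA) (x : M.Outputs)
    (ξ ξ' : M.SA) :
    ∑ y, criticCoef α x.2 ξ ξ' y * A ξ₀ y = criticDrift α A ξ₀ x ξ ξ' := by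
  have := sum_criticCoef_smul 1 α x.2 ξ ξ' (A ξ₀)
  simp only [one_mul, smul_eq_mul] at this
  rw [this, criticDrift, mul_comm]

lemma sum_actorCoef_mul (ζ : ℝ) (A : M.SA → M.SA → ℝ) (ξ₀ : M.SA) (x : M.Outputs) (ξ : M.SA) :
    ∑ y, actorCoef ζ x.1 x.2 ξ y * A ξ₀ y = actorDrift ζ A ξ₀ x ξ := by
  have := sum_actorCoef_smul 1 ζ x.1 x.2 ξ (A ξ₀)
  simp only [one_mul, smul_eq_mul] at this
  rw [this, actorDrift]

end Coef

section Trajectory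

variable {act : ℝ → ℝ} {N : ℕ} {T β κ : ℝ} {θ : ℕ → Fin N → HiddenUnit dx da}
  {a : ℕ → M.SA → ℝ}

lemma sum_abs_smul_le {s : ℝ} (hs : 0 ≤ s) {a : M.SA → ℝ} (ha : ∑ y, |a y| ≤ β) :
    ∑ y, |s * a y| ≤ s * β := by
  simp_rw [abs_mul, abs_of_nonneg hs, ← Finset.mul_sum]
  exact mul_le_mul_of_nonneg_left ha hs

lemma abs_net_le {θ : Fin N → HiddenUnit dx da} (hact : IsActivation act)
    (hκ : ∀ i, |(θ i).1| ≤ κ) (ξ : M.SA) : |M.net act θ ξ| ≤ √(N : ℝ) * κ := by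
  refine abs_one_div_sqrt_mul_sum_le fun i => ?_
  rw [abs_mul]
  exact (mul_le_of_le_one_right (abs_nonneg _) (hact.bound _)).trans (hκ i)

lemma abs_net_gradStep_smul_sub_le {θ : Fin N → HiddenUnit dx da} {a : M.SA → ℝ}
    (hact : IsActivation act) (hκ1 : 1 ≤ κ) (hN : 0 < N)
    (hκ : ∀ i, |(θ i).1| ≤ κ) (ha : ∑ y, |a y| ≤ β) (ξ : M.SA) :
    |M.net act (gradStep act θ fun y => ((N : ℝ) * √(N : ℝ))⁻¹ * a y) ξ - M.net act θ ξ|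
      ≤ 2 * κ ^ 2 * M.radius ^ 2 * β / N := by
  have hN' : (0 : ℝ) < N := by exact_mod_cast hN
  refine (abs_net_gradStep_sub_le hact hκ1 hκ _ ξ).trans ?_
  calc _ ≤ √(N : ℝ) * (2 * κ ^ 2 * M.radius ^ 2 * (((N : ℝ) * √(N : ℝ))⁻¹ * β)) := by
        gcongr
        exact sum_abs_smul_le (by positivity) ha
    _ = _ := by field_simp

/-- Drift, increments and linearization along a sequence of small gradient steps. -/
lemma gradStep_trajectory_bounds (hact : IsActivation act) (hκ1 : 1 ≤ κ) (hN : 0 < N)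
    (hT : 0 ≤ T) (hβ : 0 ≤ β)
    (hstep : ∀ k, θ (k + 1) = gradStep act (θ k) fun y => ((N : ℝ) * √(N : ℝ))⁻¹ * a k y)
    (hκ : ∀ k : ℕ, (k : ℝ) ≤ N * T → ∀ i, |(θ k i).1| ≤ κ)
    (ha : ∀ k : ℕ, (k : ℝ) ≤ N * T → ∑ y, |a k y| ≤ β) (k : ℕ) (hk : (k : ℝ) ≤ N * T) :
    (∀ i, ‖θ k i - θ 0 i‖ ≤ T * β * κ * M.radius / √(N : ℝ)) ∧
    ∀ (A : M.SA → M.SA → ℝ) (ε : ℝ), (∀ ξ y, |empKernel act (θ 0) ξ y - A ξ y| ≤ ε) →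
      ∀ ξ, |N * (M.net act (θ (k + 1)) ξ - M.net act (θ k) ξ) - ∑ y, a k y * A ξ y|
        ≤ κ ^ 3 * M.radius ^ 4 * β ^ 2 * (2 + 6 * T) / √(N : ℝ) + β * ε := by
  have hN' : (0 : ℝ) < N := by exact_mod_cast hN
  have hsN : 0 < √(N : ℝ) := Real.sqrt_pos.2 hN'
  have hB := one_le_radius (M := M)
  have hss : √(N : ℝ) * √(N : ℝ) = N := Real.mul_self_sqrt hN'.le
  set s : ℝ := ((N : ℝ) * √(N : ℝ))⁻¹ with hs
  have hs0 : 0 ≤ s := by positivity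
  -- At most `N * T` steps of size `N^{-3/2}` give a displacement of order `N^{-1/2}`.
  have hdrift : ∀ k : ℕ, (k : ℝ) ≤ N * T → ∀ i,
      ‖θ k i - θ 0 i‖ ≤ k * (s * β * (κ * M.radius)) := by
    intro k
    induction k with
    | zero => simp
    | succ k ih =>
      intro hk i
      push_cast at hk ⊢
      have hk' : (k : ℝ) ≤ N * T := by linarith
      have h1 := norm_gradStep_sub_le hact hκ1 (hκ k hk') (fun y => s * a k y) i
      rw [← hstep] at h1
      have h2 : (∑ y, |s * a k y|) * (κ * M.radius) ≤ s * β * (κ * M.radius) := by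
        gcongr
        exact sum_abs_smul_le hs0 (ha k hk')
      have h3 := norm_add_le (θ (k + 1) i - θ k i) (θ k i - θ 0 i)
      rw [sub_add_sub_cancel] at h3
      linarith [ih hk' i]
  have hdrift' : ∀ i, ‖θ k i - θ 0 i‖ ≤ T * β * κ * M.radius / √(N : ℝ) := by
    intro i
    refine (hdrift k hk i).trans ?_
    calc (k : ℝ) * (s * β * (κ * M.radius)) ≤ N * T * (s * β * (κ * M.radius)) := by gcongr
      _ = _ := by rw [hs]; field_simp
  refine ⟨hdrift', fun A ε hA ξ => ?_⟩
  have h1 := abs_net_gradStep_sub_sub_le hact hκ1 (hκ k hk) (fun y => s * a k y) ξ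
  rw [← hstep] at h1
  have h2 : √(N : ℝ) * (2 * κ ^ 3 * M.radius ^ 4 * (∑ y, |s * a k y|) ^ 2)
      ≤ √(N : ℝ) * (2 * κ ^ 3 * M.radius ^ 4 * (s * β) ^ 2) := by
    gcongr
    exact sum_abs_smul_le hs0 (ha k hk)
  -- The scaling is chosen so that `N * √N * s = 1`: the scaled increments of the output are of
  -- order one.
  have e1 : N * (√(N : ℝ) * ∑ y, s * a k y * empKernel act (θ k) ξ y)
      = ∑ y, a k y * empKernel act (θ k) ξ y := by
    simp_rw [mul_assoc, ← Finset.mul_sum]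
    rw [hs, ← mul_assoc, ← mul_assoc, mul_inv_cancel₀ (by positivity), one_mul]
  have h3 : |N * (M.net act (θ (k + 1)) ξ - M.net act (θ k) ξ)
      - ∑ y, a k y * empKernel act (θ k) ξ y| ≤ 2 * κ ^ 3 * M.radius ^ 4 * β ^ 2 / √(N : ℝ) := by
    rw [← e1, ← mul_sub, abs_mul, abs_of_pos hN']
    calc _ ≤ N * (√(N : ℝ) * (2 * κ ^ 3 * M.radius ^ 4 * (s * β) ^ 2)) := by
          gcongr
          exact h1.trans h2
      _ = 2 * κ ^ 3 * M.radius ^ 4 * β ^ 2 / (N * √(N : ℝ)) := by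
          rw [hs]; field_simp
      _ ≤ _ := by
          gcongr
          refine le_mul_of_one_le_left hsN.le ?_
          exact_mod_cast hN
  -- The kernel at step `k` is compared with the initial kernel through the displacement of the
  -- parameters, and the initial kernel with `A` through `ε`.
  have h4 : |∑ y, a k y * empKernel act (θ k) ξ y - ∑ y, a k y * A ξ y|
      ≤ β * (6 * κ ^ 2 * M.radius ^ 3 * (T * β * κ * M.radius / √(N : ℝ)) + ε) := by
    rw [← Finset.sum_sub_distrib]
    refine (Finset.abs_sum_le_sum_abs _ _).trans ?_
    have hE : ∀ y, |empKernel act (θ k) ξ y - A ξ y|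
        ≤ 6 * κ ^ 2 * M.radius ^ 3 * (T * β * κ * M.radius / √(N : ℝ)) + ε := by
      intro y
      have h5 := abs_empKernel_sub_le hact hκ1 hN (hκ 0 (by simpa using by positivity)) (hκ k hk)
        hdrift' ξ y
      have h6 := abs_add_le (empKernel act (θ k) ξ y - empKernel act (θ 0) ξ y)
        (empKernel act (θ 0) ξ y - A ξ y)
      rw [sub_add_sub_cancel] at h6
      linarith [hA ξ y]
    calc _ ≤ ∑ y, |a k y| * (6 * κ ^ 2 * M.radius ^ 3 * (T * β * κ * M.radius / √(N : ℝ)) + ε) := by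
          refine Finset.sum_le_sum fun y _ => ?_
          rw [← mul_sub, abs_mul]
          exact mul_le_mul_of_nonneg_left (hE y) (abs_nonneg _)
      _ ≤ _ := by
          rw [← Finset.sum_mul]
          exact mul_le_mul_of_nonneg_right (ha k hk) ((abs_nonneg _).trans (hE ξ))
  have h5 := abs_add_le (N * (M.net act (θ (k + 1)) ξ - M.net act (θ k) ξ)
      - ∑ y, a k y * empKernel act (θ k) ξ y)
    (∑ y, a k y * empKernel act (θ k) ξ y - ∑ y, a k y * A ξ y)
  rw [sub_add_sub_cancel] at h5
  calc _ ≤ _ := h5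
    _ ≤ _ := add_le_add h3 h4
    _ = _ := by ring

end Trajectory

end MDP

/-! ### Uniform a priori bounds for the actor and critic iterations. -/

namespace MDP

variable {dx da : ℕ} {M : MDP dx da} {act : ℝ → ℝ} {α T : ℝ} {N : ℕ}
  {θ₀ ϑ₀ : Fin N → HiddenUnit dx da} {ξ ξt : ℕ → M.SA}

lemma params_succ_fst (k : ℕ) : (M.params act α θ₀ ϑ₀ ξ ξt (k + 1)).1
    = gradStep act (M.params act α θ₀ ϑ₀ ξ ξt k).1 fun y => ((N : ℝ) * √(N : ℝ))⁻¹ *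
      actorCoef (zeta ((k : ℝ) / N)) (M.net act (M.params act α θ₀ ϑ₀ ξ ξt k).1)
        (M.net act (M.params act α θ₀ ϑ₀ ξ ξt k).2) (ξt k) y :=
  actorStep_eq_gradStep act _ _ _ _

lemma params_succ_snd (k : ℕ) : (M.params act α θ₀ ϑ₀ ξ ξt (k + 1)).2
    = gradStep act (M.params act α θ₀ ϑ₀ ξ ξt k).2 fun y => ((N : ℝ) * √(N : ℝ))⁻¹ *
      criticCoef α (M.net act (M.params act α θ₀ ϑ₀ ξ ξt k).2) (ξ k) (ξ (k + 1)) y :=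
  criticStep_eq_gradStep act α _ _ _

/-- At this stage only `‖Q‖ ≤ √N * max |c|` is known. The step size is small enough to absorb the
factor `√N`: the largest weight `u` grows by at most `α / N * (1 + 2 * u)` per step, and Grönwall
applies. -/
lemma abs_params_snd_fst_le (hact : IsActivation act) (hα : 0 ≤ α) (hN : 0 < N)
    (hϑ : ∀ i, |(ϑ₀ i).1| ≤ 1) (k : ℕ) (hk : (k : ℝ) ≤ N * T) (i : Fin N) :
    |((M.params act α θ₀ ϑ₀ ξ ξt k).2 i).1| ≤ 2 * Real.exp (2 * α * T) := by
  have hN' : (0 : ℝ) < N := by exact_mod_cast hN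
  have hN1 : (1 : ℝ) ≤ N := by exact_mod_cast hN
  set u : ℕ → ℝ := fun k => ‖fun i => ((M.params act α θ₀ ϑ₀ ξ ξt k).2 i).1‖ with hu
  have hc : ∀ k i, |((M.params act α θ₀ ϑ₀ ξ ξt k).2 i).1| ≤ u k := fun k i =>
    norm_le_pi_norm (fun i => ((M.params act α θ₀ ϑ₀ ξ ξt k).2 i).1) i
  have hu0 : ∀ k, 0 ≤ u k := fun k => norm_nonneg _
  have hQ : ∀ k, ‖M.net act (M.params act α θ₀ ϑ₀ ξ ξt k).2‖ ≤ √(N : ℝ) * u k := fun k =>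
    (pi_norm_le_iff_of_nonneg (mul_nonneg (Real.sqrt_nonneg _) (hu0 k))).2
      fun y => abs_net_le hact (hc k) y
  have hstep : ∀ k : ℕ, (k : ℝ) + 1 ≤ N * T → u (k + 1) ≤ u k + α / N * (1 + 2 * u k) := by
    intro k _
    have h0 := hu0 k
    refine (pi_norm_le_iff_of_nonneg (by positivity)).2 fun i => ?_
    have h1 := abs_gradStep_fst_sub_le hact (M.params act α θ₀ ϑ₀ ξ ξt k).2
      (fun y => ((N : ℝ) * √(N : ℝ))⁻¹ *
        criticCoef α (M.net act (M.params act α θ₀ ϑ₀ ξ ξt k).2) (ξ k) (ξ (k + 1)) y) i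
    rw [← params_succ_snd] at h1
    have hs1 : 1 ≤ √(N : ℝ) := Real.one_le_sqrt.2 hN1
    have h2 : ((N : ℝ) * √(N : ℝ))⁻¹ *
        (α * (1 + 2 * ‖M.net act (M.params act α θ₀ ϑ₀ ξ ξt k).2‖)) ≤ α / N * (1 + 2 * u k) := by
      calc _ ≤ ((N : ℝ) * √(N : ℝ))⁻¹ * (α * (√(N : ℝ) + 2 * (√(N : ℝ) * u k))) := by
            gcongr
            exact hQ k
        _ = α / N * (1 + 2 * u k) := by field_simp
    have h3 := h1.trans
      ((sum_abs_smul_le (by positivity) (sum_abs_criticCoef_le hα _ _ _)).trans h2)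
    have h4 := abs_add_le (((M.params act α θ₀ ϑ₀ ξ ξt (k + 1)).2 i).1
      - ((M.params act α θ₀ ϑ₀ ξ ξt k).2 i).1) (((M.params act α θ₀ ϑ₀ ξ ξt k).2 i).1)
    rw [sub_add_cancel] at h4
    rw [Real.norm_eq_abs]
    linarith [hc k i]
  have h := add_half_le_mul_exp hN hα hu0 hstep k hk
  have h0 : u 0 ≤ 1 := (pi_norm_le_iff_of_nonneg zero_le_one).2 fun i => hϑ i
  have h1 : (u 0 + 1 / 2) * Real.exp (2 * α * T) ≤ 2 * Real.exp (2 * α * T) := by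
    gcongr; linarith
  linarith [hc k i]

/-- Clipping bounds the actor coefficients independently of the critic, so the weights grow at most
linearly in time. -/
lemma abs_params_fst_fst_le (hact : IsActivation act) (hN : 0 < N)
    (hθ : ∀ i, |(θ₀ i).1| ≤ 1) (k : ℕ) (hk : (k : ℝ) ≤ N * T) (i : Fin N) :
    |((M.params act α θ₀ ϑ₀ ξ ξt k).1 i).1| ≤ 1 + 4 * T := by
  have hN' : (0 : ℝ) < N := by exact_mod_cast hN
  have hN1 : (1 : ℝ) ≤ N := by exact_mod_cast hN
  have h : ∀ k : ℕ, |((M.params act α θ₀ ϑ₀ ξ ξt k).1 i).1| ≤ 1 + 4 * (k / N) := by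
    intro k
    induction k with
    | zero => simpa [params] using hθ i
    | succ k ih =>
      have h1 := abs_gradStep_fst_sub_le hact (M.params act α θ₀ ϑ₀ ξ ξt k).1
        (fun y => ((N : ℝ) * √(N : ℝ))⁻¹ *
          actorCoef (zeta ((k : ℝ) / N)) (M.net act (M.params act α θ₀ ϑ₀ ξ ξt k).1)
            (M.net act (M.params act α θ₀ ϑ₀ ξ ξt k).2) (ξt k) y) i
      rw [← params_succ_fst] at h1
      have h2 : ((N : ℝ) * √(N : ℝ))⁻¹ * 4 ≤ 4 / N := by
        rw [mul_comm, ← div_eq_mul_inv]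
        gcongr
        exact le_mul_of_one_le_right hN'.le (Real.one_le_sqrt.2 hN1)
      have hz : (0 : ℝ) ≤ k / N := by positivity
      have h3 := h1.trans
        ((sum_abs_smul_le (by positivity)
          (sum_abs_actorCoef_le (zeta_nonneg hz) (zeta_le_one hz) _ _ _)).trans h2)
      have h4 := abs_add_le (((M.params act α θ₀ ϑ₀ ξ ξt (k + 1)).1 i).1
        - ((M.params act α θ₀ ϑ₀ ξ ξt k).1 i).1) (((M.params act α θ₀ ϑ₀ ξ ξt k).1 i).1)
      rw [sub_add_cancel] at h4
      have h5 : 1 + 4 * (((k + 1 : ℕ) : ℝ) / N) = 1 + 4 * (k / N) + 4 / N := by push_cast; ring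
      linarith
  refine (h k).trans ?_
  have : (k : ℝ) / N ≤ T := (div_le_iff₀ hN').2 (by linarith)
  linarith

/-- The pair of the network outputs along a training trajectory. -/
noncomputable def outputPath (act : ℝ → ℝ) (α : ℝ) (θ₀ ϑ₀ : Fin N → HiddenUnit dx da)
    (ξ ξt : ℕ → M.SA) (k : ℕ) : M.Outputs :=
  (M.net act (M.params act α θ₀ ϑ₀ ξ ξt k).1, M.net act (M.params act α θ₀ ϑ₀ ξ ξt k).2)

/-- Bounds along the training trajectories, uniform in the number of hidden units. -/
theorem exists_outputPath_bounds (M : MDP dx da) (hact : IsActivation act) (hα : 0 ≤ α)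
    (hT : 0 ≤ T) : ∃ K : ℝ, 1 ≤ K ∧ ∀ {N : ℕ}, 0 < N →
    ∀ (θ₀ ϑ₀ : Fin N → HiddenUnit dx da) (ξ ξt : ℕ → M.SA),
    (∀ i, |(θ₀ i).1| ≤ 1) → (∀ i, |(ϑ₀ i).1| ≤ 1) →
    ∀ S : ℝ, 1 + ‖outputPath act α θ₀ ϑ₀ ξ ξt 0‖ ≤ S → ∀ k : ℕ, (k : ℝ) ≤ N * T →
    ‖outputPath act α θ₀ ϑ₀ ξ ξt k‖ ≤ K * S ∧
    ‖outputPath act α θ₀ ϑ₀ ξ ξt (k + 1) - outputPath act α θ₀ ϑ₀ ξ ξt k‖ ≤ K * S / N ∧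
    (∀ i, ‖(M.params act α θ₀ ϑ₀ ξ ξt k).1 i - θ₀ i‖ ≤ K * S / √(N : ℝ)) ∧
    (∀ i, ‖(M.params act α θ₀ ϑ₀ ξ ξt k).2 i - ϑ₀ i‖ ≤ K * S / √(N : ℝ)) ∧
    ∀ (A : M.SA → M.SA → ℝ) (ε : ℝ), 0 ≤ ε → (∀ y z, |empKernel act θ₀ y z - A y z| ≤ ε) →
      (∀ y z, |empKernel act ϑ₀ y z - A y z| ≤ ε) → ∀ y,
      |N * ((outputPath act α θ₀ ϑ₀ ξ ξt (k + 1)).1 y - (outputPath act α θ₀ ϑ₀ ξ ξt k).1 y)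
        - actorDrift (zeta ((k : ℝ) / N)) A y (outputPath act α θ₀ ϑ₀ ξ ξt k) (ξt k)|
          ≤ K * S ^ 2 * (1 / √(N : ℝ) + ε) ∧
      |N * ((outputPath act α θ₀ ϑ₀ ξ ξt (k + 1)).2 y - (outputPath act α θ₀ ϑ₀ ξ ξt k).2 y)
        - criticDrift α A y (outputPath act α θ₀ ϑ₀ ξ ξt k) (ξ k) (ξ (k + 1))|
          ≤ K * S ^ 2 * (1 / √(N : ℝ) + ε) := by
  -- `κ` bounds the output weights of both networks, `L` is the response of the outputs to a step,
  -- `E` the growth factor of the critic outputs, and `b * S` bounds the coefficients of a step.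
  -- `K₁`, `K₂`, `K₃` and `K₄` belong to the outputs, their increments, the parameter displacement
  -- and the linearisation error.
  set κ : ℝ := 2 * Real.exp (2 * α * T) + 1 + 4 * T with hκd
  have hexp0 : 0 < Real.exp (2 * α * T) := Real.exp_pos _
  have hκ1 : 1 ≤ κ := by rw [hκd]; linarith
  have hB := one_le_radius (M := M)
  set B := M.radius
  set L : ℝ := 2 * κ ^ 2 * B ^ 2 with hL
  have hL0 : 0 ≤ L := by positivity
  set E : ℝ := Real.exp (2 * (L * α) * T) with hE
  have hE0 : 0 < E := Real.exp_pos _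
  set b : ℝ := 4 + α * (1 + 2 * E) with hb
  have hb0 : 0 ≤ b := by positivity
  set K₁ : ℝ := 1 + E + L * 4 * T
  set K₂ : ℝ := L * b
  set K₃ : ℝ := T * b * κ * B
  set K₄ : ℝ := κ ^ 3 * B ^ 4 * b ^ 2 * (2 + 6 * T) + b with hK₄
  have hK₁ : 1 ≤ K₁ := by
    have : 0 ≤ L * 4 * T := by positivity
    change 1 ≤ 1 + E + L * 4 * T
    linarith
  have hK₂ : 0 ≤ K₂ := by positivity
  have hK₃ : 0 ≤ K₃ := by positivity
  have hK₄0 : 0 ≤ K₄ := by positivity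
  refine ⟨K₁ + K₂ + K₃ + K₄, by linarith, ?_⟩
  intro N hN θ₀ ϑ₀ ξ ξt hθ hϑ S hS
  have hN' : (0 : ℝ) < N := by exact_mod_cast hN
  have hsN : 0 < √(N : ℝ) := Real.sqrt_pos.2 hN'
  set s := M.params act α θ₀ ϑ₀ ξ ξt with hs
  set X := outputPath act α θ₀ ϑ₀ ξ ξt with hX
  have hS1 : 1 ≤ S := by linarith [norm_nonneg (X 0)]
  have hS0 : 0 ≤ S := by linarith
  have hP0 : ‖(X 0).1‖ ≤ S := by linarith [norm_fst_le (X 0)]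
  have hQ0 : ‖(X 0).2‖ + 1 / 2 ≤ S := by linarith [norm_snd_le (X 0)]
  have hκθ : ∀ k : ℕ, (k : ℝ) ≤ N * T → ∀ i, |((s k).1 i).1| ≤ κ := fun k hk i =>
    (abs_params_fst_fst_le hact hN hθ k hk i).trans (by rw [hκd]; linarith)
  have hκϑ : ∀ k : ℕ, (k : ℝ) ≤ N * T → ∀ i, |((s k).2 i).1| ≤ κ := fun k hk i =>
    (abs_params_snd_fst_le hact hα hN hϑ k hk i).trans (by rw [hκd]; linarith)
  have hz : ∀ k : ℕ, (0 : ℝ) ≤ k / N := fun k => by positivity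
  have haθ : ∀ k : ℕ, ∑ y, |actorCoef (zeta ((k : ℝ) / N)) (X k).1 (X k).2 (ξt k) y| ≤ 4 :=
    fun k => sum_abs_actorCoef_le (zeta_nonneg (hz k)) (zeta_le_one (hz k)) _ _ _
  have hincθ : ∀ {β : ℝ} (k : ℕ), (k : ℝ) ≤ N * T →
      ∑ y, |actorCoef (zeta ((k : ℝ) / N)) (X k).1 (X k).2 (ξt k) y| ≤ β →
      ‖(X (k + 1)).1 - (X k).1‖ ≤ L * β / N := by
    intro β k hk hβ
    have hβ0 : 0 ≤ β := (Finset.sum_nonneg fun _ _ => abs_nonneg _).trans hβ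
    refine (pi_norm_le_iff_of_nonneg (by positivity)).2 fun y => ?_
    have := abs_net_gradStep_smul_sub_le hact hκ1 hN (hκθ k hk) hβ y
    have e : (X (k + 1)).1 y = M.net act (gradStep act (s k).1 fun y => ((N : ℝ) * √(N : ℝ))⁻¹ *
        actorCoef (zeta ((k : ℝ) / N)) (X k).1 (X k).2 (ξt k) y) y :=
      congrArg (fun θ => M.net act θ y) (params_succ_fst k)
    rw [Pi.sub_apply, e]
    exact this
  have hincϑ : ∀ {β : ℝ} (k : ℕ), (k : ℝ) ≤ N * T →
      ∑ y, |criticCoef α (X k).2 (ξ k) (ξ (k + 1)) y| ≤ β →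
      ‖(X (k + 1)).2 - (X k).2‖ ≤ L * β / N := by
    intro β k hk hβ
    have hβ0 : 0 ≤ β := (Finset.sum_nonneg fun _ _ => abs_nonneg _).trans hβ
    refine (pi_norm_le_iff_of_nonneg (by positivity)).2 fun y => ?_
    have := abs_net_gradStep_smul_sub_le hact hκ1 hN (hκϑ k hk) hβ y
    have e : (X (k + 1)).2 y = M.net act (gradStep act (s k).2 fun y => ((N : ℝ) * √(N : ℝ))⁻¹ *
        criticCoef α (X k).2 (ξ k) (ξ (k + 1)) y) y :=
      congrArg (fun θ => M.net act θ y) (params_succ_snd k)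
    rw [Pi.sub_apply, e]
    exact this
  -- With the weights under control, one step changes the critic outputs by at most `L * α / N * (1
  -- + 2 * ‖Q‖)`. Grönwall replaces the crude bound of order `√N` by one independent of `N`.
  have hQ : ∀ k : ℕ, (k : ℝ) ≤ N * T → ‖(X k).2‖ ≤ E * S := by
    intro k hk
    have h := add_half_le_mul_exp hN (mul_nonneg hL0 hα) (u := fun k => ‖(X k).2‖)
      (fun k => norm_nonneg _) (fun k hk => ?_) k hk
    · have : (‖(X 0).2‖ + 1 / 2) * E ≤ S * E := by gcongr
      linarith
    · have h1 := hincϑ k (by linarith) (sum_abs_criticCoef_le hα _ _ _)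
      have h2 := norm_add_le ((X (k + 1)).2 - (X k).2) (X k).2
      rw [sub_add_cancel] at h2
      have h3 : L * (α * (1 + 2 * ‖(X k).2‖)) / N = L * α / N * (1 + 2 * ‖(X k).2‖) := by ring
      linarith
  have hP : ∀ k : ℕ, (k : ℝ) ≤ N * T → ‖(X k).1‖ ≤ S + k * (L * 4 / N) := by
    intro k
    induction k with
    | zero => simpa using fun _ => hP0
    | succ k ih =>
      intro hk
      push_cast at hk ⊢
      have hk' : (k : ℝ) ≤ N * T := by linarith
      have h1 := hincθ k hk' (haθ k)
      have h2 := norm_add_le ((X (k + 1)).1 - (X k).1) (X k).1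
      rw [sub_add_cancel] at h2
      linarith [ih hk']
  have hbS : 4 ≤ b * S := by
    have h1 : 4 ≤ b := by
      have : 0 ≤ α * (1 + 2 * E) := by positivity
      linarith
    nlinarith
  have haθ' : ∀ k : ℕ, (k : ℝ) ≤ N * T →
      ∑ y, |actorCoef (zeta ((k : ℝ) / N)) (X k).1 (X k).2 (ξt k) y| ≤ b * S := fun k _ =>
    (haθ k).trans hbS
  have haϑ : ∀ k : ℕ, (k : ℝ) ≤ N * T →
      ∑ y, |criticCoef α (X k).2 (ξ k) (ξ (k + 1)) y| ≤ b * S := by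
    intro k hk
    refine (sum_abs_criticCoef_le hα _ _ _).trans ?_
    calc _ ≤ α * (S + 2 * (E * S)) := by
          gcongr
          exact hQ k hk
      _ ≤ 4 * S + α * (S + 2 * (E * S)) := by linarith
      _ = b * S := by rw [hb]; ring
  have hbS0 : 0 ≤ b * S := by positivity
  -- The linearisation error is quadratic in the coefficients, which is the source of `S ^ 2`; the
  -- linear term is absorbed because `S ≥ 1`.
  have hfin : ∀ {ε : ℝ}, 0 ≤ ε → κ ^ 3 * B ^ 4 * (b * S) ^ 2 * (2 + 6 * T) / √(N : ℝ) + b * S * ε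
      ≤ (K₁ + K₂ + K₃ + K₄) * S ^ 2 * (1 / √(N : ℝ) + ε) := by
    intro ε hε
    have hSS : S ≤ S ^ 2 := le_self_pow₀ hS1 (by norm_num)
    calc _ = κ ^ 3 * B ^ 4 * b ^ 2 * (2 + 6 * T) * S ^ 2 * (1 / √(N : ℝ)) + b * S * ε := by ring
      _ ≤ K₄ * S ^ 2 * (1 / √(N : ℝ)) + K₄ * S ^ 2 * ε := by
          have h1 : b ≤ K₄ := by
            rw [hK₄]; exact le_add_of_nonneg_left (by positivity)
          have h2 : κ ^ 3 * B ^ 4 * b ^ 2 * (2 + 6 * T) ≤ K₄ := by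
            rw [hK₄]; exact le_add_of_nonneg_right hb0
          gcongr
      _ = K₄ * S ^ 2 * (1 / √(N : ℝ) + ε) := by ring
      _ ≤ _ := by
          gcongr
          linarith
  intro k hk
  have hθt := gradStep_trajectory_bounds hact hκ1 hN hT hbS0 (θ := fun k => (s k).1)
    (fun k => params_succ_fst k) hκθ haθ' k hk
  have hϑt := gradStep_trajectory_bounds hact hκ1 hN hT hbS0 (θ := fun k => (s k).2)
    (fun k => params_succ_snd k) hκϑ haϑ k hk
  have hdr : T * (b * S) * κ * B / √(N : ℝ) ≤ (K₁ + K₂ + K₃ + K₄) * S / √(N : ℝ) := by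
    refine div_le_div_of_nonneg_right ?_ hsN.le
    calc T * (b * S) * κ * B = K₃ * S := by ring
      _ ≤ _ := mul_le_mul_of_nonneg_right (by linarith) hS0
  refine ⟨max_le ?_ ?_, ?_, fun i => (hθt.1 i).trans hdr, fun i => (hϑt.1 i).trans hdr, ?_⟩
  · refine (hP k hk).trans ?_
    calc S + k * (L * 4 / N) ≤ S + N * T * (L * 4 / N) := by gcongr
      _ = S + L * 4 * T := by field_simp
      _ ≤ S + E * S + L * 4 * T * S := by
          have h1 : 0 ≤ E * S := by positivity
          have h2 : L * 4 * T ≤ L * 4 * T * S := le_mul_of_one_le_right (by positivity) hS1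
          linarith
      _ = K₁ * S := by ring
      _ ≤ _ := by gcongr; linarith
  · refine (hQ k hk).trans ?_
    gcongr
    have : 0 ≤ L * 4 * T := by positivity
    change E ≤ 1 + E + L * 4 * T + K₂ + K₃ + K₄
    linarith
  · have hle : L * (b * S) / N ≤ (K₁ + K₂ + K₃ + K₄) * S / N := by
      refine div_le_div_of_nonneg_right ?_ hN'.le
      calc L * (b * S) = K₂ * S := by ring
        _ ≤ _ := mul_le_mul_of_nonneg_right (by linarith) hS0
    exact (max_le (hincθ k hk (haθ' k hk)) (hincϑ k hk (haϑ k hk))).trans hle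
  · intro A ε hε hA hA' y
    have h1 := hθt.2 A ε hA y
    have h2 := hϑt.2 A ε hA' y
    have e1 := sum_actorCoef_mul (zeta ((k : ℝ) / N)) A y (X k) (ξt k)
    have e2 := sum_criticCoef_mul α A y (X k) (ξ k) (ξ (k + 1))
    rw [← e1, ← e2]
    exact ⟨h1.trans (hfin hε), h2.trans (hfin hε)⟩

end MDP

/-! ### The law of large numbers for triangular arrays and empirical measures -/

section LLN

variable {Ω : ℕ+ → Type*} [∀ N, MeasurableSpace (Ω N)] {Pr : ∀ N, Measure (Ω N)}
  [∀ N, IsProbabilityMeasure (Pr N)] {S : Type*} [MeasurableSpace S]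

/-- The weak law of large numbers for arrays with i.i.d. rows. -/
theorem tendsto_average_probFilter {Z : ∀ N : ℕ+, Fin N → Ω N → S} {ν : Measure S}
    (hZ : ∀ N i, Measurable (Z N i)) (hind : ∀ N, iIndepFun (Z N) (Pr N))
    (hlaw : ∀ N i, (Pr N).map (Z N i) = ν) {f : S → ℝ} (hf : Measurable f) (hf2 : MemLp f 2 ν) :
    Tendsto (fun p : Σ N, Ω N => 1 / ((p.1 : ℕ) : ℝ) * ∑ i, f (Z p.1 i p.2)) (probFilter Pr)
      (𝓝 (∫ x, f x ∂ν)) := by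
  have hν : IsProbabilityMeasure ν := by
    rw [← hlaw 1 0]; exact Measure.isProbabilityMeasure_map (hZ 1 0).aemeasurable
  rw [Metric.tendsto_nhds]
  intro ε hε
  have hu : Tendsto (fun N : ℕ+ => Var[f; ν] / ε ^ 2 / (N : ℕ)) atTop (𝓝 0) :=
    (tendsto_const_div_atTop_nhds_zero_nat _).comp tendsto_PNat_val_atTop_atTop
  refine eventually_probFilter_of_le hu fun N => ?_
  have hN' : (0 : ℝ) < (N : ℕ) := by exact_mod_cast N.pos
  have hmem : ∀ i, MemLp (f ∘ Z N i) 2 (Pr N) := fun i => by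
    refine MemLp.comp_of_map ?_ (hZ N i).aemeasurable
    rwa [hlaw]
  set X : Ω N → ℝ := ∑ i, f ∘ Z N i with hX
  have hXm : MemLp X 2 (Pr N) := memLp_finsetSum' _ fun i _ => hmem i
  have hvar : Var[X; Pr N] = N * Var[f; ν] := by
    rw [hX, IndepFun.variance_sum (fun i _ => hmem i)]
    · have h : ∀ i, Var[f ∘ Z N i; Pr N] = Var[f; ν] := fun i => by
        rw [← covariance_self (hmem i).aemeasurable, ← covariance_self hf.aemeasurable, ← hlaw N i,
          covariance_map hf.aestronglyMeasurable hf.aestronglyMeasurable (hZ N i).aemeasurable]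
      simp [h]
    · intro i _ j _ hij
      exact ((hind N).indepFun hij).comp hf hf
  have hmean : ∫ ω, X ω ∂(Pr N) = N * ∫ x, f x ∂ν := by
    have h : ∀ i, ∫ ω, f (Z N i ω) ∂(Pr N) = ∫ x, f x ∂ν := fun i => by
      rw [← hlaw N i, integral_map (hZ N i).aemeasurable hf.aestronglyMeasurable]
    simp only [hX, Finset.sum_apply, Function.comp_apply]
    refine (integral_finsetSum _ fun i _ => (hmem i).integrable (by norm_num)).trans ?_
    simp [h]
  have hc : 0 < (N : ℕ) * ε := by positivity
  refine (measure_mono fun ω hω => ?_).trans ((meas_ge_le_variance_div_sq hXm hc).trans_eq ?_)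
  · have hω' : ε ≤ |1 / ((N : ℕ) : ℝ) * ∑ i, f (Z N i ω) - ∫ x, f x ∂ν| := not_lt.1 hω
    change (N : ℕ) * ε ≤ |X ω - ∫ ω, X ω ∂(Pr N)|
    have e : X ω - ∫ ω, X ω ∂(Pr N)
        = N * (1 / ((N : ℕ) : ℝ) * ∑ i, f (Z N i ω) - ∫ x, f x ∂ν) := by
      rw [hmean, hX, Finset.sum_apply]
      field_simp
      rfl
    rw [e, abs_mul, abs_of_pos hN']
    gcongr
  · rw [hvar]
    congr 1
    field_simp

lemma integral_empirical (N : ℕ+) (θ : Fin N → S) {f : S → ℝ} (hf : StronglyMeasurable f) :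
    ∫ x, f x ∂(empirical N θ : Measure S) = 1 / ((N : ℕ) : ℝ) * ∑ i, f (θ i) := by
  change ∫ x, f x ∂(((N : ℕ) : ℝ≥0∞)⁻¹ • ∑ i, Measure.dirac (θ i)) = _
  rw [integral_smul_measure, integral_finsetSum_measure]
  · simp_rw [integral_dirac' f _ hf]
    simp [one_div]
  · intro i _
    exact integrable_dirac' hf (by simp)

/-- The empirical measures of i.i.d. samples converge weakly in probability. -/
theorem tendsto_empirical_probFilter [TopologicalSpace S] [OpensMeasurableSpace S]
    {Z : ∀ N : ℕ+, Fin N → Ω N → S} {ν : ProbabilityMeasure S}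
    (hZ : ∀ N i, Measurable (Z N i)) (hind : ∀ N, iIndepFun (Z N) (Pr N))
    (hlaw : ∀ N i, (Pr N).map (Z N i) = ν) :
    Tendsto (fun p : Σ N, Ω N => empirical p.1 fun i => Z p.1 i p.2) (probFilter Pr) (𝓝 ν) := by
  -- Convergence in probability being convergence along a filter, the test functions can be treated
  -- one at a time.
  rw [ProbabilityMeasure.tendsto_iff_forall_integral_tendsto]
  intro f
  have hf : Measurable f := f.continuous.measurable
  simp_rw [integral_empirical _ _ hf.stronglyMeasurable]
  exact tendsto_average_probFilter hZ hind hlaw hf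
    (MemLp.of_bound hf.aestronglyMeasurable ‖f‖ (Eventually.of_forall f.norm_coe_le_norm))

/-- An atom of the first measure in `B` has its partner in the thickening, so the claim holds atom
by atom. -/
lemma empirical_apply_le [PseudoEMetricSpace S] [OpensMeasurableSpace S] (N : ℕ+)
    {θ θ' : Fin N → S} {ε : ℝ≥0∞} (hε : ε ≠ ⊤) (h : ∀ i, edist (θ i) (θ' i) < ε) {B : Set S}
    (hB : MeasurableSet B) :
    (empirical N θ : Measure S) B
      ≤ (empirical N θ' : Measure S) (Metric.thickening ε.toReal B) := by
  change ((((N : ℕ) : ℝ≥0∞)⁻¹ • ∑ i, Measure.dirac (θ i)) : Measure S) B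
    ≤ ((((N : ℕ) : ℝ≥0∞)⁻¹ • ∑ i, Measure.dirac (θ' i)) : Measure S) _
  simp only [Measure.smul_apply, Measure.finsetSum_apply, smul_eq_mul]
  refine mul_le_mul_right (Finset.sum_le_sum fun i _ => ?_) _
  rw [Measure.dirac_apply' _ hB, Measure.dirac_apply' _ Metric.isOpen_thickening.measurableSet]
  by_cases hi : θ i ∈ B
  · have : θ' i ∈ Metric.thickening ε.toReal B := by
      rw [Metric.thickening, Set.mem_ofPred_eq, ENNReal.ofReal_toReal hε]
      refine (Metric.infEDist_le_edist_of_mem hi).trans_lt ?_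
      rw [edist_comm]
      exact h i
    simp [hi, this]
  · simp [hi]

/-- The empirical measure is `1`-Lipschitz for the Lévy-Prokhorov distance. -/
lemma levyProkhorovEDist_empirical_le [PseudoEMetricSpace S] [OpensMeasurableSpace S] (N : ℕ+)
    {θ θ' : Fin N → S} {δ : ℝ≥0∞} (h : ∀ i, edist (θ i) (θ' i) ≤ δ) :
    levyProkhorovEDist (empirical N θ : Measure S) (empirical N θ') ≤ δ := by
  refine levyProkhorovEDist_le_of_forall _ _ _ fun ε B hδ hε hB => ⟨?_, ?_⟩
  · exact (empirical_apply_le N hε.ne (fun i => (h i).trans_lt hδ) hB).trans le_self_add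
  · refine (empirical_apply_le N hε.ne (fun i => ?_) hB).trans le_self_add
    rw [edist_comm]
    exact (h i).trans_lt hδ

end LLN

/-! ### The central limit theorem for triangular arrays of vectors -/

section CLT

lemma tendsto_of_tendsto_succPNat {β : Type*} {f : ℕ+ → β} {l : Filter β}
    (h : Tendsto (fun n : ℕ => f n.succPNat) atTop l) : Tendsto f atTop l := by
  rw [← OrderIso.pnatIsoNat.symm.map_atTop, tendsto_map'_iff]
  exact h

/-- Rescale to unit variance and evaluate the standard limit at `√v`. If `v = 0`, the variable
vanishes almost surely. -/
lemma tendsto_charFun_inv_sqrt_smul_pow {Ω : Type*} [MeasurableSpace Ω] {P : Measure Ω}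
    [IsProbabilityMeasure P] {X : Ω → ℝ} (hX : MemLp X 2 P) (h0 : ∫ ω, X ω ∂P = 0) {v : ℝ}
    (hv : ∫ ω, X ω ^ 2 ∂P = v) :
    Tendsto (fun n : ℕ => charFun (P.map X) ((√(n : ℝ))⁻¹) ^ n) atTop
      (𝓝 (Complex.exp (-v / 2))) := by
  have hv0 : 0 ≤ v := hv ▸ integral_nonneg fun ω => sq_nonneg _
  rcases hv0.eq_or_lt with rfl | hvpos
  · have hX0 : X =ᵐ[P] fun _ => 0 := by
      have := (integral_eq_zero_iff_of_nonneg (fun ω => sq_nonneg (X ω)) hX.integrable_sq).1 hv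
      filter_upwards [this] with ω hω
      exact pow_eq_zero_iff (two_ne_zero) |>.1 hω
    rw [Measure.map_congr hX0]
    simp
  · have hs : 0 < √v := Real.sqrt_pos.2 hvpos
    have h := tendsto_charFun_inv_sqrt_mul_pow (P := P) (X := fun ω => (√v)⁻¹ * X ω)
      (hX.aemeasurable.const_mul _) (by rw [integral_const_mul, h0, mul_zero]) (by
        simp only [Pi.pow_apply, mul_pow]
        rw [integral_const_mul, hv, inv_pow, Real.sq_sqrt hv0, inv_mul_cancel₀ hvpos.ne']) (√v)
    have e : -(√v : ℂ) ^ 2 / 2 = -v / 2 := by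
      rw [← Complex.ofReal_pow, Real.sq_sqrt hv0]
    rw [e] at h
    refine h.congr fun n => ?_
    rw [charFun_map_mul_comp hX.aemeasurable]
    congr 2
    field_simp

variable {Ω : ℕ+ → Type*} [∀ N, MeasurableSpace (Ω N)] {Pr : ∀ N, Measure (Ω N)}
  [∀ N, IsProbabilityMeasure (Pr N)] {ι : Type*} [Fintype ι]

/-- The Cramér–Wold reduction: by independence the characteristic function at `t` is a power of that
of the one-dimensional law of `⟨t, x⟩`. -/
lemma charFun_map_smul_sum_eq_pow {Ω : Type*} [MeasurableSpace Ω] {P : Measure Ω}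
    [IsProbabilityMeasure P] {N : ℕ} {V : Fin N → Ω → EuclideanSpace ℝ ι}
    {ρ : Measure (EuclideanSpace ℝ ι)} (hV : ∀ i, Measurable (V i)) (hind : iIndepFun V P)
    (hlaw : ∀ i, P.map (V i) = ρ) (s : ℝ) (t : EuclideanSpace ℝ ι) :
    charFun (P.map fun ω => s • ∑ i, V i ω) t
      = charFun (ρ.map fun x => inner ℝ t x) s ^ N := by
  rw [charFun_map_smul_comp (Finset.measurable_sum _ fun i _ => hV i).aemeasurable,
    hind.charFun_map_fun_sum_eq_prod fun i => (hV i).aemeasurable]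
  simp only [Finset.prod_apply, hlaw, Finset.prod_const, Finset.card_univ, Fintype.card_fin]
  congr 1
  rw [charFun_apply, charFun_apply, integral_map (by fun_prop) (by fun_prop)]
  refine integral_congr_ae (Eventually.of_forall fun x => ?_)
  simp only [inner_smul_right, real_inner_comm x t]
  simp

/-- The central limit theorem for arrays with i.i.d. rows of square integrable vectors. -/
theorem tendstoInDistribution_multivariateGaussian [DecidableEq ι]
    {V : ∀ N : ℕ+, Fin N → Ω N → EuclideanSpace ℝ ι}
    {ρ : Measure (EuclideanSpace ℝ ι)} [IsProbabilityMeasure ρ] (hV : ∀ N i, Measurable (V N i))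
    (hind : ∀ N, iIndepFun (V N) (Pr N)) (hlaw : ∀ N i, (Pr N).map (V N i) = ρ)
    {S : Matrix ι ι ℝ} (hS : S.PosSemidef) (hL2 : ∀ t, MemLp (fun x => inner ℝ t x) 2 ρ)
    (hmean : ∀ t, ∫ x, inner ℝ t x ∂ρ = 0)
    (hcov : ∀ t, ∫ x, inner ℝ t x ^ 2 ∂ρ = t.ofLp ⬝ᵥ S.mulVec t.ofLp) :
    TendstoInDistribution (fun (N : ℕ+) ω => (√((N : ℕ) : ℝ))⁻¹ • ∑ i, V N i ω) atTop id Pr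
      (multivariateGaussian 0 S) := by
  have hm : ∀ N : ℕ+, AEMeasurable (fun ω => (√((N : ℕ) : ℝ))⁻¹ • ∑ i, V N i ω) (Pr N) := fun N =>
    ((measurable_const_smul (√((N : ℕ) : ℝ))⁻¹).comp
      (Finset.measurable_sum _ fun i _ => hV N i)).aemeasurable
  have hid : AEMeasurable id (multivariateGaussian 0 S) := measurable_id.aemeasurable
  refine ⟨hm, hid, tendsto_of_tendsto_succPNat ?_⟩
  refine ProbabilityMeasure.tendsto_of_tendsto_charFun
    (μ := fun n : ℕ => ⟨(Pr n.succPNat).map _, Measure.isProbabilityMeasure_map (hm n.succPNat)⟩)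
    (μ₀ := ⟨(multivariateGaussian 0 S).map id, Measure.isProbabilityMeasure_map hid⟩) fun t => ?_
  have hlim : charFun ((multivariateGaussian 0 S).map id) t
      = Complex.exp (-(t.ofLp ⬝ᵥ S.mulVec t.ofLp : ℝ) / 2) := by
    rw [Measure.map_id, charFun_multivariateGaussian hS]
    congr 1
    simp [neg_div]
  have h := (tendsto_charFun_inv_sqrt_smul_pow (hL2 t) (hmean t) (hcov t)).comp
    (tendsto_add_atTop_nat 1)
  rw [← hlim] at h
  refine Tendsto.congr (fun n => ?_) h
  exact (charFun_map_smul_sum_eq_pow (hV n.succPNat) (hind _) (hlaw _) _ t).symm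

end CLT

/-! ### The limit of the initial outputs -/

namespace MDP

variable {dx da : ℕ} {M : MDP dx da} {act : ℝ → ℝ}

/-- The output of one hidden unit. -/
noncomputable def unitOutput (M : MDP dx da) (act : ℝ → ℝ) (z : HiddenUnit dx da) (ξ : M.SA) : ℝ :=
  z.1 * act (M.dot z.2 ξ)

/-- The linear combination of the outputs of one hidden unit with weights `t`. -/
noncomputable def combinedOutput (M : MDP dx da) (act : ℝ → ℝ) (t : M.SA → ℝ)
    (z : HiddenUnit dx da) : ℝ := ∑ ξ, t ξ * M.unitOutput act z ξ

lemma continuous_unitOutput (hact : IsActivation act) (ξ : M.SA) :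
    Continuous fun z => M.unitOutput act z ξ :=
  continuous_fst.mul (hact.continuous.comp ((continuous_dot ξ).comp continuous_snd))

lemma continuous_combinedOutput (hact : IsActivation act) (t : M.SA → ℝ) :
    Continuous (M.combinedOutput act t) :=
  continuous_finsetSum _ fun ξ _ => continuous_const.mul (continuous_unitOutput hact ξ)

section Law

variable {ν₀ : Measure (HiddenUnit dx da)}

lemma ae_abs_unitOutput_le (hact : IsActivation act) (hν₀ : IsInitLaw ν₀) :
    ∀ᵐ z ∂ν₀, ∀ ξ, |M.unitOutput act z ξ| ≤ 1 := by
  filter_upwards [hν₀.bound_c] with z hz ξ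
  rw [unitOutput, abs_mul]
  exact mul_le_one₀ hz (abs_nonneg _) (hact.bound _)

/-- By independence the mean factors, and `c` is centred. -/
lemma integral_unitOutput (hact : IsActivation act) (hν₀ : IsInitLaw ν₀) (ξ : M.SA) :
    ∫ z, M.unitOutput act z ξ ∂ν₀ = 0 := by
  have h := hν₀.indep.integral_fun_comp_mul_comp (f := fun c : ℝ => c)
    (g := fun w => act (M.dot w ξ)) measurable_fst.aemeasurable measurable_snd.aemeasurable
    measurable_id.aestronglyMeasurable
    (hact.continuous.comp (continuous_dot ξ)).measurable.aestronglyMeasurable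
  rw [hν₀.mean_c, zero_mul] at h
  exact h

variable [IsProbabilityMeasure ν₀]

lemma memLp_combinedOutput (hact : IsActivation act) (hν₀ : IsInitLaw ν₀) (t : M.SA → ℝ) :
    MemLp (M.combinedOutput act t) 2 ν₀ := by
  refine MemLp.of_bound (continuous_combinedOutput hact t).aestronglyMeasurable (∑ ξ, |t ξ|) ?_
  filter_upwards [ae_abs_unitOutput_le (M := M) hact hν₀] with z hz
  refine (Finset.abs_sum_le_sum_abs _ _).trans (Finset.sum_le_sum fun ξ _ => ?_)
  rw [abs_mul]
  exact mul_le_of_le_one_right (abs_nonneg _) (hz ξ)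

lemma integrable_unitOutput (hact : IsActivation act) (hν₀ : IsInitLaw ν₀) (ξ : M.SA) :
    Integrable (fun z => M.unitOutput act z ξ) ν₀ := by
  refine Integrable.of_bound (continuous_unitOutput hact ξ).aestronglyMeasurable 1 ?_
  filter_upwards [ae_abs_unitOutput_le (M := M) hact hν₀] with z hz using hz ξ

lemma integral_combinedOutput (hact : IsActivation act) (hν₀ : IsInitLaw ν₀) (t : M.SA → ℝ) :
    ∫ z, M.combinedOutput act t z ∂ν₀ = 0 := by
  simp only [combinedOutput]
  rw [integral_finsetSum _ fun ξ _ => (integrable_unitOutput hact hν₀ ξ).const_mul _]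
  simp [integral_const_mul, integral_unitOutput hact hν₀]

/-- The covariance matrix of the limit of the initial outputs of one network. -/
noncomputable def covMatrix (M : MDP dx da) (act : ℝ → ℝ) (ν₀ : Measure (HiddenUnit dx da)) :
    Matrix M.SA M.SA ℝ := fun ξ ξ' => M.initCov act ν₀ ξ ξ'

lemma integral_combinedOutput_sq (hact : IsActivation act) (hν₀ : IsInitLaw ν₀) (t : M.SA → ℝ) :
    ∫ z, M.combinedOutput act t z ^ 2 ∂ν₀ = t ⬝ᵥ (M.covMatrix act ν₀).mulVec t := by
  have e : ∀ z, M.combinedOutput act t z ^ 2 = ∑ ξ, ∑ ξ', t ξ * t ξ' *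
      (z.1 ^ 2 * (act (M.dot z.2 ξ) * act (M.dot z.2 ξ'))) := by
    intro z
    rw [sq, combinedOutput, Finset.sum_mul_sum]
    refine Finset.sum_congr rfl fun ξ _ => Finset.sum_congr rfl fun ξ' _ => ?_
    rw [unitOutput, unitOutput]
    ring
  have hi : ∀ ξ ξ' : M.SA, Integrable (fun z : HiddenUnit dx da => t ξ * t ξ' *
      (z.1 ^ 2 * (act (M.dot z.2 ξ) * act (M.dot z.2 ξ')))) ν₀ := by
    intro ξ ξ'
    have hc : Continuous fun z => M.unitOutput act z ξ * M.unitOutput act z ξ' :=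
      (continuous_unitOutput hact ξ).mul (continuous_unitOutput hact ξ')
    have h1 : Integrable (fun z => M.unitOutput act z ξ * M.unitOutput act z ξ') ν₀ := by
      refine Integrable.of_bound hc.aestronglyMeasurable 1 ?_
      filter_upwards [ae_abs_unitOutput_le (M := M) hact hν₀] with z hz
      rw [Real.norm_eq_abs, abs_mul]
      exact mul_le_one₀ (hz ξ) (abs_nonneg _) (hz ξ')
    refine (h1.const_mul (t ξ * t ξ')).congr (Eventually.of_forall fun z => ?_)
    simp only [unitOutput]
    ring
  simp_rw [e]
  rw [integral_finsetSum _ fun ξ _ => integrable_finsetSum _ fun ξ' _ => hi ξ ξ']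
  simp only [dotProduct, Matrix.mulVec, Finset.mul_sum]
  refine Finset.sum_congr rfl fun ξ _ => ?_
  rw [integral_finsetSum _ fun ξ' _ => hi ξ ξ']
  refine Finset.sum_congr rfl fun ξ' _ => ?_
  rw [integral_const_mul, covMatrix, initCov]
  ring

/-- The pair of the outputs of a hidden unit of the actor and a hidden unit of the critic, as a
Euclidean vector. -/
noncomputable def outputVec (M : MDP dx da) (act : ℝ → ℝ)
    (z : HiddenUnit dx da × HiddenUnit dx da) : EuclideanSpace ℝ (M.SA ⊕ M.SA) :=
  WithLp.toLp 2 (Sum.elim (M.unitOutput act z.2) (M.unitOutput act z.1))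

lemma measurable_outputVec (hact : IsActivation act) : Measurable (M.outputVec act) := by
  refine (PiLp.continuous_toLp 2 _).measurable.comp (measurable_pi_iff.2 fun j => ?_)
  rcases j with ξ | ξ
  · exact (continuous_unitOutput hact ξ).measurable.comp measurable_snd
  · exact (continuous_unitOutput hact ξ).measurable.comp measurable_fst

lemma inner_outputVec (t : EuclideanSpace ℝ (M.SA ⊕ M.SA))
    (z : HiddenUnit dx da × HiddenUnit dx da) : inner ℝ t (M.outputVec act z)
      = M.combinedOutput act (fun ξ => t (Sum.inl ξ)) z.2
        + M.combinedOutput act (fun ξ => t (Sum.inr ξ)) z.1 := by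
  simp [PiLp.inner_apply, outputVec, combinedOutput, mul_comm]

/-- The covariance matrix of the limit of the initial outputs of the actor and the critic. -/
noncomputable def pairCovMatrix (M : MDP dx da) (act : ℝ → ℝ) (ν₀ : Measure (HiddenUnit dx da)) :
    Matrix (M.SA ⊕ M.SA) (M.SA ⊕ M.SA) ℝ :=
  Matrix.fromBlocks (M.covMatrix act ν₀) 0 0 (M.covMatrix act ν₀)

lemma memLp_inner_outputVec (hact : IsActivation act) (hν₀ : IsInitLaw ν₀)
    (t : EuclideanSpace ℝ (M.SA ⊕ M.SA)) :
    MemLp (fun z => inner ℝ t (M.outputVec act z)) 2 (ν₀.prod ν₀) := by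
  simp_rw [inner_outputVec]
  exact ((memLp_combinedOutput hact hν₀ _).comp_measurePreserving measurePreserving_snd).add
    ((memLp_combinedOutput hact hν₀ _).comp_measurePreserving measurePreserving_fst)

lemma integral_inner_outputVec (hact : IsActivation act) (hν₀ : IsInitLaw ν₀)
    (t : EuclideanSpace ℝ (M.SA ⊕ M.SA)) :
    ∫ z, inner ℝ t (M.outputVec act z) ∂(ν₀.prod ν₀) = 0 := by
  have h := fun t => (memLp_combinedOutput (M := M) hact hν₀ t).integrable one_le_two
  simp_rw [inner_outputVec]
  rw [integral_add ((h _).comp_snd _) ((h _).comp_fst _), integral_fun_snd, integral_fun_fst,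
    integral_combinedOutput hact hν₀, integral_combinedOutput hact hν₀]
  simp

/-- The cross term is a product of two centred integrals over the product measure; this is why the
covariance matrix is block diagonal. -/
lemma integral_inner_outputVec_sq (hact : IsActivation act) (hν₀ : IsInitLaw ν₀)
    (t : EuclideanSpace ℝ (M.SA ⊕ M.SA)) :
    ∫ z, inner ℝ t (M.outputVec act z) ^ 2 ∂(ν₀.prod ν₀)
      = t.ofLp ⬝ᵥ (M.pairCovMatrix act ν₀).mulVec t.ofLp := by
  have h := fun t => (memLp_combinedOutput (M := M) hact hν₀ t).integrable one_le_two
  have h2 := fun t => (memLp_combinedOutput (M := M) hact hν₀ t).integrable_sq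
  set u : M.SA → ℝ := fun ξ => t (Sum.inl ξ) with hu
  set v : M.SA → ℝ := fun ξ => t (Sum.inr ξ) with hv
  have e : ∀ z : HiddenUnit dx da × HiddenUnit dx da, inner ℝ t (M.outputVec act z) ^ 2
      = M.combinedOutput act u z.2 ^ 2 + M.combinedOutput act v z.1 ^ 2
        + 2 * (M.combinedOutput act v z.1 * M.combinedOutput act u z.2) := by
    intro z
    rw [inner_outputVec]
    ring
  simp_rw [e]
  have i1 : Integrable (fun z : HiddenUnit dx da × HiddenUnit dx da =>
      M.combinedOutput act u z.2 ^ 2) (ν₀.prod ν₀) := (h2 u).comp_snd _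
  have i2 : Integrable (fun z : HiddenUnit dx da × HiddenUnit dx da =>
      M.combinedOutput act v z.1 ^ 2) (ν₀.prod ν₀) := (h2 v).comp_fst _
  have i12 : Integrable (fun z : HiddenUnit dx da × HiddenUnit dx da =>
      M.combinedOutput act u z.2 ^ 2 + M.combinedOutput act v z.1 ^ 2) (ν₀.prod ν₀) := i1.add i2
  rw [integral_add i12 (((h v).mul_prod (h u)).const_mul 2), integral_add i1 i2,
    integral_const_mul, integral_prod_mul, integral_combinedOutput hact hν₀,
    integral_fun_snd (fun z => M.combinedOutput act u z ^ 2),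
    integral_fun_fst (fun z => M.combinedOutput act v z ^ 2),
    integral_combinedOutput_sq hact hν₀, integral_combinedOutput_sq hact hν₀]
  have et : t.ofLp = Sum.elim u v := by
    ext j
    rcases j with ξ | ξ <;> rfl
  rw [et, pairCovMatrix, Matrix.fromBlocks_mulVec, sumElim_dotProduct_sumElim]
  simp

/-- Its quadratic form is a second moment. -/
lemma posSemidef_pairCovMatrix (hact : IsActivation act) (hν₀ : IsInitLaw ν₀) :
    (M.pairCovMatrix act ν₀).PosSemidef := by
  refine Matrix.PosSemidef.of_dotProduct_mulVec_nonneg ?_ fun t => ?_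
  · have h : (M.covMatrix act ν₀).transpose = M.covMatrix act ν₀ := by
      ext ξ ξ'
      simp only [Matrix.transpose_apply, covMatrix, initCov, mul_comm]
    rw [Matrix.IsHermitian, Matrix.conjTranspose_eq_transpose_of_trivial, pairCovMatrix,
      Matrix.fromBlocks_transpose, h, Matrix.transpose_zero]
  · have := integral_inner_outputVec_sq hact hν₀ (WithLp.toLp 2 t : EuclideanSpace ℝ (M.SA ⊕ M.SA))
    simp only [star_trivial]
    rw [← this]
    exact integral_nonneg fun z => sq_nonneg _

end Law

/-- The pair of vectors given by the coordinates of a Euclidean vector. -/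
noncomputable def splitCLM (M : MDP dx da) : EuclideanSpace ℝ (M.SA ⊕ M.SA) →L[ℝ] M.Outputs :=
  (ContinuousLinearMap.pi fun ξ => EuclideanSpace.proj (Sum.inl ξ)).prod
    (ContinuousLinearMap.pi fun ξ => EuclideanSpace.proj (Sum.inr ξ))

/-- The initial outputs converge in distribution to a pair of independent Gaussian vectors. -/
theorem exists_gaussian_limit (hact : IsActivation act) {ν₀ : Measure (HiddenUnit dx da)}
    [IsProbabilityMeasure ν₀] (hν₀ : IsInitLaw ν₀) {α : ℝ} {Ω : ℕ+ → Type*}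
    [∀ N, MeasurableSpace (Ω N)] {Pr : ∀ N, Measure (Ω N)} [∀ N, IsProbabilityMeasure (Pr N)]
    {D : ∀ N : ℕ+, M.NACData N (Ω N)} (hD : ∀ N, (D N).IsOnlineNAC act α ν₀ (Pr N)) :
    ∃ (Ω' : Type) (_ : MeasurableSpace Ω') (Pr' : Measure Ω') (_ : IsProbabilityMeasure Pr')
      (G H : Ω' → M.SA → ℝ),
      HasGaussianLaw (fun ω => (G ω, H ω)) Pr' ∧
      IndepFun G H Pr' ∧
      (∀ ξ, ∫ ω, G ω ξ ∂Pr' = 0) ∧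
      (∀ ξ, ∫ ω, H ω ξ ∂Pr' = 0) ∧
      (∀ ξ ξ', ∫ ω, G ω ξ * G ω ξ' ∂Pr' = M.initCov act ν₀ ξ ξ') ∧
      (∀ ξ ξ', ∫ ω, H ω ξ * H ω ξ' ∂Pr' = M.initCov act ν₀ ξ ξ') ∧
      TendstoInDistribution (fun N ω => ((D N).P act α 0 ω, (D N).Q act α 0 ω)) atTop
        (fun ω => (G ω, H ω)) Pr Pr' := by
  classical
  set S := M.pairCovMatrix act ν₀ with hS
  have hSp : S.PosSemidef := posSemidef_pairCovMatrix hact hν₀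
  set ρ := multivariateGaussian (0 : EuclideanSpace ℝ (M.SA ⊕ M.SA)) S with hρ
  have hvec := measurable_outputVec (M := M) hact
  have hgauss : HasGaussianLaw (fun x => M.splitCLM x) ρ :=
    (IsGaussian.hasGaussianLaw_id (μ := ρ)).map_fun M.splitCLM
  have hmem : ∀ j, MemLp (fun x : EuclideanSpace ℝ (M.SA ⊕ M.SA) => x j) 2 ρ := fun j =>
    ((IsGaussian.hasGaussianLaw_id (μ := ρ)).map_fun
      (EuclideanSpace.proj j : EuclideanSpace ℝ (M.SA ⊕ M.SA) →L[ℝ] ℝ)).memLp_two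
  have hmean : ∀ j, ∫ x : EuclideanSpace ℝ (M.SA ⊕ M.SA), x j ∂ρ = 0 := fun j => by
    have := ContinuousLinearMap.integral_comp_comm
      (EuclideanSpace.proj j : EuclideanSpace ℝ (M.SA ⊕ M.SA) →L[ℝ] ℝ)
      (IsGaussian.integrable_id (μ := ρ))
    simp only [id_eq, hρ, integral_id_multivariateGaussian] at this
    simpa using this
  have hcov : ∀ i j, cov[fun x => x i, fun x => x j; ρ] = S i j := fun i j =>
    covariance_eval_multivariateGaussian hSp i j
  have hprod : ∀ i j, ∫ x : EuclideanSpace ℝ (M.SA ⊕ M.SA), x i * x j ∂ρ = S i j := fun i j => by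
    rw [← hcov, covariance_eq_sub (hmem i) (hmem j), hmean, zero_mul, sub_zero]
    rfl
  -- The limit is realised canonically: the sample space is the Euclidean space with the Gaussian
  -- law, and the two vectors are its coordinate blocks.
  refine ⟨EuclideanSpace ℝ (M.SA ⊕ M.SA), inferInstance, ρ, inferInstance,
    fun x ξ => x (Sum.inl ξ), fun x ξ => x (Sum.inr ξ), hgauss, ?_, fun ξ => hmean _,
    fun ξ => hmean _, fun ξ ξ' => hprod _ _, fun ξ ξ' => hprod _ _, ?_⟩
  -- For jointly Gaussian vectors the vanishing off-diagonal blocks give independence.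
  · refine HasGaussianLaw.indepFun_of_covariance_eval
      (X := fun ξ (x : EuclideanSpace ℝ (M.SA ⊕ M.SA)) => x (Sum.inl ξ))
      (Y := fun ξ (x : EuclideanSpace ℝ (M.SA ⊕ M.SA)) => x (Sum.inr ξ)) hgauss fun ξ ξ' => ?_
    rw [hcov]
    rfl
  · have hmeas : ∀ N i, Measurable fun ω => ((D N).ϑ₀ ω i, (D N).θ₀ ω i) := fun N i =>
      ((measurable_pi_apply i).comp (hD N).measurable_ϑ₀).prodMk
        ((measurable_pi_apply i).comp (hD N).measurable_θ₀)
    have hprob : IsProbabilityMeasure ((ν₀.prod ν₀).map (M.outputVec act)) :=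
      Measure.isProbabilityMeasure_map hvec.aemeasurable
    have hinner : ∀ t : EuclideanSpace ℝ (M.SA ⊕ M.SA), Measurable fun x => inner ℝ t x :=
      fun t => by fun_prop
    have h := tendstoInDistribution_multivariateGaussian
      (V := fun N i ω => M.outputVec act ((D N).ϑ₀ ω i, (D N).θ₀ ω i))
      (ρ := (ν₀.prod ν₀).map (M.outputVec act)) (Pr := Pr) (S := S)
      (fun N i => hvec.comp (hmeas N i)) (fun N => (hD N).init_indep.comp _ fun _ => hvec)
      (fun N i => by
        rw [← (hD N).init_law i, Measure.map_map hvec (hmeas N i)]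
        rfl) hSp
      (fun t => (memLp_map_measure_iff (hinner t).aestronglyMeasurable hvec.aemeasurable).2
        (memLp_inner_outputVec hact hν₀ t))
      (fun t => by
        rw [integral_map hvec.aemeasurable (hinner t).aestronglyMeasurable]
        exact integral_inner_outputVec hact hν₀ t)
      (fun t => by
        rw [integral_map hvec.aemeasurable ((hinner t).pow_const 2).aestronglyMeasurable]
        exact integral_inner_outputVec_sq hact hν₀ t)
    have h' := h.continuous_comp M.splitCLM.continuous
    refine h'.congr (fun N => Eventually.of_forall fun ω => ?_) (Eventually.of_forall fun ω => rfl)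
    refine Prod.ext (funext fun ξ => ?_) (funext fun ξ => ?_)
    · simp [splitCLM, NACData.P, net, NACData.state, params, outputVec, unitOutput,
        one_div, Prod.fst_sum]
    · simp [splitCLM, NACData.Q, net, NACData.state, params, outputVec, unitOutput,
        one_div, Prod.snd_sum]

end MDP

/-! ### Paths -/

namespace CadlagPath

variable {T : ℝ} {E : Type*}

/-- The identity time change bounds the Skorokhod distance by the uniform one. No other time change
is needed, as the convergence to the continuous limit paths is uniform. -/
lemma edist_le_of_forall [PseudoEMetricSpace E] {x y : CadlagPath T E} {δ : ℝ≥0∞}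
    (h : ∀ t, edist (x t) (y t) ≤ δ) : edist x y ≤ δ :=
  iInf_le_of_le (OrderIso.refl _) (max_le (by simp) (iSup_le h))

/-- A continuous path as a càdlàg path. -/
def ofContinuous [TopologicalSpace E] (f : Set.Icc (0 : ℝ) T → E) (hf : Continuous f) :
    CadlagPath T E where
  toFun := f
  right_continuous _ := hf.continuousWithinAt
  left_limit t := ⟨f t, (hf.tendsto t).mono_left nhdsWithin_le_nhds⟩

lemma ext_of_forall [TopologicalSpace E] {x y : CadlagPath T E} (h : ∀ t, x t = y t) : x = y := by
  cases x; cases y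
  congr
  exact funext h

lemma nat_floor_mul_le {n : ℕ} {t : ℝ} (ht : t ≤ T) :
    ⌊(n : ℝ) * t⌋₊ ≤ ⌊(n : ℝ) * T⌋₊ :=
  Nat.floor_le_floor (mul_le_mul_of_nonneg_left ht n.cast_nonneg)

/-- The path `t ↦ Y ⌊n t⌋` depends continuously on finitely many values of `Y`. -/
lemma continuous_ofSeq_min [PseudoEMetricSpace E] (T : ℝ) (n m : ℕ) :
    Continuous fun s : Fin (m + 1) → E =>
      ofSeq T n fun k => s ⟨min k m, Nat.lt_succ_of_le (min_le_right k m)⟩ := by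
  refine LipschitzWith.continuous (K := 1) fun s s' => ?_
  rw [ENNReal.coe_one, one_mul]
  exact edist_le_of_forall fun t => edist_le_pi_edist s s' _

/-- On `[0,T]` only the values up to `⌊n T⌋` matter, so the path is a continuous image of a finite
vector in the second countable space `S`. Measurability in the Skorokhod space thus needs no
countability of `E`. -/
lemma measurable_ofSeq [PseudoEMetricSpace E] {S : Type*} [TopologicalSpace S]
    [MeasurableSpace S] [BorelSpace S] [SecondCountableTopology S] {Ω : Type*} [MeasurableSpace Ω]
    (T : ℝ) (n : ℕ) {F : S → E} (hF : Continuous F) {Y : ℕ → Ω → S} (hY : ∀ k, Measurable (Y k)) :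
    Measurable fun ω => ofSeq T n fun k => F (Y k ω) := by
  set m := ⌊(n : ℝ) * T⌋₊
  have h1 : Continuous fun s : Fin (m + 1) → S =>
      ofSeq T n fun k => F (s ⟨min k m, Nat.lt_succ_of_le (min_le_right k m)⟩) :=
    (continuous_ofSeq_min T n m).comp (continuous_pi fun i => hF.comp (continuous_apply i))
  have h2 : Measurable fun ω => fun i : Fin (m + 1) => Y i ω := measurable_pi_iff.2 fun i => hY i
  convert h1.measurable.comp h2 using 1
  funext ω
  refine ext_of_forall fun t => ?_
  change F (Y ⌊(n : ℝ) * t⌋₊ ω) = F (Y (min ⌊(n : ℝ) * t⌋₊ m) ω)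
  rw [min_eq_left (nat_floor_mul_le t.2.2)]

end CadlagPath

namespace MDP

variable {dx da : ℕ} {M : MDP dx da} {act : ℝ → ℝ} {α T : ℝ}

/-! ### The limit process -/

section LimitPath

variable {ν₀ : ProbabilityMeasure (HiddenUnit dx da)}

lemma continuous_flow_field (hM : M.IsErgodic) (hα : 0 ≤ α) (hT : 0 ≤ T) (x : M.Outputs) :
    Continuous fun t : Set.Icc (0 : ℝ) T =>
      flow (M.field act α (ν₀ : Measure (HiddenUnit dx da))) T x t :=
  continuousOn_iff_continuous_domRestrict.1
    ((isTameField_field hM hα T).flow_spec hT x).2.continuousOn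

/-- The solution of the limit system that starts in `x`. -/
noncomputable def limitPath (act : ℝ → ℝ) (ν₀ : ProbabilityMeasure (HiddenUnit dx da))
    (hM : M.IsErgodic) (hα : 0 ≤ α) (hT : 0 ≤ T) (x : M.Outputs) : CadlagPath T M.E :=
  .ofContinuous (fun t => (.ofMeasure ν₀, .ofMeasure ν₀,
      flow (M.field act α (ν₀ : Measure (HiddenUnit dx da))) T x t))
    (continuous_const.prodMk (continuous_const.prodMk (continuous_flow_field hM hα hT x)))

lemma isODESolution_field_iff {ν : Measure (HiddenUnit dx da)} {P Q : ℝ → M.SA → ℝ} :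
    IsODESolution (M.field act α ν) T (fun t => (P t, Q t)) ↔
      ∀ t ∈ Set.Icc (0 : ℝ) T, ∀ ξ,
        HasDerivWithinAt (fun s => Q s ξ) (M.criticField act α ν t (P t) (Q t) ξ)
          (Set.Icc 0 T) t ∧
        HasDerivWithinAt (fun s => P s ξ) (M.actorField act ν t (P t) (Q t) ξ)
          (Set.Icc 0 T) t := by
  refine forall₂_congr fun t ht => ⟨fun h ξ => ⟨?_, ?_⟩, fun h => ?_⟩
  · exact (hasDerivWithinAt_pi.1
      (hasFDerivWithinAt_snd.comp_hasDerivWithinAt t h (Set.mapsTo_univ _ _))) ξ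
  · exact (hasDerivWithinAt_pi.1
      (hasFDerivWithinAt_fst.comp_hasDerivWithinAt t h (Set.mapsTo_univ _ _))) ξ
  · exact (hasDerivWithinAt_pi.2 fun ξ => (h ξ).2).prodMk (hasDerivWithinAt_pi.2 fun ξ => (h ξ).1)

lemma isLimitPath_limitPath (hM : M.IsErgodic) (hα : 0 ≤ α) (hT : 0 ≤ T) (x : M.Outputs) :
    M.IsLimitPath act α T ν₀ x.1 x.2 (limitPath act ν₀ hM hα hT x) := by
  obtain ⟨h0, h⟩ := (isTameField_field (act := act) (ν₀ := (ν₀ : Measure (HiddenUnit dx da)))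
    hM hα T).flow_spec hT x
  exact ⟨fun t => (flow (M.field act α (ν₀ : Measure (HiddenUnit dx da))) T x t).1,
    fun t => (flow (M.field act α (ν₀ : Measure (HiddenUnit dx da))) T x t).2, fun t => rfl,
    congrArg Prod.fst h0, congrArg Prod.snd h0, isODESolution_field_iff.1 h⟩

theorem existsUnique_isLimitPath (hM : M.IsErgodic) (hα : 0 ≤ α) (hT : 0 ≤ T)
    (p₀ q₀ : M.SA → ℝ) : ∃! z : CadlagPath T M.E, M.IsLimitPath act α T ν₀ p₀ q₀ z := by
  refine ⟨limitPath act ν₀ hM hα hT (p₀, q₀), isLimitPath_limitPath hM hα hT (p₀, q₀), ?_⟩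
  rintro z ⟨P, Q, hz, hP, hQ, hode⟩
  have hF := isTameField_field (act := act) (ν₀ := (ν₀ : Measure (HiddenUnit dx da))) hM hα T
  obtain ⟨h0, h⟩ := hF.flow_spec hT (p₀, q₀)
  have heq := hF.eqOn (isODESolution_field_iff.2 hode) h (by rw [h0, hP, hQ])
  refine CadlagPath.ext_of_forall fun t => ?_
  rw [hz t]
  change (_, _, (fun t => (P t, Q t)) (t : ℝ)) = _
  rw [heq t.2]
  rfl

/-- The flow is Lipschitz in the starting point on balls, uniformly in time, and the two measure
components are constant. -/
lemma continuous_limitPath (hM : M.IsErgodic) (hα : 0 ≤ α) (hT : 0 ≤ T) :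
    Continuous (limitPath (M := M) act ν₀ hM hα hT) := by
  have hF := isTameField_field (act := act) (ν₀ := (ν₀ : Measure (HiddenUnit dx da))) hM hα T
  refine continuous_iff_continuousAt.2 fun x => ?_
  obtain ⟨C, hC0, hC⟩ := hF.exists_dist_flow_le hT (‖x‖ + 1)
  refine tendsto_iff_edist_tendsto_0.2 ?_
  have hlim : Tendsto (fun y => ENNReal.ofReal (C * dist y x)) (𝓝 x) (𝓝 0) := by
    have h1 : Continuous fun y => C * dist y x := by fun_prop
    have := ENNReal.tendsto_ofReal (h1.tendsto x)
    simpa using this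
  refine tendsto_of_tendsto_of_tendsto_of_le_of_le' tendsto_const_nhds hlim
    (Eventually.of_forall fun _ => zero_le) ?_
  filter_upwards [Metric.ball_mem_nhds x one_pos] with y hy
  have hy' : ‖y‖ ≤ ‖x‖ + 1 := by
    have h1 := norm_sub_norm_le y x
    have h2 := mem_ball_iff_norm.1 hy
    linarith
  refine CadlagPath.edist_le_of_forall fun t => ?_
  have h := hC y x hy' (by linarith) t t.2
  have e : edist (limitPath act ν₀ hM hα hT y t) (limitPath act ν₀ hM hα hT x t)
      = edist (flow (M.field act α (ν₀ : Measure (HiddenUnit dx da))) T y t)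
        (flow (M.field act α (ν₀ : Measure (HiddenUnit dx da))) T x t) := by
    simp [limitPath, CadlagPath.ofContinuous, Prod.edist_eq]
  rw [e, edist_dist]
  exact ENNReal.ofReal_le_ofReal h

end LimitPath

/-! ### Measurability of the process -/

lemma edist_ofMeasure_empirical_le (N : ℕ+) {θ θ' : Fin N → HiddenUnit dx da} {δ : ℝ≥0∞}
    (h : ∀ i, edist (θ i) (θ' i) ≤ δ) :
    edist (LevyProkhorov.ofMeasure (empirical N θ)) (LevyProkhorov.ofMeasure (empirical N θ'))
      ≤ δ :=
  levyProkhorovEDist_empirical_le N h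

lemma continuous_ofMeasure_empirical (N : ℕ+) : Continuous fun θ : Fin N → HiddenUnit dx da =>
    LevyProkhorov.ofMeasure (empirical N θ) := by
  refine LipschitzWith.continuous (K := 1) fun θ θ' => ?_
  rw [ENNReal.coe_one, one_mul]
  exact edist_ofMeasure_empirical_le N fun i => edist_le_pi_edist θ θ' i

lemma measurable_process (hact : IsActivation act) {N : ℕ+} {Ω : Type*} [MeasurableSpace Ω]
    {D : M.NACData N Ω} {ν₀ : Measure (HiddenUnit dx da)} {Pr : Measure Ω}
    (hD : D.IsOnlineNAC act α ν₀ Pr) : Measurable (D.process act α T) := by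
  have hF : Continuous fun s : (Fin N → HiddenUnit dx da) × (Fin N → HiddenUnit dx da) =>
      ((LevyProkhorov.ofMeasure (empirical N s.1), LevyProkhorov.ofMeasure (empirical N s.2),
        M.net act s.1, M.net act s.2) : M.E) :=
    ((continuous_ofMeasure_empirical N).comp continuous_fst).prodMk
      (((continuous_ofMeasure_empirical N).comp continuous_snd).prodMk
        (((continuous_net hact.continuous).comp continuous_fst).prodMk
          ((continuous_net hact.continuous).comp continuous_snd)))
  exact CadlagPath.measurable_ofSeq T N hF fun k =>
    (D.measurable_state hact k).mono (hD.history_le k) le_rfl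

end MDP

namespace MDP

variable {dx da : ℕ} {M : MDP dx da} {act : ℝ → ℝ} {α T : ℝ}

/-! ### Averages of the drifts -/

section Average

variable {ν₀ : Measure (HiddenUnit dx da)}

lemma continuousOn_criticDrift (A : M.SA → M.SA → ℝ) (ξ y z : M.SA) :
    ContinuousOn (fun p : ℝ × M.Outputs => criticDrift α A ξ p.2 y z) M.slab :=
  continuousOn_const.mul (continuousOn_const.mul ((continuousOn_const.add
    (continuousOn_const.mul (continuousOn_Q z))).sub (continuousOn_Q y)))

lemma continuousOn_actorDrift (A : M.SA → M.SA → ℝ) (ξ y : M.SA) :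
    ContinuousOn (fun p : ℝ × M.Outputs => actorDrift (zeta p.1) A ξ p.2 y) M.slab :=
  ((continuousOn_time continuousOn_zeta).mul (continuousOn_clip y)).mul
    (continuousOn_const.sub (continuousOn_finsetSum _ fun a _ =>
      (continuousOn_softmax (y.1, a)).mul continuousOn_const))

lemma sum_policyKernel {q : M.SA → M.X → ℝ} (hq : ∀ ξ, ∑ x, q ξ x = 1) (t : ℝ) (x : M.Outputs)
    (y : M.SA) : ∑ z, policyKernel q t x y z = 1 :=
  M.sum_mul_policy hq (isPositivePolicy_explore_eta t x.1) y

/-- Averaging the temporal difference over the next pair turns `Q` there into `∑ Q g p`; the other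
terms do not depend on the next pair, and the kernel has row sums one. -/
lemma criticField_eq_average (t : ℝ) (x : M.Outputs) (ξ : M.SA) :
    M.criticField act α ν₀ t x.1 x.2 ξ = ∑ y, M.stat (M.explore (eta t) x.1) y *
      ∑ z, policyKernel M.p t x y z * criticDrift α (M.kernelA act ν₀) ξ x y z := by
  have h : ∀ y, ∑ z, policyKernel M.p t x y z * criticDrift α (M.kernelA act ν₀) ξ x y z
      = α * (M.kernelA act ν₀ ξ y * (M.r y
        + M.γ * ∑ z : M.SA, x.2 z * M.explore (eta t) x.1 z * M.p y z.1 - x.2 y)) := by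
    intro y
    have e : ∀ z, policyKernel M.p t x y z * criticDrift α (M.kernelA act ν₀) ξ x y z
        = α * M.kernelA act ν₀ ξ y * (M.r y - x.2 y) * policyKernel M.p t x y z
          + α * M.kernelA act ν₀ ξ y * M.γ * (x.2 z * M.explore (eta t) x.1 z * M.p y z.1) := by
      intro z
      simp only [policyKernel, criticDrift]
      ring
    simp_rw [e]
    rw [Finset.sum_add_distrib, ← Finset.mul_sum, ← Finset.mul_sum, sum_policyKernel M.p_sum]
    ring
  simp_rw [h]
  simp only [criticField, Finset.mul_sum]
  refine Finset.sum_congr rfl fun y _ => ?_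
  ring

/-- The actor drift does not involve the next pair, so the transition kernel sums out. -/
lemma actorField_eq_average (t : ℝ) (x : M.Outputs) (ξ : M.SA) :
    M.actorField act ν₀ t x.1 x.2 ξ = ∑ y, M.visit (M.explore (eta t) x.1) y *
      ∑ z, policyKernel M.pAux t x y z * actorDrift (zeta t) (M.kernelA act ν₀) ξ x y := by
  simp only [actorField]
  refine Finset.sum_congr rfl fun y _ => ?_
  rw [← Finset.sum_mul, sum_policyKernel M.sum_pAux, one_mul, actorDrift]
  ring

end Average

/-! ### The initial parameters -/

section Init

variable {ν₀ : ProbabilityMeasure (HiddenUnit dx da)} {Ω : ℕ+ → Type*}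
  [∀ N, MeasurableSpace (Ω N)] {Pr : ∀ N, Measure (Ω N)} {D : ∀ N : ℕ+, M.NACData N (Ω N)}

lemma continuous_unitKernel (hact : IsActivation act) (ξ y : M.SA) :
    Continuous (unitKernel act ξ y) := by
  have h (ξ : M.SA) : Continuous fun z : HiddenUnit dx da => M.dot z.2 ξ :=
    (continuous_dot ξ).comp continuous_snd
  have h1 := fun ξ : M.SA => hact.continuous.comp (h ξ)
  have h2 := fun ξ : M.SA => hact.continuous_deriv.comp (h ξ)
  exact ((h1 y).mul (h1 ξ)).add ((continuous_fst.pow 2).mul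
    (((h2 y).mul (h2 ξ)).mul continuous_const))

lemma memLp_unitKernel (hact : IsActivation act)
    (hν₀ : IsInitLaw (ν₀ : Measure (HiddenUnit dx da))) (ξ y : M.SA) :
    MemLp (unitKernel act ξ y) 2 (ν₀ : Measure (HiddenUnit dx da)) := by
  refine MemLp.of_bound (continuous_unitKernel hact ξ y).aestronglyMeasurable
    (1 + M.radius ^ 2) ?_
  filter_upwards [hν₀.bound_c] with z hz
  rw [Real.norm_eq_abs, unitKernel]
  refine (abs_add_le _ _).trans (add_le_add ?_ ?_)
  · rw [abs_mul]
    exact mul_le_one₀ (hact.bound _) (abs_nonneg _) (hact.bound _)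
  · rw [abs_mul, abs_mul, abs_mul, abs_pow]
    have h1 : |z.1| ^ 2 ≤ 1 := pow_le_one₀ (abs_nonneg _) hz
    have h2 := mul_le_one₀ (hact.bound_deriv (M.dot z.2 y)) (abs_nonneg _)
      (hact.bound_deriv (M.dot z.2 ξ))
    have h3 := mul_le_mul h2 (abs_inner_vec_le ξ y) (abs_nonneg _) zero_le_one
    calc _ ≤ 1 * (1 * M.radius ^ 2) := mul_le_mul h1 h3 (by positivity) zero_le_one
      _ = _ := by ring

variable {Z : ∀ N : ℕ+, Ω N → Fin N → HiddenUnit dx da}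

/-- `Z` is an array of i.i.d. initial parameters with law `ν₀`. -/
structure IsInitArray (ν₀ : Measure (HiddenUnit dx da)) (Pr : ∀ N, Measure (Ω N))
    (Z : ∀ N : ℕ+, Ω N → Fin N → HiddenUnit dx da) : Prop where
  measurable : ∀ N i, Measurable fun ω => Z N ω i
  indep : ∀ N, iIndepFun (fun i ω => Z N ω i) (Pr N)
  law : ∀ N i, (Pr N).map (fun ω => Z N ω i) = ν₀

lemma isInitArray_actor
    (hD : ∀ N, (D N).IsOnlineNAC act α (ν₀ : Measure (HiddenUnit dx da)) (Pr N)) :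
    IsInitArray (ν₀ : Measure (HiddenUnit dx da)) Pr fun N => (D N).θ₀ where
  measurable N i := (measurable_pi_apply i).comp (hD N).measurable_θ₀
  indep N := (hD N).init_indep.comp _ fun _ => measurable_snd
  law N i := by
    have hm : Measurable fun ω => ((D N).ϑ₀ ω i, (D N).θ₀ ω i) :=
      ((measurable_pi_apply i).comp (hD N).measurable_ϑ₀).prodMk
        ((measurable_pi_apply i).comp (hD N).measurable_θ₀)
    have h := congrArg (Measure.map Prod.snd) ((hD N).init_law i)
    rw [Measure.map_map measurable_snd hm, Measure.map_snd_prod, measure_univ, one_smul] at h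
    exact h

lemma isInitArray_critic
    (hD : ∀ N, (D N).IsOnlineNAC act α (ν₀ : Measure (HiddenUnit dx da)) (Pr N)) :
    IsInitArray (ν₀ : Measure (HiddenUnit dx da)) Pr fun N => (D N).ϑ₀ where
  measurable N i := (measurable_pi_apply i).comp (hD N).measurable_ϑ₀
  indep N := (hD N).init_indep.comp _ fun _ => measurable_fst
  law N i := by
    have hm : Measurable fun ω => ((D N).ϑ₀ ω i, (D N).θ₀ ω i) :=
      ((measurable_pi_apply i).comp (hD N).measurable_ϑ₀).prodMk
        ((measurable_pi_apply i).comp (hD N).measurable_θ₀)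
    have h := congrArg (Measure.map Prod.fst) ((hD N).init_law i)
    rw [Measure.map_map measurable_fst hm, Measure.map_fst_prod, measure_univ, one_smul] at h
    exact h

namespace IsInitArray

/-- The weak law of large numbers for `unitKernel`, applied to each of the finitely many pairs. -/
lemma eventually_abs_empKernel_sub_le [∀ N, IsProbabilityMeasure (Pr N)] (hact : IsActivation act)
    (hν₀ : IsInitLaw (ν₀ : Measure (HiddenUnit dx da)))
    (hZ : IsInitArray (ν₀ : Measure (HiddenUnit dx da)) Pr Z) {ε : ℝ} (hε : 0 < ε) :
    ∀ᶠ p in probFilter Pr, ∀ y z : M.SA,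
      |empKernel act (Z p.1 p.2) y z - M.kernelA act (ν₀ : Measure (HiddenUnit dx da)) y z|
        ≤ ε := by
  refine eventually_all.2 fun y => eventually_all.2 fun z => ?_
  have h := tendsto_average_probFilter (Z := fun N i ω => Z N ω i) hZ.measurable hZ.indep hZ.law
    (continuous_unitKernel hact y z).measurable (memLp_unitKernel hact hν₀ y z)
  filter_upwards [Metric.tendsto_nhds.1 h ε hε] with p hp
  exact hp.le

lemma eventually_edist_empirical_lt [∀ N, IsProbabilityMeasure (Pr N)]
    (hZ : IsInitArray (ν₀ : Measure (HiddenUnit dx da)) Pr Z)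
    {ε : ℝ≥0∞} (hε : 0 < ε) :
    ∀ᶠ p in probFilter Pr, edist (LevyProkhorov.ofMeasure (empirical p.1 (Z p.1 p.2)))
      (LevyProkhorov.ofMeasure ν₀) < ε := by
  have h := tendsto_empirical_probFilter (Z := fun N i ω => Z N ω i) hZ.measurable hZ.indep hZ.law
  have h2 := (LevyProkhorov.continuous_ofMeasure_probabilityMeasure.tendsto ν₀).comp h
  exact EMetric.tendsto_nhds.1 h2 ε hε

lemma eventually_abs_fst_le (hν₀ : IsInitLaw (ν₀ : Measure (HiddenUnit dx da)))
    (hZ : IsInitArray (ν₀ : Measure (HiddenUnit dx da)) Pr Z) :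
    ∀ᶠ p in probFilter Pr, ∀ i, |(Z p.1 p.2 i).1| ≤ 1 := by
  refine eventually_probFilter_of_ae fun N => ?_
  change ∀ᵐ ω ∂Pr N, ∀ i, |(Z N ω i).1| ≤ 1
  refine ae_all_iff.2 fun i => ?_
  have h : ∀ᵐ z ∂(Pr N).map fun ω => Z N ω i, |z.1| ≤ 1 := by
    rw [hZ.law]
    exact hν₀.bound_c
  exact ae_of_ae_map (hZ.measurable N i).aemeasurable h

end IsInitArray

end Init

end MDP

/-! ### Comparison of the algorithm with the limit system. -/

lemma IsTameField.exists_norm_flow_sub_le {V : Type*} [NormedAddCommGroup V] [NormedSpace ℝ V]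
    [CompleteSpace V] {F : ℝ → V → V} {T : ℝ} (hF : IsTameField F T) (hT : 0 ≤ T) (R : ℝ) :
    ∃ L, ∀ x, ‖x‖ ≤ R → ∀ s t, 0 ≤ s → s ≤ t → t ≤ T →
      ‖flow F T x t - flow F T x s‖ ≤ L * (t - s) := by
  obtain ⟨K, hK, hgrow⟩ := hF.growth
  obtain ⟨R', -, hR'⟩ := hF.exists_norm_flow_le hT R
  refine ⟨K * (1 + R'), fun x hx s t hs hst ht => ?_⟩
  have h := (hF.flow_spec hT x).2.norm_sub_sub_smul_le hs hst ht (v := 0) (η := K * (1 + R'))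
    fun r hr => by
      have hr' : r ∈ Set.Icc (0 : ℝ) T := ⟨hs.trans hr.1, hr.2.trans ht⟩
      rw [sub_zero]
      refine (hgrow r hr' _).trans ?_
      gcongr
      exact hR' x hx r hr'
  simpa using h

namespace MDP

variable {dx da : ℕ} {M : MDP dx da} {act : ℝ → ℝ} {α T : ℝ}
  {ν₀ : ProbabilityMeasure (HiddenUnit dx da)} {Ω : ℕ+ → Type*} [∀ N, MeasurableSpace (Ω N)]
  {Pr : ∀ N, Measure (Ω N)} [∀ N, IsProbabilityMeasure (Pr N)] {D : ∀ N : ℕ+, M.NACData N (Ω N)}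

section Average

variable {G : ∀ N, Set (Ω N)} {R : ℝ}

lemma eventually_abs_sum_criticDrift_sub_le
    (hD : ∀ N, (D N).IsOnlineNAC act α (ν₀ : Measure (HiddenUnit dx da)) (Pr N))
    (hM : M.IsErgodic) (hact : IsActivation act)
    (hG : ∀ N, MeasurableSet[(D N).history 0] (G N))
    (hGX : ∀ N, ∀ ω ∈ G N, ∀ k : ℕ, (k : ℝ) ≤ (N : ℕ) * T → ‖(D N).outputs act α k ω‖ ≤ R)
    (hGd : ∀ N, ∀ ω ∈ G N, ∀ k : ℕ, (k : ℝ) + 1 ≤ (N : ℕ) * T →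
      ‖(D N).outputs act α (k + 1) ω - (D N).outputs act α k ω‖ ≤ R / (N : ℕ))
    {ε : ℝ} (hε : 0 < ε) (y : M.SA) :
    ∀ᶠ p in probFilter Pr, p.2 ∈ G p.1 → ∀ n : ℕ, (n : ℝ) ≤ p.1 * T →
      |∑ k ∈ Finset.range n, (criticDrift α (M.kernelA act (ν₀ : Measure (HiddenUnit dx da))) y
          ((D p.1).outputs act α k p.2) ((D p.1).ξ k p.2) ((D p.1).ξ (k + 1) p.2)
        - (M.field act α (ν₀ : Measure (HiddenUnit dx da)) ((k : ℝ) / p.1)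
          ((D p.1).outputs act α k p.2)).2 y)| ≤ ε * p.1 :=
  eventually_abs_sum_sub_policy_average_le M.p_nonneg M.p_sum hM.isLipschitzPolicyMap_stat
    (fun t x => M.isStationaryDist_stat (isPositivePolicy_explore_eta t x.1))
    (fun t x => hM.irreducible _ (isPositivePolicy_explore_eta t x.1))
    (fun N => NACData.filtration (hD N)) (fun N k => (D N).measurable_outputs hact k)
    (fun N _ => (D N).measurable_history_ξ le_rfl)
    (ψ := fun _ x y' z => criticDrift α (M.kernelA act (ν₀ : Measure (HiddenUnit dx da))) y x y' z)
    (fun y' z => continuousOn_criticDrift _ y y' z)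
    (ψbar := fun t x => (M.field act α (ν₀ : Measure (HiddenUnit dx da)) t x).2 y)
    (fun t _ x => criticField_eq_average t x y)
    (fun N k z => (hD N).ξ_succ k z) hG hGX hGd hε

lemma eventually_abs_sum_actorDrift_sub_le
    (hD : ∀ N, (D N).IsOnlineNAC act α (ν₀ : Measure (HiddenUnit dx da)) (Pr N))
    (hM : M.IsErgodic) (hact : IsActivation act)
    (hG : ∀ N, MeasurableSet[(D N).history 0] (G N))
    (hGX : ∀ N, ∀ ω ∈ G N, ∀ k : ℕ, (k : ℝ) ≤ (N : ℕ) * T → ‖(D N).outputs act α k ω‖ ≤ R)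
    (hGd : ∀ N, ∀ ω ∈ G N, ∀ k : ℕ, (k : ℝ) + 1 ≤ (N : ℕ) * T →
      ‖(D N).outputs act α (k + 1) ω - (D N).outputs act α k ω‖ ≤ R / (N : ℕ))
    {ε : ℝ} (hε : 0 < ε) (y : M.SA) :
    ∀ᶠ p in probFilter Pr, p.2 ∈ G p.1 → ∀ n : ℕ, (n : ℝ) ≤ p.1 * T →
      |∑ k ∈ Finset.range n, (actorDrift (zeta ((k : ℝ) / p.1))
          (M.kernelA act (ν₀ : Measure (HiddenUnit dx da))) y
          ((D p.1).outputs act α k p.2) ((D p.1).ξt k p.2)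
        - (M.field act α (ν₀ : Measure (HiddenUnit dx da)) ((k : ℝ) / p.1)
          ((D p.1).outputs act α k p.2)).1 y)| ≤ ε * p.1 :=
  eventually_abs_sum_sub_policy_average_le M.pAux_nonneg M.sum_pAux hM.isLipschitzPolicyMap_visit
    (fun t x => M.isStationaryDist_visit (isPositivePolicy_explore_eta t x.1))
    (fun t x => hM.aux_irreducible _ (isPositivePolicy_explore_eta t x.1))
    (fun N => NACData.filtration (hD N)) (fun N k => (D N).measurable_outputs hact k)
    (fun N _ => (D N).measurable_history_ξt le_rfl)
    (ψ := fun t x y' _ => actorDrift (zeta t)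
      (M.kernelA act (ν₀ : Measure (HiddenUnit dx da))) y x y')
    (fun y' _ => continuousOn_actorDrift _ y y')
    (ψbar := fun t x => (M.field act α (ν₀ : Measure (HiddenUnit dx da)) t x).1 y)
    (fun t _ x => actorField_eq_average t x y)
    (fun N k z => (hD N).ξt_succ k z) hG hGX hGd hε

end Average

/-- The event that the initial outputs are bounded by `R` and the initial output weights by `1`. -/
def tameInit {N : ℕ} {Ω : Type*} (D : M.NACData N Ω) (act : ℝ → ℝ) (α R : ℝ) : Set Ω :=
  {ω | ‖D.outputs act α 0 ω‖ < R ∧ (∀ i, |(D.θ₀ ω i).1| ≤ 1) ∧ ∀ i, |(D.ϑ₀ ω i).1| ≤ 1}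

/-- The event depends on the initial parameters only and is known at time `0`; restricting to it
leaves the conditional laws of later samples usable in the averaging. -/
lemma measurableSet_tameInit (hact : IsActivation act) {N : ℕ} {Ω : Type*} (D : M.NACData N Ω)
    (R : ℝ) : MeasurableSet[D.history 0] (tameInit D act α R) := by
  have h (i : Fin N) : MeasurableSet {θ : Fin N → HiddenUnit dx da | |(θ i).1| ≤ 1} :=
    (isClosed_le (by fun_prop) continuous_const).measurableSet
  have h1 : MeasurableSet {x : M.Outputs | ‖x‖ < R} :=
    (isOpen_lt continuous_norm continuous_const).measurableSet
  have h2 : MeasurableSet {θ : Fin N → HiddenUnit dx da | ∀ i, |(θ i).1| ≤ 1} := by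
    rw [Set.ofPred_forall]
    exact MeasurableSet.iInter h
  exact (D.measurable_outputs hact 0 h1).inter
    ((D.measurable_history_θ₀ 0 h2).inter (D.measurable_history_ϑ₀ 0 h2))

end MDP

lemma abs_sum_smul_sub_le {u d f : ℕ → ℝ} {c e : ℝ} {n : ℕ} (h : ∀ k < n, |u k - d k| ≤ c)
    (h' : |∑ k ∈ Finset.range n, (d k - f k)| ≤ e) :
    |∑ k ∈ Finset.range n, (u k - f k)| ≤ n * c + e := by
  have e1 : ∑ k ∈ Finset.range n, (u k - f k)
      = ∑ k ∈ Finset.range n, (u k - d k) + ∑ k ∈ Finset.range n, (d k - f k) := by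
    rw [← Finset.sum_add_distrib]
    exact Finset.sum_congr rfl fun k _ => by ring
  rw [e1]
  refine (abs_add_le _ _).trans (add_le_add ((Finset.abs_sum_le_sum_abs _ _).trans ?_) h')
  refine (Finset.sum_le_sum fun k hk => h k (Finset.mem_range.1 hk)).trans ?_
  simp

section

variable {Ω : ℕ+ → Type*} [∀ N, MeasurableSpace (Ω N)] {Pr : ∀ N, Measure (Ω N)}

lemma eventually_le_div_natCast {c : ℝ} (hc : 0 < c) (K : ℝ) :
    ∀ᶠ p in probFilter Pr, K / (p.1 : ℕ) ≤ c := by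
  have h := (tendsto_const_div_atTop_nhds_zero_nat K).comp
    (tendsto_PNat_val_atTop_atTop.comp (tendsto_fst_probFilter (Pr := Pr)))
  exact (h.eventually (gt_mem_nhds hc)).mono fun _ hp => le_of_lt hp

lemma eventually_div_sqrt_le {c : ℝ} (hc : 0 < c) (K : ℝ) :
    ∀ᶠ p in probFilter Pr, K / √((p.1 : ℕ) : ℝ) ≤ c := by
  have h := (tendsto_const_nhds (x := K)).div_atTop (Real.tendsto_sqrt_atTop.comp
    (tendsto_natCast_atTop_atTop.comp
      (tendsto_PNat_val_atTop_atTop.comp (tendsto_fst_probFilter (Pr := Pr)))))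
  exact (h.eventually (gt_mem_nhds hc)).mono fun _ hp => le_of_lt hp

end

namespace MDP

variable {dx da : ℕ} {M : MDP dx da} {act : ℝ → ℝ} {α T : ℝ}
  {ν₀ : ProbabilityMeasure (HiddenUnit dx da)} {Ω : ℕ+ → Type*} [∀ N, MeasurableSpace (Ω N)]
  {Pr : ∀ N, Measure (Ω N)} [∀ N, IsProbabilityMeasure (Pr N)] {D : ∀ N : ℕ+, M.NACData N (Ω N)}

/-- The outputs follow the limit system, and the parameters stay close to their initial values,
uniformly on `[0,T]` and with high probability. -/
theorem eventually_norm_outputs_sub_flow_le (hM : M.IsErgodic) (hact : IsActivation act)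
    (hν₀ : IsInitLaw (ν₀ : Measure (HiddenUnit dx da))) (hα : 0 ≤ α) (hT : 0 ≤ T)
    (hD : ∀ N, (D N).IsOnlineNAC act α (ν₀ : Measure (HiddenUnit dx da)) (Pr N)) (R : ℝ) {r : ℝ}
    (hr : 0 < r) :
    ∀ᶠ p in probFilter Pr, ‖(D p.1).outputs act α 0 p.2‖ < R → ∀ n : ℕ, (n : ℝ) ≤ p.1 * T →
      ‖(D p.1).outputs act α n p.2 - flow (M.field act α (ν₀ : Measure (HiddenUnit dx da))) T
        ((D p.1).outputs act α 0 p.2) ((n : ℝ) / p.1)‖ ≤ r ∧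
      (∀ i, ‖((D p.1).state act α n p.2).1 i - (D p.1).θ₀ p.2 i‖ ≤ r) ∧
      ∀ i, ‖((D p.1).state act α n p.2).2 i - (D p.1).ϑ₀ p.2 i‖ ≤ r := by
  set A := M.kernelA act (ν₀ : Measure (HiddenUnit dx da)) with hA
  have hF := isTameField_field (act := act) (ν₀ := (ν₀ : Measure (HiddenUnit dx da))) hM hα T
  obtain ⟨K, hK1, hK⟩ := exists_outputPath_bounds M hact hα hT
  set S := 1 + |R| with hS
  have hS0 : 0 < S := by positivity
  have hKS : 0 < K * S ^ 2 := by positivity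
  -- On the event `tameInit` all outputs up to time `T` stay in the ball of radius `K * S`, where
  -- the Euler estimate is needed.
  obtain ⟨δ, hδ, N₀, hN₀⟩ := hF.exists_euler_le hT (K * S) hr
  have hZ := isInitArray_actor hD
  have hZ' := isInitArray_critic hD
  -- Once `1 / √N ≤ ε`, at most `N * T` linearisation errors of size `2 * ε * (K * S ^ 2)` sum to at
  -- most `δ / 2 * N`. The other half of `δ` is left to the averaging error.
  set ε := δ / (4 * (T + 1) * (K * S ^ 2)) with hε
  have hε0 : 0 < ε := by positivity
  have hpath : ∀ (N : ℕ+), ∀ ω ∈ tameInit (D N) act α R, ∀ k : ℕ, (k : ℝ) ≤ (N : ℕ) * T → _ :=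
    fun N ω hω k hk => hK N.pos ((D N).θ₀ ω) ((D N).ϑ₀ ω) (fun j => (D N).ξ j ω)
      (fun j => (D N).ξt j ω) hω.2.1 hω.2.2 S
      (add_le_add le_rfl (hω.1.le.trans (le_abs_self R))) k hk
  have hG := fun N => measurableSet_tameInit (α := α) hact (D N) R
  have hGX : ∀ (N : ℕ+), ∀ ω ∈ tameInit (D N) act α R, ∀ k : ℕ, (k : ℝ) ≤ (N : ℕ) * T →
      ‖(D N).outputs act α k ω‖ ≤ K * S := fun N ω hω k hk => (hpath N ω hω k hk).1
  have hGd : ∀ (N : ℕ+), ∀ ω ∈ tameInit (D N) act α R, ∀ k : ℕ, (k : ℝ) + 1 ≤ (N : ℕ) * T →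
      ‖(D N).outputs act α (k + 1) ω - (D N).outputs act α k ω‖ ≤ K * S / (N : ℕ) :=
    fun N ω hω k hk => (hpath N ω hω k (by linarith)).2.1
  filter_upwards [
    eventually_all.2 fun y => eventually_abs_sum_criticDrift_sub_le hD hM hact hG hGX hGd
      (half_pos hδ) y,
    eventually_all.2 fun y => eventually_abs_sum_actorDrift_sub_le hD hM hact hG hGX hGd
      (half_pos hδ) y,
    hZ.eventually_abs_empKernel_sub_le (M := M) hact hν₀ hε0,
    hZ'.eventually_abs_empKernel_sub_le (M := M) hact hν₀ hε0,
    hZ.eventually_abs_fst_le hν₀, hZ'.eventually_abs_fst_le hν₀,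
    eventually_div_sqrt_le hε0 1, eventually_div_sqrt_le hr (K * S),
    eventually_le_div_natCast one_pos (N₀ : ℝ)] with p h1 h2 h3 h4 h5 h6 h7 h8 h9 hR
  obtain ⟨N, ω⟩ := p
  dsimp only at *
  have hω : ω ∈ tameInit (D N) act α R := ⟨hR, h5, h6⟩
  have hN : (0 : ℝ) < (N : ℕ) := by exact_mod_cast N.pos
  have hN₀N : N₀ ≤ (N : ℕ) := by
    rw [div_le_one hN] at h9
    exact_mod_cast h9
  have hsum : ∀ n : ℕ, (n : ℝ) ≤ (N : ℕ) * T →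
      n * (K * S ^ 2 * (1 / √((N : ℕ) : ℝ) + ε)) + δ / 2 * (N : ℕ) ≤ δ * (N : ℕ) := by
    intro n hn
    have e1 : K * S ^ 2 * (1 / √((N : ℕ) : ℝ) + ε) ≤ K * S ^ 2 * (2 * ε) := by
      gcongr
      linarith
    have e2 : K * S ^ 2 * (2 * ε) = δ / (2 * (T + 1)) := by
      rw [hε]
      field_simp
      ring
    have e3 : (n : ℝ) * (K * S ^ 2 * (1 / √((N : ℕ) : ℝ) + ε))
        ≤ (N : ℕ) * T * (δ / (2 * (T + 1))) := by
      rw [← e2]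
      gcongr
    have e4 : T * (δ / (2 * (T + 1))) ≤ δ / 2 := by
      rw [← mul_div_assoc, div_le_div_iff₀ (by positivity) two_pos]
      nlinarith
    nlinarith [mul_le_mul_of_nonneg_left e4 hN.le]
  have heuler := hN₀ N hN₀N N.pos (fun k => (D N).outputs act α k ω) (hGX N ω hω) (by
    intro n hn
    have hk : ∀ k < n, (k : ℝ) ≤ (N : ℕ) * T := fun k hk =>
      (Nat.cast_le.2 hk.le).trans hn
    rw [norm_prod_le_iff]
    constructor <;> refine (pi_norm_le_iff_of_nonneg (by positivity)).2 fun y => ?_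
    · have h := abs_sum_smul_sub_le
        (fun k hkn => ((hpath N ω hω k (hk k hkn)).2.2.2.2 A ε hε0.le h3 h4 y).1)
        (h2 y hω n hn)
      refine le_trans (le_of_eq ?_) (h.trans (hsum n hn))
      rw [Real.norm_eq_abs, Prod.fst_sum, Finset.sum_apply]
      rfl
    · have h := abs_sum_smul_sub_le
        (fun k hkn => ((hpath N ω hω k (hk k hkn)).2.2.2.2 A ε hε0.le h3 h4 y).2)
        (h1 y hω n hn)
      refine le_trans (le_of_eq ?_) (h.trans (hsum n hn))
      rw [Real.norm_eq_abs, Prod.snd_sum, Finset.sum_apply]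
      rfl)
  intro n hn
  exact ⟨heuler n hn, fun i => ((hpath N ω hω n hn).2.2.1 i).trans h8,
    fun i => ((hpath N ω hω n hn).2.2.2.1 i).trans h8⟩

/-- The process is close to the solution of the limit system that starts in the initial outputs. -/
theorem eventually_edist_process_limitPath_lt (hM : M.IsErgodic) (hact : IsActivation act)
    (hν₀ : IsInitLaw (ν₀ : Measure (HiddenUnit dx da))) (hα : 0 ≤ α) (hT : 0 ≤ T)
    (hD : ∀ N, (D N).IsOnlineNAC act α (ν₀ : Measure (HiddenUnit dx da)) (Pr N)) (R : ℝ)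
    {δ : ℝ≥0∞} (hδ : 0 < δ) :
    ∀ᶠ p in probFilter Pr, ‖(D p.1).outputs act α 0 p.2‖ < R →
      edist ((D p.1).process act α T p.2)
        (limitPath act ν₀ hM hα hT ((D p.1).outputs act α 0 p.2)) < δ := by
  have hF := isTameField_field (act := act) (ν₀ := (ν₀ : Measure (HiddenUnit dx da))) hM hα T
  obtain ⟨r, hr0, hrδ⟩ := ENNReal.lt_iff_exists_nnreal_btwn.1 hδ
  have hr : (0 : ℝ) < r := by exact_mod_cast hr0
  obtain ⟨L, hL⟩ := hF.exists_norm_flow_sub_le hT R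
  have hr2 : (0 : ℝ≥0∞) < ENNReal.ofReal (r / 2) := by simpa using hr
  have hsum : ENNReal.ofReal (r / 2) + ENNReal.ofReal (r / 2) = r := by
    rw [← ENNReal.ofReal_add (by positivity) (by positivity), add_halves, ENNReal.ofReal_coe_nnreal]
  filter_upwards [eventually_norm_outputs_sub_flow_le hM hact hν₀ hα hT hD R (half_pos hr),
    (isInitArray_actor hD).eventually_edist_empirical_lt hr2,
    (isInitArray_critic hD).eventually_edist_empirical_lt hr2,
    eventually_le_div_natCast (half_pos hr) |L|] with p h1 h2 h3 h4 hR
  obtain ⟨N, ω⟩ := p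
  dsimp only at *
  have hN : (0 : ℝ) < (N : ℕ) := by exact_mod_cast N.pos
  refine (CadlagPath.edist_le_of_forall fun t => ?_).trans_lt hrδ
  set n := ⌊((N : ℕ) : ℝ) * t⌋₊ with hn
  have ht0 : 0 ≤ ((N : ℕ) : ℝ) * t := mul_nonneg hN.le t.2.1
  have hnt : (n : ℝ) ≤ (N : ℕ) * t := Nat.floor_le ht0
  have hnt' : ((N : ℕ) : ℝ) * t < n + 1 := Nat.lt_floor_add_one _
  obtain ⟨ho, hθ, hϑ⟩ := h1 hR n (hnt.trans (mul_le_mul_of_nonneg_left t.2.2 hN.le))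
  have hemp : ∀ θ θ' : Fin N → HiddenUnit dx da, (∀ i, ‖θ i - θ' i‖ ≤ r / 2) →
      edist (LevyProkhorov.ofMeasure (empirical N θ')) (LevyProkhorov.ofMeasure ν₀)
        < ENNReal.ofReal (r / 2) →
      edist (LevyProkhorov.ofMeasure (empirical N θ)) (LevyProkhorov.ofMeasure ν₀) ≤ r := by
    intro θ θ' h h'
    refine (edist_triangle _ _ _).trans ((add_le_add ?_ h'.le).trans hsum.le)
    refine edist_ofMeasure_empirical_le N fun i => ?_
    rw [edist_dist, dist_eq_norm]
    exact ENNReal.ofReal_le_ofReal (h i)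
  have hflow : edist ((D N).outputs act α n ω)
      (flow (M.field act α (ν₀ : Measure (HiddenUnit dx da))) T ((D N).outputs act α 0 ω) t)
        ≤ r := by
    rw [edist_dist, dist_eq_norm, ← ENNReal.ofReal_coe_nnreal]
    refine ENNReal.ofReal_le_ofReal ?_
    -- The process is constant between grid points, whereas the flow moves by at most `|L| / N` from
    -- `n / N` to `t`.
    have h5 := hL _ hR.le ((n : ℝ) / (N : ℕ)) t (by positivity)
      ((div_le_iff₀ hN).2 (by linarith)) t.2.2
    have h6 : L * ((t : ℝ) - (n : ℝ) / (N : ℕ)) ≤ r / 2 := by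
      refine le_trans ?_ h4
      have h7 : (t : ℝ) - (n : ℝ) / (N : ℕ) ≤ 1 / (N : ℕ) := by
        rw [sub_le_iff_le_add, ← add_div, le_div_iff₀ hN]
        linarith
      have h8 : 0 ≤ (t : ℝ) - (n : ℝ) / (N : ℕ) := by
        rw [sub_nonneg, div_le_iff₀ hN]
        linarith
      calc _ ≤ |L| * (1 / (N : ℕ)) := mul_le_mul (le_abs_self L) h7 h8 (abs_nonneg L)
        _ = _ := by ring
    rw [norm_sub_rev] at h5
    have h9 := norm_sub_le_norm_sub_add_norm_sub ((D N).outputs act α n ω)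
      (flow (M.field act α (ν₀ : Measure (HiddenUnit dx da))) T ((D N).outputs act α 0 ω)
        ((n : ℝ) / (N : ℕ)))
      (flow (M.field act α (ν₀ : Measure (HiddenUnit dx da))) T ((D N).outputs act α 0 ω) t)
    linarith
  exact max_le (hemp _ _ hθ h2) (max_le (hemp _ _ hϑ h3) hflow)

end MDP

theorem theorem1 {dx da : ℕ} (M : MDP dx da) (hM : M.IsErgodic)
    (act : ℝ → ℝ) (hact : IsActivation act)
    (ν₀ : ProbabilityMeasure (HiddenUnit dx da))
    (hν₀ : IsInitLaw (ν₀ : Measure (HiddenUnit dx da)))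
    (α : ℝ) (hα : 0 < α) (T : ℝ) (hT : 0 < T)
    {Ω : ℕ+ → Type*} [∀ N, MeasurableSpace (Ω N)] (Pr : ∀ N, Measure (Ω N))
    [∀ N, IsProbabilityMeasure (Pr N)]
    (D : ∀ N : ℕ+, M.NACData N (Ω N))
    (hD : ∀ N, (D N).IsOnlineNAC act α (ν₀ : Measure (HiddenUnit dx da)) (Pr N)) :
    -- the limit system has exactly one solution from every initial condition
    (∀ p₀ q₀ : M.SA → ℝ, ∃! z : CadlagPath T M.E, M.IsLimitPath act α T ν₀ p₀ q₀ z) ∧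
    ∃ (Ω' : Type) (_ : MeasurableSpace Ω') (Pr' : Measure Ω') (_ : IsProbabilityMeasure Pr')
      (G H : Ω' → M.SA → ℝ) (Z : Ω' → CadlagPath T M.E),
      -- `(G, H)` is a centred Gaussian vector, the weak limit of `(P_0^N, Q_0^N)`
      HasGaussianLaw (fun ω => (G ω, H ω)) Pr' ∧
      IndepFun G H Pr' ∧
      (∀ ξ, ∫ ω, G ω ξ ∂Pr' = 0) ∧
      (∀ ξ, ∫ ω, H ω ξ ∂Pr' = 0) ∧
      (∀ ξ ξ', ∫ ω, G ω ξ * G ω ξ' ∂Pr' = M.initCov act ν₀ ξ ξ') ∧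
      (∀ ξ ξ', ∫ ω, H ω ξ * H ω ξ' ∂Pr' = M.initCov act ν₀ ξ ξ') ∧
      TendstoInDistribution (fun N ω => ((D N).P act α 0 ω, (D N).Q act α 0 ω)) atTop
        (fun ω => (G ω, H ω)) Pr Pr' ∧
      -- the limit process solves the limit system from `(G, H)`
      (∀ ω, M.IsLimitPath act α T ν₀ (G ω) (H ω) (Z ω)) ∧
      -- weak convergence in the Skorokhod space
      TendstoInDistribution (fun N => (D N).process act α T) atTop Z Pr Pr' := by

  refine ⟨fun p₀ q₀ => MDP.existsUnique_isLimitPath hM hα.le hT.le p₀ q₀, ?_⟩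
  obtain ⟨Ω', mΩ', Pr', hPr', G, H, hGauss, hind, hmG, hmH, hcG, hcH, hlim⟩ :=
    MDP.exists_gaussian_limit hact hν₀ hD
  -- The limit process is the solution map applied to the Gaussian limit `(G, H)`, and the same map
  -- is applied to the initial outputs of the finite networks.
  exact ⟨Ω', mΩ', Pr', hPr', G, H, fun ω => MDP.limitPath act ν₀ hM hα.le hT.le (G ω, H ω),
    hGauss, hind, hmG, hmH, hcG, hcH, hlim,
    fun ω => MDP.isLimitPath_limitPath hM hα.le hT.le (G ω, H ω),
    tendstoInDistribution_of_local_approx hlim (MDP.continuous_limitPath hM hα.le hT.le)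
      (fun N => (MDP.measurable_process hact (hD N)).aemeasurable)
      fun R _ hδ => MDP.eventually_edist_process_limitPath_lt hM hact hν₀ hα.le hT.le hD R hδ⟩
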